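/- All graphs are finite, simple, undirected and connected, and all embeddings of graphs on closed surfaces are cellular. An embedding of a graph is called \emph{strong} if every facial walk is a cycle of the graph. An \emph{Apollonian network} is a planar graph obtained from the complete graph $K_4$ by a finite (possibly empty) sequence of steps, each of which picks a triangular face of the graph embedded on the sphere and adds a new vertex that is adjacent to exactly the three vertices of this face. An \emph{Apollonian dual} is a graph isomorphic to the dual graph, with respect to an embedding on the sphere, of an Apollonian network. Theorem. Let $G$ be a $3$-connected cubic planar graph. Then $G$ is an Apollonian dual if and only if $G$ has no strong embedding on any orientable surface of positive genus. -/

import Mathlib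

namespace SimpleGraph

universe u

variable {V : Type u}

/-- A finite graph is `3`-connected: it has more than three vertices, and it remains connected
after the deletion of any set of fewer than three vertices. -/
def IsThreeConnected (G : SimpleGraph V) : Prop :=
  3 < Nat.card V ∧ ∀ S : Set V, S.Finite → S.ncard < 3 → (G.induce Sᶜ).Connected

/-- A rotation system of a graph: a permutation of the darts (oriented edges) which, for each
vertex `v`, permutes the darts leaving `v` cyclically. It gives the cyclic order of the edges
around each vertex. By the Heffter–Edmonds principle, the rotation systems of a finite connected
graph are the cellular embeddings of the graph on closed oriented surfaces (no edge is twisted). -/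
structure RotationSystem (G : SimpleGraph V) where
  /-- The successor of a dart in the cyclic order around its tail. -/
  rot : Equiv.Perm G.Dart
  /-- The darts with tail `v` form one cycle. -/
  isCycleOn : ∀ v : V, rot.IsCycleOn {d : G.Dart | d.fst = v}

namespace RotationSystem

variable {G : SimpleGraph V}

/-- Face traversal: walk along the dart `d` to its head, and leave along the dart that follows the
reverse of `d` in the cyclic order around that vertex. -/
def next (R : RotationSystem G) : Equiv.Perm G.Dart :=
  (Function.Involutive.toPerm (Dart.symm : G.Dart → G.Dart) Dart.symm_involutive).trans R.rot

/-- The faces (cells) of the embedding are the orbits of the face traversal; the facial walk of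
the face of `d` is `d, next d, next (next d), …` up to the first return to `d`. -/
def Face (R : RotationSystem G) : Type u :=
  Quotient (Equiv.Perm.SameCycle.setoid R.next)

/-- The face whose facial walk traverses the dart `d`. -/
def faceOf (R : RotationSystem G) (d : G.Dart) : R.Face :=
  Quotient.mk (Equiv.Perm.SameCycle.setoid R.next) d

/-- The embedding of the connected graph `G` (with at least one edge) given by `R` is on the
orientable closed connected surface of genus `g`, as read off from Euler's formula
`|V| - |E| + |F| = 2 - 2g`. -/
def HasGenus (R : RotationSystem G) (g : ℕ) : Prop :=
  G.Connected ∧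
    (Nat.card V : ℤ) - (Nat.card G.edgeSet : ℤ) + (Nat.card R.Face : ℤ) = 2 - 2 * (g : ℤ)

/-- The embedding is strong: every facial walk is a cycle, i.e. it meets no vertex twice and has
length at least three (length one cannot occur, since `G` has no loops). -/
def IsStrong (R : RotationSystem G) : Prop :=
  (∀ d d' : G.Dart, R.faceOf d = R.faceOf d' → d.fst = d'.fst → d = d') ∧
    ∀ d : G.Dart, R.next (R.next d) ≠ d

/-- The dual graph of the embedded graph: its vertices are the faces, and two distinct faces are
adjacent when they lie on the two sides of a common edge. -/
def dualGraph (R : RotationSystem G) : SimpleGraph R.Face where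
  Adj f₁ f₂ := f₁ ≠ f₂ ∧ ∃ d : G.Dart, R.faceOf d = f₁ ∧ R.faceOf d.symm = f₂
  symm := ⟨fun _ _ ⟨hne, d, h₁, h₂⟩ => ⟨hne.symm, d.symm, h₂, by rw [Dart.symm_symm]; exact h₁⟩⟩
  loopless := ⟨fun _ h => h.1 rfl⟩

end RotationSystem

/-- `G` is planar: it has an embedding on the sphere (genus `0`). -/
def IsPlanar (G : SimpleGraph V) : Prop :=
  ∃ R : RotationSystem G, R.HasGenus 0

/-- `G` has a strong embedding on the orientable surface of genus `g`. -/
def HasStrongOrientableEmbedding (G : SimpleGraph V) (g : ℕ) : Prop :=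
  ∃ R : RotationSystem G, R.HasGenus g ∧ R.IsStrong

/-- Subdivision of the triangle `a, b, c`: add a new vertex `none` adjacent to exactly
`a`, `b` and `c`. -/
def subdivideTriangle (T : SimpleGraph V) (a b c : V) : SimpleGraph (Option V) where
  Adj x y :=
    match x, y with
    | some u, some v => T.Adj u v
    | some u, none => u = a ∨ u = b ∨ u = c
    | none, some v => v = a ∨ v = b ∨ v = c
    | none, none => False
  symm := ⟨fun x y h => by
    cases x <;> cases y <;> first | exact h | exact h.symm⟩
  loopless := ⟨fun x h => by
    cases x
    · exact h
    · exact T.loopless.irrefl _ h⟩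

/-- Apollonian networks: start from `K₄` and repeatedly subdivide a triangular face of an
embedding on the sphere. The triangular face is given by a dart `d` with `next³ d = d`; its
vertices are the tails of `d`, `next d` and `next (next d)`. Vertices carry the labels that arise
from the construction, so that every Apollonian network occurs up to isomorphism. -/
inductive IsApollonianNetwork : {W : Type} → SimpleGraph W → Prop
  | completeGraph : IsApollonianNetwork (⊤ : SimpleGraph (Fin 4))
  | subdivide {W : Type} (T : SimpleGraph W) (hT : IsApollonianNetwork T)
      (R : RotationSystem T) (hR : R.HasGenus 0)
      (d : T.Dart) (hd : R.next (R.next (R.next d)) = d) :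
      IsApollonianNetwork (T.subdivideTriangle d.fst (R.next d).fst (R.next (R.next d)).fst)

/-- `G` is an Apollonian dual: it is isomorphic to the dual graph of an Apollonian network
embedded on the sphere. -/
def IsApollonianDual (G : SimpleGraph V) : Prop :=
  ∃ (W : Type) (T : SimpleGraph W) (R : RotationSystem T),
    IsApollonianNetwork T ∧ R.HasGenus 0 ∧ Nonempty (G ≃g R.dualGraph)

end SimpleGraph

/-! The plane dual `T` of a 3-connected cubic planar graph `G` is a simple triangulation of the
sphere (`IsThreeConnected.isDualSimple`). At a cubic vertex only two rotations exist, so an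
orientable embedding of `G` is a two-colouring of the faces of `T`, recording where it agrees with
the plane rotation (`dualColor`). Its facial walks are walks through the faces of `T` that turn left
or right by colour (`colorWalk`). It is strong when no such walk visits a face twice
(`IsStrongColoring`).

From Apollonian to genus zero: a strong colouring is constant around a vertex of degree three
(`IsStrongColoring.color_rot_eq`), and stays strong when that vertex is deleted
(`IsDeletion.isStrongColoring`). Induction down to `K₄` shows that strong colourings of an
Apollonian network are constant (`IsApollonianNetwork.color_eq`). A constant colouring is the plane
embedding or its mirror image (`IsTriangulated.card_face_of_const`).

Conversely, suppose `T` contains an induced disjoint union of even cycles. Colour the faces by the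
side of these cycles. Each walk then circles a vertex, switching to the other end whenever it
crosses a cycle edge. A proper two-colouring of the cycles gives an invariant showing that the
embedding is strong. Two cycle edges at a common vertex lie on the same facial walks; in genus zero
their duals would form a cut of `G`, which is impossible (`IsEvenTwoRegular.exists_strong`).

It remains to find even induced cycles in `T` unless it is Apollonian. Deleting vertices of degree
three leads to `K₄` or to minimum degree at least four (`exists_isApollonianNetwork_iso`). In the
second case an innermost argument on separating triangles gives adjacent vertices with induced links
(`hasInducedLink_of_minimal`, `HasGenus.exists_hasInducedLink`). An even link is the desired cycle.
If both degrees are odd, the boundary of the union of the two stars is even; it is induced unless a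
4-cycle through the two vertices is.

All topology rests on homology mod 2 of a pair of permutations (`exists_coboundary_eq`): in genus
zero, cycles are boundaries of sets of faces. -/

namespace Equiv.Perm

/-! ### Cycles of permutations and homology mod 2 of combinatorial maps. -/

variable {D : Type*}

/-- The `ZMod 2`-valued functions that are constant along the cycles of a permutation. -/
def invariantFun (π : Perm D) : Submodule (ZMod 2) (D → ZMod 2) where
  carrier := {f | ∀ d, f (π d) = f d}
  add_mem' := fun hf hg d => by simp [hf d, hg d]
  zero_mem' := fun _ => rfl
  smul_mem' := fun a f hf d => by simp [hf d]

theorem mem_invariantFun {π : Perm D} {f : D → ZMod 2} :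
    f ∈ invariantFun π ↔ ∀ d, f (π d) = f d := Iff.rfl

theorem SameCycle.apply_eq_of_forall {β : Type*} {π : Perm D} {f : D → β}
    (hf : ∀ d, f (π d) = f d) {a b : D} (h : SameCycle π a b) : f a = f b := by
  obtain ⟨n, rfl⟩ := h
  have key : ∀ n : ℤ, ∀ d, f ((π ^ n) d) = f d := by
    intro n
    induction n using Int.induction_on with
    | zero => simp
    | succ i ih => intro d; rw [zpow_add_one, mul_apply, ih, hf]
    | pred i ih =>
      intro d
      rw [zpow_sub_one, mul_apply, ih, ← hf (π⁻¹ d), show π (π⁻¹ d) = d from π.apply_symm_apply d]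
  exact (key n a).symm

theorem finrank_invariantFun [Finite D] (π : Perm D) :
    Module.finrank (ZMod 2) (invariantFun π) = Nat.card (Quotient (SameCycle.setoid π)) := by
  classical
  have := Fintype.ofFinite D
  have : Fintype (Quotient (SameCycle.setoid π)) := Fintype.ofFinite _
  let L := LinearMap.funLeft (ZMod 2) (ZMod 2) (Quotient.mk (SameCycle.setoid π))
  have hinj : Function.Injective L :=
    LinearMap.funLeft_injective_of_surjective _ _ _ Quotient.mk_surjective
  have hrange : LinearMap.range L = invariantFun π := by
    ext f
    constructor
    · rintro ⟨g, rfl⟩ d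
      change g _ = g _
      congr 1
      exact Quotient.sound ((SameCycle.refl π d).apply_left)
    · intro hf
      refine ⟨fun q => Quotient.lift f (fun a b h => SameCycle.apply_eq_of_forall hf h) q, ?_⟩
      ext d
      rfl
  rw [← hrange, LinearMap.finrank_range_of_inj hinj, Module.finrank_fintype_fun_eq_card,
    Nat.card_eq_fintype_card]

/-- The sign of a permutation in terms of the number of its cycles, fixed points included. -/
theorem sign_eq_pow_card_quotient [Fintype D] [DecidableEq D] (π : Perm D) :
    sign π = (-1) ^ (Fintype.card D + Nat.card (Quotient (SameCycle.setoid π))) := by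
  -- A complete invariant of the cycle of a point. Fixed points all have the trivial `cycleOf`, so
  -- they need labels of their own.
  let q : D → Perm D ⊕ D := fun x => if π x = x then Sum.inr x else Sum.inl (cycleOf π x)
  have hq : ∀ x y, SameCycle π x y ↔ q x = q y := by
    intro x y
    constructor
    · intro h
      by_cases hx : π x = x
      · have : x = y := h.eq_of_left hx
        rw [this]
      · have hy : π y ≠ y := fun hy => hx (h.apply_eq_self_iff.mpr hy)
        simp only [q, hx, hy, if_false]
        rw [h.cycleOf_eq]
    · intro h
      by_cases hx : π x = x <;> by_cases hy : π y = y <;>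
        simp only [q, hx, hy, if_true, if_false] at h
      · rw [Sum.inr.inj h]
      · exact absurd h (by simp)
      · exact absurd h (by simp)
      · exact (sameCycle_iff_cycleOf_eq_of_mem_support (mem_support.mpr hx)
          (mem_support.mpr hy)).mpr (Sum.inl.inj h)
  have hcard : Nat.card (Quotient (SameCycle.setoid π)) = (Set.range q).ncard := by
    rw [← Nat.card_coe_set_eq]
    exact Nat.card_congr ((Quotient.congrRight fun a b => hq a b).trans
      (Setoid.quotientKerEquivRange q))
  have hrange : Set.range q =
      ((π.cycleFactorsFinset.disjSum (Finset.univ.filter fun x => π x = x) : Finset _) :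
        Set (Perm D ⊕ D)) := by
    ext z
    simp only [Set.mem_range, Finset.mem_coe, Finset.mem_disjSum, Finset.mem_filter,
      Finset.mem_univ, true_and]
    constructor
    · rintro ⟨x, rfl⟩
      by_cases hx : π x = x
      · right; exact ⟨x, hx, by simp [q, hx]⟩
      · left
        exact ⟨cycleOf π x, cycleOf_mem_cycleFactorsFinset_iff.mpr (mem_support.mpr hx),
          by simp [q, hx]⟩
    · rintro (⟨c, hc, rfl⟩ | ⟨x, hx, rfl⟩)
      · obtain ⟨x, hx⟩ := (mem_cycleFactorsFinset_iff.mp hc).1.nonempty_support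
        have hx' : π x ≠ x := by
          rw [← (mem_cycleFactorsFinset_iff.mp hc).2 x hx]; exact mem_support.mp hx
        exact ⟨x, by simp [q, hx', ← cycle_is_cycleOf hx hc]⟩
      · exact ⟨x, by simp [q, hx]⟩
  rw [hcard, hrange, Set.ncard_coe_finset, Finset.card_disjSum, sign_of_cycleType,
    sum_cycleType, cycleType_def]
  have h1 : (Finset.univ.filter fun x => π x = x).card + π.support.card = Fintype.card D := by
    rw [← Finset.card_univ, ← Finset.card_filter_add_card_filter_not (s := Finset.univ)
      (fun x => π x = x)]
    rfl
  rw [← h1]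
  simp only [Multiset.card_map, Finset.card_val]
  rw [show (Finset.univ.filter fun x => π x = x).card + π.support.card +
    (π.cycleFactorsFinset.card + (Finset.univ.filter fun x => π x = x).card) =
    2 * (Finset.univ.filter fun x => π x = x).card +
      (π.support.card + π.cycleFactorsFinset.card) by ring]
  simp [pow_add _ (2 * _), pow_mul]

section Homology

variable {α σ : Perm D}

/-- The summands at `d` and `α d` are equal and cancel mod 2. Thus edge functions form an isotropic
space. -/
theorem sum_mul_eq_zero_of_involutive [Fintype D] (hα : ∀ d, α (α d) = d) (hα' : ∀ d, α d ≠ d)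
    {x y : D → ZMod 2} (hx : x ∈ invariantFun α) (hy : y ∈ invariantFun α) :
    ∑ d, x d * y d = 0 := by
  refine Finset.sum_involution (fun d _ => α d) ?_ (fun d _ _ => hα' d) (fun d _ => Finset.mem_univ _)
    (fun d _ => hα d)
  intro d _
  rw [hx d, hy d]
  exact CharTwo.add_self_eq_zero _

/-- The sum of a function and its reflection under `α`, as a linear map. -/
def coboundary (α : Perm D) : (D → ZMod 2) →ₗ[ZMod 2] (D → ZMod 2) :=
  LinearMap.id + LinearMap.funLeft (ZMod 2) (ZMod 2) α

theorem coboundary_apply (c : D → ZMod 2) (d : D) : coboundary α c d = c d + c (α d) := rfl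

theorem ker_coboundary : LinearMap.ker (coboundary α) = invariantFun α := by
  ext c
  rw [LinearMap.mem_ker, mem_invariantFun, funext_iff]
  refine forall_congr' fun d => ?_
  rw [coboundary_apply, Pi.zero_apply, CharTwo.add_eq_zero, eq_comm]

theorem coboundary_mem_invariantFun (hα : ∀ d, α (α d) = d) (c : D → ZMod 2) :
    coboundary α c ∈ invariantFun α := by
  intro d
  rw [coboundary_apply, coboundary_apply, hα, add_comm]

theorem card_le_two_mul_finrank_invariantFun [Fintype D] (hα : ∀ d, α (α d) = d) :
    Fintype.card D ≤ 2 * Module.finrank (ZMod 2) (invariantFun α) := by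
  have h := LinearMap.finrank_range_add_finrank_ker (coboundary α)
  rw [Module.finrank_fintype_fun_eq_card, ker_coboundary] at h
  have : LinearMap.range (coboundary α) ≤ invariantFun α := by
    rintro _ ⟨c, rfl⟩
    exact coboundary_mem_invariantFun hα c
  have := Submodule.finrank_mono this
  omega

/-- The functions orthogonal to all `α`-invariant and all `σ`-invariant functions. -/
def orthogonalFun [Fintype D] (α σ : Perm D) : Submodule (ZMod 2) (D → ZMod 2) :=
  LinearMap.BilinForm.orthogonal (dotProductBilin (ZMod 2) (ZMod 2))
    (invariantFun α ⊔ invariantFun σ)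

theorem mem_orthogonalFun [Fintype D] {x : D → ZMod 2} :
    x ∈ orthogonalFun α σ ↔
      (∀ f ∈ invariantFun α, ∑ d, f d * x d = 0) ∧ ∀ f ∈ invariantFun σ, ∑ d, f d * x d = 0 := by
  rw [orthogonalFun, LinearMap.BilinForm.mem_orthogonal_iff]
  constructor
  · intro h
    exact ⟨fun f hf => h f (Submodule.mem_sup_left hf), fun f hf => h f (Submodule.mem_sup_right hf)⟩
  · rintro ⟨h₁, h₂⟩ f hf
    obtain ⟨a, ha, b, hb, rfl⟩ := Submodule.mem_sup.mp hf
    change ∑ d, (a d + b d) * x d = 0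
    simp only [add_mul, Finset.sum_add_distrib]
    rw [h₁ a ha, h₂ b hb, add_zero]

theorem finrank_orthogonalFun_add [Fintype D] :
    Module.finrank (ZMod 2) (orthogonalFun α σ) +
      Module.finrank (ZMod 2) (invariantFun α ⊔ invariantFun σ : Submodule _ _) =
        Fintype.card D := by
  classical
  have hB : LinearMap.BilinForm.Nondegenerate
      (dotProductBilin (ZMod 2) (ZMod 2) : LinearMap.BilinForm (ZMod 2) (D → ZMod 2)) := by
    refine ⟨fun x hx => ?_, fun x hx => ?_⟩
    · ext d
      simpa [dotProductBilin] using hx (Pi.single d 1)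
    · ext d
      simpa [dotProductBilin] using hx (Pi.single d 1)
  have h := LinearMap.BilinForm.finrank_orthogonal hB (invariantFun α ⊔ invariantFun σ)
  have h2 := Submodule.finrank_le (invariantFun α ⊔ invariantFun σ)
  rw [Module.finrank_fintype_fun_eq_card] at h h2
  rw [orthogonalFun]
  omega

theorem finrank_invariantFun_inf_le [Fintype D]
    (hconn : ∀ f ∈ invariantFun α ⊓ invariantFun σ, ∀ d e, f d = f e) :
    Module.finrank (ZMod 2) (invariantFun α ⊓ invariantFun σ : Submodule _ _) ≤ 1 := by
  have : invariantFun α ⊓ invariantFun σ ≤ Submodule.span (ZMod 2) {fun _ => 1} := by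
    intro f hf
    rw [Submodule.mem_span_singleton]
    rcases isEmpty_or_nonempty D with h | ⟨⟨d⟩⟩
    · exact ⟨0, funext fun d => h.elim d⟩
    · refine ⟨f d, funext fun e => ?_⟩
      simp [hconn f hf d e]
  exact (Submodule.finrank_mono this).trans ((finrank_span_le_card _).trans (by simp))

/-- The boundary of a set of faces meets each vertex evenly: `c (α d) = c (σ d)`, so reindexing by
`σ` makes the two halves of the sum equal. -/
theorem coboundary_mem_orthogonalFun [Fintype D] (hα : ∀ d, α (α d) = d) (hα' : ∀ d, α d ≠ d)
    {c : D → ZMod 2} (hc : c ∈ invariantFun (σ * α)) :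
    coboundary α c ∈ orthogonalFun α σ := by
  rw [mem_orthogonalFun]
  refine ⟨fun f hf => sum_mul_eq_zero_of_involutive hα hα' hf (coboundary_mem_invariantFun hα c),
    fun f hf => ?_⟩
  have h1 : ∑ d, f d * c (α d) = ∑ d, f d * c d := by
    rw [← Equiv.sum_comp σ (fun d => f d * c d)]
    refine Finset.sum_congr rfl fun d _ => ?_
    rw [hf d, ← hc (α d), mul_apply, hα]
  simp only [coboundary_apply, mul_add, Finset.sum_add_distrib]
  rw [h1]
  exact CharTwo.add_self_eq_zero _

/-- A face function with zero coboundary is invariant under `α`, hence under `σ`, hence constant. So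
the boundaries have dimension at least the number of faces minus one. -/
theorem finrank_map_coboundary_add_one_ge [Fintype D] (hα : ∀ d, α (α d) = d)
    (hconn : ∀ f ∈ invariantFun α ⊓ invariantFun σ, ∀ d e, f d = f e) :
    Module.finrank (ZMod 2) (invariantFun (σ * α)) ≤
      Module.finrank (ZMod 2) ((invariantFun (σ * α)).map (coboundary α)) + 1 := by
  have h := LinearMap.finrank_range_add_finrank_ker
    ((coboundary α).domRestrict (invariantFun (σ * α)))
  rw [LinearMap.range_domRestrict] at h
  have hker : Module.finrank (ZMod 2)
      (LinearMap.ker ((coboundary α).domRestrict (invariantFun (σ * α)))) ≤ 1 := by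
    refine le_trans ?_ (finrank_invariantFun_inf_le hconn)
    let L : LinearMap.ker ((coboundary α).domRestrict (invariantFun (σ * α))) →ₗ[ZMod 2]
        (invariantFun α ⊓ invariantFun σ : Submodule _ _) :=
      { toFun := fun c => ⟨c.1.1, by
          have h1 : c.1.1 ∈ invariantFun α := by
            rw [← ker_coboundary]; exact c.2
          refine ⟨h1, fun d => ?_⟩
          have h2 := c.1.2 (α d)
          rw [mul_apply, hα, h1 d] at h2
          exact h2⟩
        map_add' := fun _ _ => rfl
        map_smul' := fun _ _ => rfl }
    refine LinearMap.finrank_le_finrank_of_injective (f := L) fun a b hab => ?_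
    exact Subtype.ext (Subtype.ext (congrArg (fun z => z.1) hab))
  omega

theorem map_coboundary_le [Fintype D] (hα : ∀ d, α (α d) = d) (hα' : ∀ d, α d ≠ d) :
    (invariantFun (σ * α)).map (coboundary α) ≤ orthogonalFun α σ := by
  rintro _ ⟨c, hc, rfl⟩
  exact coboundary_mem_orthogonalFun hα hα' hc

/-- The cycle space has dimension at most `E - V + 1`, where `2 * E` is the number of darts and `V`
the number of cycles of `σ`. -/
theorem finrank_orthogonalFun_bound [Fintype D] (hα : ∀ d, α (α d) = d)
    (hconn : ∀ f ∈ invariantFun α ⊓ invariantFun σ, ∀ d e, f d = f e) :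
    2 * (Module.finrank (ZMod 2) (orthogonalFun α σ) +
      Module.finrank (ZMod 2) (invariantFun σ)) ≤ Fintype.card D + 2 := by
  have h1 := finrank_orthogonalFun_add (α := α) (σ := σ)
  have h2 := Submodule.finrank_sup_add_finrank_inf_eq (invariantFun α) (invariantFun σ)
  have h3 := finrank_invariantFun_inf_le hconn
  have h4 := card_le_two_mul_finrank_invariantFun hα
  omega

/-- The Euler characteristic of a connected combinatorial map is at most `2`. -/
theorem card_quotient_add_card_quotient_le [Fintype D] (hα : ∀ d, α (α d) = d)
    (hα' : ∀ d, α d ≠ d)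
    (hconn : ∀ f ∈ invariantFun α ⊓ invariantFun σ, ∀ d e, f d = f e) :
    2 * (Nat.card (Quotient (SameCycle.setoid σ)) +
      Nat.card (Quotient (SameCycle.setoid (σ * α)))) ≤ Fintype.card D + 4 := by
  rw [← finrank_invariantFun, ← finrank_invariantFun]
  have h1 := finrank_map_coboundary_add_one_ge hα hconn
  have h2 := Submodule.finrank_mono (map_coboundary_le (σ := σ) hα hα')
  have h3 := finrank_orthogonalFun_bound hα hconn
  omega

/-- On a connected combinatorial map of genus zero every edge function that is orthogonal to
all vertex functions is the coboundary of a face function. -/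
theorem exists_coboundary_eq [Fintype D] (hα : ∀ d, α (α d) = d) (hα' : ∀ d, α d ≠ d)
    (hconn : ∀ f ∈ invariantFun α ⊓ invariantFun σ, ∀ d e, f d = f e)
    (hgenus : 2 * (Nat.card (Quotient (SameCycle.setoid σ)) +
      Nat.card (Quotient (SameCycle.setoid (σ * α)))) = Fintype.card D + 4)
    {x : D → ZMod 2} (hx : ∀ d, x (α d) = x d)
    (hσ : ∀ f : D → ZMod 2, (∀ d, f (σ d) = f d) → ∑ d, f d * x d = 0) :
    ∃ c : D → ZMod 2, (∀ d, c (σ (α d)) = c d) ∧ ∀ d, x d = c d + c (α d) := by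
  rw [← finrank_invariantFun, ← finrank_invariantFun] at hgenus
  have h1 := finrank_map_coboundary_add_one_ge hα hconn
  have h2 := Submodule.finrank_mono (map_coboundary_le (σ := σ) hα hα')
  have h3 := finrank_orthogonalFun_bound hα hconn
  -- Genus zero makes the dimension estimates tight: every cycle is a boundary.
  have heq : (invariantFun (σ * α)).map (coboundary α) = orthogonalFun α σ :=
    Submodule.eq_of_le_of_finrank_le (map_coboundary_le hα hα') (by omega)
  have hmem : x ∈ orthogonalFun α σ :=
    mem_orthogonalFun.mpr ⟨fun f hf => sum_mul_eq_zero_of_involutive hα hα' hf hx, hσ⟩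
  rw [← heq] at hmem
  obtain ⟨c, hc, rfl⟩ := hmem
  exact ⟨c, fun d => hc d, fun d => rfl⟩

end Homology

end Equiv.Perm

/-! ### Transport of cycles along an equivalence. -/

namespace Equiv.Perm

variable {α β : Type*}

theorem sameCycle_permCongr (E : α ≃ β) (π : Perm α) {a b : α} :
    SameCycle (E.permCongr π) (E a) (E b) ↔ SameCycle π a b := by
  have h : ∀ n : ℤ, (E.permCongr π) ^ n = E.permCongr (π ^ n) := fun n =>
    (map_zpow E.permCongrHom π n).symm
  refine exists_congr fun n => ?_
  rw [h]
  simp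

theorem isCycleOn_permCongr (E : α ≃ β) {π : Perm α} {s : Set β}
    (h : π.IsCycleOn (E ⁻¹' s)) : (E.permCongr π).IsCycleOn s := by
  refine ⟨⟨fun x hx => ?_, (Equiv.injective _).injOn, fun y hy => ?_⟩, fun x hx y hy => ?_⟩
  · have := h.1.mapsTo (show E.symm x ∈ E ⁻¹' s by simpa using hx)
    simpa using this
  · obtain ⟨z, hz, hzy⟩ := h.1.surjOn (show E.symm y ∈ E ⁻¹' s by simpa using hy)
    exact ⟨E z, hz, by simp [hzy]⟩
  · have := (sameCycle_permCongr E π).mpr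
      (h.2 (show E.symm x ∈ E ⁻¹' s by simpa using hx) (show E.symm y ∈ E ⁻¹' s by simpa using hy))
    simpa using this

theorem card_quotient_permCongr (E : α ≃ β) (π : Perm α) :
    Nat.card (Quotient (SameCycle.setoid (E.permCongr π))) =
      Nat.card (Quotient (SameCycle.setoid π)) :=
  Nat.card_congr (Quotient.congr E fun _ _ => (sameCycle_permCongr E π).symm).symm

end Equiv.Perm

/-! ### Rotation systems: genus, separation on the sphere, isomorphisms. -/

namespace SimpleGraph

variable {V : Type*} {G : SimpleGraph V}

instance [Finite V] : Finite G.Dart := Finite.of_injective _ Dart.toProd_injective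

theorem Dart.eq_of_fst_snd {d e : G.Dart} (h₁ : d.fst = e.fst) (h₂ : d.snd = e.snd) : d = e :=
  Dart.ext _ _ (Prod.ext h₁ h₂)

@[simp]
theorem Dart.fst_symm (d : G.Dart) : d.symm.fst = d.snd := rfl

@[simp]
theorem Dart.snd_symm (d : G.Dart) : d.symm.snd = d.fst := rfl

/-- Reversal of darts, as a permutation. -/
def symmPerm (G : SimpleGraph V) : Equiv.Perm G.Dart :=
  Function.Involutive.toPerm (Dart.symm : G.Dart → G.Dart) Dart.symm_involutive

@[simp]
theorem symmPerm_apply (d : G.Dart) : G.symmPerm d = d.symm := rfl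

theorem two_mul_card_edgeSet [Finite V] (G : SimpleGraph V) :
    2 * Nat.card G.edgeSet = Nat.card G.Dart := by
  classical
  have := Fintype.ofFinite V
  rw [Nat.card_eq_fintype_card, Nat.card_eq_fintype_card, G.dart_card_eq_twice_card_edges,
    ← edgeFinset_card]

theorem Connected.exists_dart_fst [Nontrivial V] (hG : G.Connected) (v : V) :
    ∃ d : G.Dart, d.fst = v := by
  obtain ⟨u, hu⟩ := exists_ne v
  obtain ⟨p⟩ := hG.preconnected v u
  cases p with
  | nil => exact absurd rfl hu
  | cons h p => exact ⟨⟨(v, _), h⟩, rfl⟩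

/-- A graph isomorphism acts on darts. -/
def Iso.dartEquiv {W : Type*} {H : SimpleGraph W} (e : G ≃g H) : G.Dart ≃ H.Dart where
  toFun d := ⟨(e d.fst, e d.snd), e.map_adj_iff.mpr d.adj⟩
  invFun d := ⟨(e.symm d.fst, e.symm d.snd), e.symm.map_adj_iff.mpr d.adj⟩
  left_inv d := Dart.eq_of_fst_snd (by simp) (by simp)
  right_inv d := Dart.eq_of_fst_snd (by simp) (by simp)

namespace RotationSystem

theorem next_apply (R : RotationSystem G) (d : G.Dart) : R.next d = R.rot d.symm := rfl

theorem next_symm (R : RotationSystem G) (d : G.Dart) : R.next d.symm = R.rot d := by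
  rw [next_apply, Dart.symm_symm]

theorem next_eq_mul (R : RotationSystem G) : R.next = R.rot * G.symmPerm := rfl

theorem next_mul_symmPerm (R : RotationSystem G) : R.next * G.symmPerm = R.rot :=
  Equiv.ext fun d => R.next_symm d

@[simp]
theorem rot_fst (R : RotationSystem G) (d : G.Dart) : (R.rot d).fst = d.fst :=
  (R.isCycleOn d.fst).apply_mem_iff.mpr rfl

@[simp]
theorem rot_symm_fst (R : RotationSystem G) (d : G.Dart) : (R.rot.symm d).fst = d.fst := by
  rw [← R.rot_fst, Equiv.apply_symm_apply]

@[simp]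
theorem next_fst (R : RotationSystem G) (d : G.Dart) : (R.next d).fst = d.snd := by
  rw [next_apply, rot_fst, Dart.fst_symm]

theorem next_symm_apply (R : RotationSystem G) (d : G.Dart) :
    R.next.symm d = (R.rot.symm d).symm := rfl

@[simp]
theorem next_symm_snd (R : RotationSystem G) (d : G.Dart) : (R.next.symm d).snd = d.fst := by
  rw [next_symm_apply, Dart.snd_symm, rot_symm_fst]

theorem sameCycle_rot (R : RotationSystem G) {d e : G.Dart} :
    R.rot.SameCycle d e ↔ d.fst = e.fst := by
  refine ⟨fun h => Equiv.Perm.SameCycle.apply_eq_of_forall (f := fun d : G.Dart => d.fst)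
    R.rot_fst h, fun h => (R.isCycleOn e.fst).2 h rfl⟩

theorem faceOf_eq_iff (R : RotationSystem G) {d e : G.Dart} :
    R.faceOf d = R.faceOf e ↔ R.next.SameCycle d e :=
  ⟨fun h => Quotient.exact h, fun h => Quotient.sound h⟩

@[simp]
theorem faceOf_next (R : RotationSystem G) (d : G.Dart) : R.faceOf (R.next d) = R.faceOf d :=
  R.faceOf_eq_iff.mpr (Equiv.Perm.SameCycle.refl _ _).apply_left

theorem faceOf_surjective (R : RotationSystem G) : Function.Surjective R.faceOf :=
  Quotient.mk_surjective

instance [Finite V] (R : RotationSystem G) : Finite R.Face :=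
  Finite.of_surjective _ R.faceOf_surjective

theorem eq_of_rot_invariant (R : RotationSystem G) {β : Type*} {f : G.Dart → β}
    (hf : ∀ d, f (R.rot d) = f d) {d e : G.Dart} (h : d.fst = e.fst) : f d = f e :=
  (R.sameCycle_rot.mpr h).apply_eq_of_forall hf

theorem eq_of_next_invariant (R : RotationSystem G) {β : Type*} {f : G.Dart → β}
    (hf : ∀ d, f (R.next d) = f d) {d e : G.Dart} (h : R.faceOf d = R.faceOf e) : f d = f e :=
  (R.faceOf_eq_iff.mp h).apply_eq_of_forall hf

/-- In a connected graph a function on darts invariant under rotation and reversal is constant. -/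
theorem eq_of_invariant (R : RotationSystem G) (hG : G.Connected) {β : Type*} {f : G.Dart → β}
    (hrot : ∀ d, f (R.rot d) = f d) (hsymm : ∀ d : G.Dart, f d.symm = f d) (d e : G.Dart) :
    f d = f e := by
  have key : ∀ {u v : V} (_ : G.Walk u v) (d e : G.Dart), d.fst = u → e.fst = v → f d = f e := by
    intro u v p
    induction p with
    | nil => exact fun d e hd he => R.eq_of_rot_invariant hrot (hd.trans he.symm)
    | cons h p ih =>
      intro d e hd he
      rename_i u v w
      rw [← ih (Dart.symm ⟨(u, v), h⟩) e rfl he, hsymm]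
      exact R.eq_of_rot_invariant hrot hd
  obtain ⟨p⟩ := hG.preconnected d.fst e.fst
  exact key p d e rfl rfl

theorem card_quotient_rot [Nontrivial V] (R : RotationSystem G) (hG : G.Connected) :
    Nat.card (Quotient (Equiv.Perm.SameCycle.setoid R.rot)) = Nat.card V := by
  refine Nat.card_congr ((Quotient.congrRight fun a b => ?_).trans
    (Setoid.quotientKerEquivOfSurjective (fun d : G.Dart => d.fst) hG.exists_dart_fst))
  exact R.sameCycle_rot

theorem hasGenus_iff [Finite V] (R : RotationSystem G) (hG : G.Connected) (g : ℕ) :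
    R.HasGenus g ↔ 2 * (Nat.card V + Nat.card R.Face) + 4 * g = Nat.card G.Dart + 4 := by
  have := G.two_mul_card_edgeSet
  rw [HasGenus]
  constructor
  · rintro ⟨-, h⟩; omega
  · intro h; exact ⟨hG, by omega⟩

theorem invariantFun_const (R : RotationSystem G) (hG : G.Connected) :
    ∀ f ∈ Equiv.Perm.invariantFun G.symmPerm ⊓ Equiv.Perm.invariantFun R.rot, ∀ d e, f d = f e :=
  fun _ hf d e => R.eq_of_invariant hG hf.2 hf.1 d e

theorem invariantFun_const' (R : RotationSystem G) (hG : G.Connected) :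
    ∀ f ∈ Equiv.Perm.invariantFun G.symmPerm ⊓ Equiv.Perm.invariantFun R.next,
      ∀ d e, f d = f e := by
  intro f hf d e
  refine R.eq_of_invariant hG (fun d => ?_) hf.1 d e
  rw [← next_symm, hf.2, ← symmPerm_apply, hf.1]

/-- Every embedding of a connected graph has a genus. -/
theorem exists_hasGenus [Finite V] [Nontrivial V] (R : RotationSystem G) (hG : G.Connected) :
    ∃ g, R.HasGenus g := by
  classical
  have := Fintype.ofFinite V
  have hle := Equiv.Perm.card_quotient_add_card_quotient_le (α := G.symmPerm) (σ := R.rot)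
    Dart.symm_symm Dart.symm_ne (R.invariantFun_const hG)
  -- The sign of a permutation gives the parity of its number of cycles, so multiplicativity of the
  -- sign yields that `V - E + F` is even. With the bound `hle` the genus is then a natural number.
  have hs : Equiv.Perm.sign R.next = Equiv.Perm.sign R.rot * Equiv.Perm.sign G.symmPerm := by
    rw [next_eq_mul, Equiv.Perm.sign_mul]
  have hsymm : Equiv.Perm.sign G.symmPerm = (-1) ^ Nat.card G.edgeSet := by
    have : Nat.card (Quotient (Equiv.Perm.SameCycle.setoid G.symmPerm)) = Nat.card G.edgeSet := by
      refine Nat.card_congr ((Quotient.congrRight fun a b => ?_).trans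
        (Setoid.quotientKerEquivOfSurjective (fun d : G.Dart => (⟨d.edge, d.edge_mem⟩ : G.edgeSet))
          ?_))
      · change Equiv.Perm.SameCycle _ _ _ ↔ Setoid.ker _ a b
        rw [Setoid.ker_def, Subtype.mk.injEq, dart_edge_eq_iff]
        constructor
        · intro h
          have h2 := h.apply_eq_of_forall (f := fun d : G.Dart => d.edge) (fun d => d.edge_symm)
          exact (dart_edge_eq_iff _ _).mp h2
        · rintro (rfl | rfl)
          · rfl
          · exact ((Equiv.Perm.SameCycle.refl G.symmPerm b).apply_left)
      · rintro ⟨e, he⟩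
        induction e using Sym2.ind with
        | _ u v => exact ⟨⟨(u, v), he⟩, rfl⟩
    rw [Equiv.Perm.sign_eq_pow_card_quotient, this, ← Nat.card_eq_fintype_card,
      ← two_mul_card_edgeSet]
    simp [pow_add, pow_mul]
  rw [hsymm, Equiv.Perm.sign_eq_pow_card_quotient, Equiv.Perm.sign_eq_pow_card_quotient,
    card_quotient_rot R hG, ← Nat.card_eq_fintype_card,  ← two_mul_card_edgeSet] at hs
  simp only [pow_add, pow_mul, even_two, Even.neg_pow, one_pow, one_mul] at hs
  change (-1 : ℤˣ) ^ Nat.card R.Face = _ at hs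
  rw [← pow_add] at hs
  have hpar : (-1 : ℤˣ) ^ (Nat.card R.Face + (Nat.card V + Nat.card G.edgeSet)) = 1 := by
    rw [pow_add, hs, ← pow_add, ← two_mul, pow_mul]; simp
  have heven : Even (Nat.card R.Face + (Nat.card V + Nat.card G.edgeSet)) := by
    by_contra h
    rw [Nat.not_even_iff_odd] at h
    rw [h.neg_one_pow] at hpar
    exact absurd hpar (by decide)
  rw [card_quotient_rot R hG, ← Nat.card_eq_fintype_card] at hle
  change 2 * (Nat.card V + Nat.card R.Face) ≤ _ at hle
  obtain ⟨k, hk⟩ := heven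
  have h2 := G.two_mul_card_edgeSet
  refine ⟨(Nat.card G.edgeSet + 2 - Nat.card V - Nat.card R.Face) / 2, ?_⟩
  rw [hasGenus_iff R hG]
  omega

open Classical in
/-- On the sphere, a set of edges that meets every vertex evenly separates the faces. -/
theorem HasGenus.exists_faceColoring [Finite V] [Nontrivial V] [Fintype G.Dart]
    {R : RotationSystem G} (hR : R.HasGenus 0)
    {x : G.Dart → ZMod 2} (hx : ∀ d : G.Dart, x d.symm = x d)
    (hv : ∀ f : G.Dart → ZMod 2, (∀ d, f (R.rot d) = f d) → ∑ d, f d * x d = 0) :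
    ∃ c : G.Dart → ZMod 2, (∀ d, c (R.next d) = c d) ∧ ∀ d, x d = c d + c d.symm := by
  refine Equiv.Perm.exists_coboundary_eq (α := G.symmPerm) (σ := R.rot)
    Dart.symm_symm Dart.symm_ne (R.invariantFun_const hR.1) ?_ hx hv
  rw [card_quotient_rot R hR.1, ← Nat.card_eq_fintype_card]
  exact (R.hasGenus_iff hR.1 0).mp hR

/-- On the sphere, a set of edges that meets every face evenly is a cut. -/
theorem HasGenus.exists_vertexColoring [Finite V] [Nontrivial V] [Fintype G.Dart]
    {R : RotationSystem G} (hR : R.HasGenus 0)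
    {x : G.Dart → ZMod 2} (hx : ∀ d : G.Dart, x d.symm = x d)
    (hf : ∀ f : G.Dart → ZMod 2, (∀ d, f (R.next d) = f d) → ∑ d, f d * x d = 0) :
    ∃ k : V → ZMod 2, ∀ d : G.Dart, x d = k d.fst + k d.snd := by
  -- Vertices and faces exchange roles: with `σ` equal to `next`, the product `σ * α` is `rot`.
  obtain ⟨c, hc, hxc⟩ := Equiv.Perm.exists_coboundary_eq (α := G.symmPerm) (σ := R.next)
    Dart.symm_symm Dart.symm_ne (R.invariantFun_const' hR.1) (by
      rw [next_mul_symmPerm, card_quotient_rot R hR.1, ← Nat.card_eq_fintype_card, add_comm]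
      exact (R.hasGenus_iff hR.1 0).mp hR) hx hf
  have hc' : ∀ d, c (R.rot d) = c d := fun d => by rw [← next_symm]; exact hc d
  choose s hs using hR.1.exists_dart_fst
  refine ⟨fun v => c (s v), fun d => ?_⟩
  rw [hxc]
  exact congrArg₂ (· + ·) (R.eq_of_rot_invariant hc' (hs d.fst).symm)
    (R.eq_of_rot_invariant hc' (hs d.snd).symm)

/-- The rotation system obtained from a permutation of a set that is identified with the darts. -/
def ofDartEquiv {D : Type*} (E : D ≃ G.Dart) (π : Equiv.Perm D)
    (h : ∀ v, π.IsCycleOn {d | (E d).fst = v}) : RotationSystem G where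
  rot := E.permCongr π
  isCycleOn v := Equiv.Perm.isCycleOn_permCongr E (h v)

@[simp]
theorem ofDartEquiv_rot {D : Type*} (E : D ≃ G.Dart) (π : Equiv.Perm D)
    (h : ∀ v, π.IsCycleOn {d | (E d).fst = v}) (d : D) :
    (ofDartEquiv E π h).rot (E d) = E (π d) := by
  simp [ofDartEquiv]

/-- Transport of a rotation system along a graph isomorphism. -/
def mapIso {W : Type*} {H : SimpleGraph W} (R : RotationSystem G) (e : G ≃g H) :
    RotationSystem H :=
  ofDartEquiv e.dartEquiv R.rot fun v => by
    have : {d : G.Dart | (e.dartEquiv d).fst = v} = {d | d.fst = e.symm v} :=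
      Set.ext fun d => (e.toEquiv.symm_apply_eq.trans eq_comm).symm.trans eq_comm
    rw [this]
    exact R.isCycleOn (e.symm v)

section MapIso

variable {W : Type*} {H : SimpleGraph W} (R : RotationSystem G) (e : G ≃g H)

theorem mapIso_next : (R.mapIso e).next = e.dartEquiv.permCongr R.next := rfl

theorem mapIso_next_apply (d : G.Dart) :
    (R.mapIso e).next (e.dartEquiv d) = e.dartEquiv (R.next d) := by
  rw [mapIso_next, Equiv.permCongr_apply, Equiv.symm_apply_apply]

theorem mapIso_faceOf_eq_iff {d d' : G.Dart} :
    (R.mapIso e).faceOf (e.dartEquiv d) = (R.mapIso e).faceOf (e.dartEquiv d') ↔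
      R.faceOf d = R.faceOf d' := by
  rw [faceOf_eq_iff, faceOf_eq_iff, mapIso_next, Equiv.Perm.sameCycle_permCongr]

theorem HasGenus.mapIso {R : RotationSystem G} {g : ℕ} (h : R.HasGenus g) :
    (R.mapIso e).HasGenus g := by
  refine ⟨e.connected_iff.mp h.1, ?_⟩
  have h1 : Nat.card (R.mapIso e).Face = Nat.card R.Face :=
    Equiv.Perm.card_quotient_permCongr e.dartEquiv R.next
  rw [h1, ← Nat.card_congr e.toEquiv, ← Nat.card_congr e.mapEdgeSet]
  exact h.2

theorem IsStrong.mapIso {R : RotationSystem G} (h : R.IsStrong) : (R.mapIso e).IsStrong := by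
  constructor
  · intro d d' h₁ h₂
    obtain ⟨d, rfl⟩ := e.dartEquiv.surjective d
    obtain ⟨d', rfl⟩ := e.dartEquiv.surjective d'
    rw [h.1 d d' ((R.mapIso_faceOf_eq_iff e).mp h₁) (e.injective h₂)]
  · intro d h₁
    obtain ⟨d, rfl⟩ := e.dartEquiv.surjective d
    rw [mapIso_next_apply, mapIso_next_apply] at h₁
    exact h.2 d (e.dartEquiv.injective h₁)

/-- The faces correspond under a graph isomorphism. -/
def faceEquivMapIso : R.Face ≃ (R.mapIso e).Face :=
  Quotient.congr e.dartEquiv fun _ _ =>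
    (Equiv.Perm.sameCycle_permCongr e.dartEquiv R.next).symm

/-- The dual graph does not depend on the labels of the vertices. -/
def dualGraphMapIso : R.dualGraph ≃g (R.mapIso e).dualGraph where
  toEquiv := R.faceEquivMapIso e
  map_rel_iff' := by
    intro a b
    refine and_congr (not_congr (Equiv.apply_eq_iff_eq _)) ⟨?_, ?_⟩
    · rintro ⟨d, h₁, h₂⟩
      obtain ⟨d, rfl⟩ := e.dartEquiv.surjective d
      exact ⟨d, (R.faceEquivMapIso e).injective h₁, (R.faceEquivMapIso e).injective h₂⟩
    · rintro ⟨d, rfl, rfl⟩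
      exact ⟨e.dartEquiv d, rfl, rfl⟩

end MapIso

end RotationSystem
end SimpleGraph

/-! ### The dual embedding. -/

namespace SimpleGraph
namespace RotationSystem

variable {V : Type*} {G : SimpleGraph V}

/-- The dual multigraph of the embedding is simple. -/
def IsDualSimple (R : RotationSystem G) : Prop :=
  (∀ d : G.Dart, R.faceOf d ≠ R.faceOf d.symm) ∧
    ∀ d e : G.Dart, R.faceOf d = R.faceOf e → R.faceOf d.symm = R.faceOf e.symm → d = e

/-- The correspondence between the darts of a graph and of its dual. -/
noncomputable def dualDart (R : RotationSystem G) (h : R.IsDualSimple) :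
    G.Dart ≃ R.dualGraph.Dart :=
  Equiv.ofBijective
    (fun d => ⟨(R.faceOf d, R.faceOf d.symm), h.1 d, d, rfl, rfl⟩)
    ⟨fun d e hde => h.2 d e (congrArg (fun z => z.fst) hde) (congrArg (fun z => z.snd) hde), by
      rintro ⟨⟨a, b⟩, hab, d, h₁, h₂⟩
      exact ⟨d, Dart.eq_of_fst_snd h₁ h₂⟩⟩

@[simp]
theorem dualDart_fst (R : RotationSystem G) (h : R.IsDualSimple) (d : G.Dart) :
    (R.dualDart h d).fst = R.faceOf d := rfl

theorem dualDart_symm (R : RotationSystem G) (h : R.IsDualSimple) (d : G.Dart) :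
    R.dualDart h d.symm = (R.dualDart h d).symm :=
  Dart.eq_of_fst_snd rfl (congrArg R.faceOf d.symm_symm)

theorem isCycleOn_next (R : RotationSystem G) (f : R.Face) :
    R.next.IsCycleOn {d | R.faceOf d = f} := by
  refine ⟨⟨fun d hd => (R.faceOf_next d).trans hd, R.next.injective.injOn, fun d hd => ?_⟩, ?_⟩
  · exact ⟨R.next.symm d, by
      rw [Set.mem_ofPred_eq, ← faceOf_next, Equiv.apply_symm_apply]; exact hd, by simp⟩
  · intro d hd e he
    exact R.faceOf_eq_iff.mp (hd.trans he.symm)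

/-- The dual embedding. -/
noncomputable def dual (R : RotationSystem G) (h : R.IsDualSimple) :
    RotationSystem R.dualGraph :=
  ofDartEquiv (R.dualDart h) R.next fun f => R.isCycleOn_next f

variable (R : RotationSystem G) (h : R.IsDualSimple)

theorem dual_rot (d : G.Dart) : (R.dual h).rot (R.dualDart h d) = R.dualDart h (R.next d) :=
  ofDartEquiv_rot _ _ _ _

/-- Duality swaps `rot` and `next`: a facial walk of the dual turns around a vertex of `G`. -/
theorem dual_next (d : G.Dart) : (R.dual h).next (R.dualDart h d) = R.dualDart h (R.rot d) := by
  rw [next_apply, ← dualDart_symm, dual_rot, next_symm]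

theorem dual_next_eq : (R.dual h).next = (R.dualDart h).permCongr R.rot := by
  ext1 d
  obtain ⟨d, rfl⟩ := (R.dualDart h).surjective d
  rw [dual_next, Equiv.permCongr_apply, Equiv.symm_apply_apply]

theorem dual_faceOf_eq_iff {d e : G.Dart} :
    (R.dual h).faceOf (R.dualDart h d) = (R.dual h).faceOf (R.dualDart h e) ↔ d.fst = e.fst := by
  rw [faceOf_eq_iff, dual_next_eq, Equiv.Perm.sameCycle_permCongr, sameCycle_rot]

theorem dualGraph_connected [Nonempty G.Dart] (hG : G.Connected) : R.dualGraph.Connected := by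
  have key : ∀ d e : G.Dart, R.dualGraph.connectedComponentMk (R.faceOf d) =
      R.dualGraph.connectedComponentMk (R.faceOf e) := by
    have hsymm : ∀ d : G.Dart, R.dualGraph.connectedComponentMk (R.faceOf d.symm) =
        R.dualGraph.connectedComponentMk (R.faceOf d) := by
      intro d
      by_cases hd : R.faceOf d.symm = R.faceOf d
      · rw [hd]
      · refine ConnectedComponent.sound (Adj.reachable ⟨hd, d.symm, rfl, by rw [Dart.symm_symm]⟩)
    refine R.eq_of_invariant hG (fun d => ?_) hsymm
    rw [← next_symm, faceOf_next, hsymm]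
  refine (connected_iff _).mpr ⟨fun a b => ?_, ‹Nonempty G.Dart›.map R.faceOf⟩
  obtain ⟨d, rfl⟩ := R.faceOf_surjective a
  obtain ⟨e, rfl⟩ := R.faceOf_surjective b
  exact ConnectedComponent.exact (key d e)

variable [Nontrivial V] (hG : G.Connected)

/-- The faces of the dual embedding are the vertices. -/
noncomputable def dualFaceEquiv : (R.dual h).Face ≃ V :=
  Equiv.ofBijective
    (Quotient.lift (fun x => ((R.dualDart h).symm x).fst) fun x y hxy => by
      obtain ⟨d, rfl⟩ := (R.dualDart h).surjective x
      obtain ⟨e, rfl⟩ := (R.dualDart h).surjective y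
      simpa using (R.dual_faceOf_eq_iff h).mp (Quotient.sound hxy))
    ⟨fun a b => by
      obtain ⟨x, rfl⟩ := (R.dual h).faceOf_surjective a
      obtain ⟨y, rfl⟩ := (R.dual h).faceOf_surjective b
      obtain ⟨d, rfl⟩ := (R.dualDart h).surjective x
      obtain ⟨e, rfl⟩ := (R.dualDart h).surjective y
      intro hab
      change ((R.dualDart h).symm _).fst = ((R.dualDart h).symm _).fst at hab
      rw [dual_faceOf_eq_iff]
      simpa using hab, fun v => by
      obtain ⟨d, rfl⟩ := hG.exists_dart_fst v
      refine ⟨(R.dual h).faceOf (R.dualDart h d), ?_⟩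
      change ((R.dualDart h).symm _).fst = _
      rw [Equiv.symm_apply_apply]⟩

@[simp]
theorem dualFaceEquiv_faceOf (d : G.Dart) :
    R.dualFaceEquiv h hG ((R.dual h).faceOf (R.dualDart h d)) = d.fst := by
  change ((R.dualDart h).symm _).fst = _
  rw [Equiv.symm_apply_apply]

/-- The dual of the dual embedding is the original graph. -/
noncomputable def dualDualIso : (R.dual h).dualGraph ≃g G where
  toEquiv := R.dualFaceEquiv h hG
  map_rel_iff' := by
    intro a b
    obtain ⟨a, rfl⟩ := (R.dual h).faceOf_surjective a
    obtain ⟨b, rfl⟩ := (R.dual h).faceOf_surjective b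
    obtain ⟨a, rfl⟩ := (R.dualDart h).surjective a
    obtain ⟨b, rfl⟩ := (R.dualDart h).surjective b
    rw [dualFaceEquiv_faceOf, dualFaceEquiv_faceOf]
    constructor
    · intro hab
      refine ⟨fun h' => hab.ne ((R.dual_faceOf_eq_iff h).mp h'),
        R.dualDart h ⟨(a.fst, b.fst), hab⟩, ?_, ?_⟩
      · rw [dual_faceOf_eq_iff]
      · rw [← dualDart_symm, dual_faceOf_eq_iff]; rfl
    · rintro ⟨-, d, h₁, h₂⟩
      obtain ⟨d, rfl⟩ := (R.dualDart h).surjective d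
      rw [← dualDart_symm, dual_faceOf_eq_iff] at h₂
      rw [dual_faceOf_eq_iff] at h₁
      rw [← h₁, ← h₂]
      exact d.adj

theorem HasGenus.dual [Finite V] {R : RotationSystem G} (h : R.IsDualSimple) {g : ℕ}
    (hR : R.HasGenus g) : (R.dual h).HasGenus g := by
  have : Nonempty G.Dart := ⟨(hR.1.exists_dart_fst hR.1.nonempty.some).choose⟩
  rw [hasGenus_iff _ (R.dualGraph_connected hR.1), Nat.card_congr (R.dualFaceEquiv h hR.1),
    ← Nat.card_congr (R.dualDart h), ← (hasGenus_iff R hR.1 g).mp hR]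
  ring

end RotationSystem
end SimpleGraph

/-! ### Triangulations. -/

namespace SimpleGraph
namespace RotationSystem

variable {V : Type*} {G : SimpleGraph V} {R : RotationSystem G}

/-- Every face of the embedding is a triangle. -/
def IsTriangulated (R : RotationSystem G) : Prop :=
  ∀ d, R.next (R.next (R.next d)) = d

theorem next_ne (d : G.Dart) : R.next d ≠ d := fun h =>
  d.snd_ne_fst (by rw [← R.next_fst d, h])

theorem IsTriangulated.next_next_ne (hR : R.IsTriangulated) (d : G.Dart) :
    R.next (R.next d) ≠ d := fun h => R.next_ne d (by conv_rhs => rw [← hR d, h])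

theorem IsTriangulated.next_next_snd (hR : R.IsTriangulated) (d : G.Dart) :
    (R.next (R.next d)).snd = d.fst := by
  rw [← R.next_fst, hR]

theorem IsTriangulated.next_rot_snd (hR : R.IsTriangulated) (d : G.Dart) :
    (R.next (R.rot d)).snd = d.snd := by
  rw [← next_symm, hR.next_next_snd]; rfl

theorem IsTriangulated.adj_rot_snd (hR : R.IsTriangulated) (d : G.Dart) :
    G.Adj d.snd (R.rot d).snd := by
  have h := (R.next (R.rot d)).adj
  rw [hR.next_rot_snd, next_fst] at h
  exact h.symm

theorem IsTriangulated.next_symm_eq (hR : R.IsTriangulated) (d : G.Dart) :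
    R.next.symm d = R.next (R.next d) := by
  rw [Equiv.symm_apply_eq, hR]

theorem IsTriangulated.faceOf_eq_iff (hR : R.IsTriangulated) {d e : G.Dart} :
    R.faceOf e = R.faceOf d ↔ e = d ∨ e = R.next d ∨ e = R.next (R.next d) := by
  constructor
  · intro h
    have key := R.eq_of_next_invariant
      (f := fun e => e = d ∨ e = R.next d ∨ e = R.next (R.next d)) (fun e => by
        refine propext ⟨?_, ?_⟩
        · rintro (h | h | h)
          · right; right
            rw [← h, hR]
          · left; exact R.next.injective h
          · right; left; exact R.next.injective h
        · rintro (rfl | rfl | rfl)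
          · right; left; rfl
          · right; right; rfl
          · left; exact hR d) h
    rw [key]
    exact Or.inl rfl
  · rintro (rfl | rfl | rfl) <;> simp

open Classical in
theorem card_dart_eq_sum [Fintype V] [Fintype R.Face] :
    Nat.card G.Dart = ∑ f : R.Face, (Finset.univ.filter fun d => R.faceOf d = f).card := by
  rw [Nat.card_eq_fintype_card, ← Finset.card_univ,
    Finset.card_eq_sum_card_fiberwise (f := R.faceOf) (t := Finset.univ) (fun _ _ => by simp)]

open Classical in
theorem IsTriangulated.card_face [Finite V] (hR : R.IsTriangulated) :
    3 * Nat.card R.Face = Nat.card G.Dart := by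
  have := Fintype.ofFinite V
  have := Fintype.ofFinite R.Face
  rw [card_dart_eq_sum (R := R), Finset.sum_congr rfl (g := fun _ => 3), Finset.sum_const,
    Finset.card_univ, Nat.card_eq_fintype_card, smul_eq_mul, mul_comm]
  intro f _
  obtain ⟨d, rfl⟩ := R.faceOf_surjective f
  have : (Finset.univ.filter fun e => R.faceOf e = R.faceOf d) =
      {d, R.next d, R.next (R.next d)} := by
    ext e
    simp [hR.faceOf_eq_iff]
  rw [this, Finset.card_eq_three]
  exact ⟨_, _, _, (R.next_ne d).symm, (hR.next_next_ne d).symm, (R.next_ne _).symm, rfl⟩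

theorem IsTriangulated.hasGenus_zero_iff [Finite V] (hR : R.IsTriangulated) (hG : G.Connected) :
    R.HasGenus 0 ↔ Nat.card G.Dart + 12 = 6 * Nat.card V := by
  have h := hR.card_face
  rw [hasGenus_iff R hG]
  omega

open Classical in
-- No vertex has degree one, so every face has at least three darts. Euler's formula and the number
-- of edges force the average to be three, so equality holds everywhere.
theorem HasGenus.isTriangulated [Finite V] (hR : R.HasGenus 0) (hrot : ∀ d, R.rot d ≠ d)
    (hcard : Nat.card G.Dart + 12 = 6 * Nat.card V) : R.IsTriangulated := by
  have := Fintype.ofFinite V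
  have := Fintype.ofFinite R.Face
  have hF := (hasGenus_iff R hR.1 0).mp hR
  have hnn : ∀ d, R.next (R.next d) ≠ d := by
    intro d h
    have h1 : R.next d = d.symm := by
      refine Dart.eq_of_fst_snd (R.next_fst d) ?_
      rw [← R.next_fst, h]; rfl
    exact hrot d.symm (by rw [← next_apply, h1])
  have hsub : ∀ d, ({d, R.next d, R.next (R.next d)} : Finset G.Dart) ⊆
      Finset.univ.filter fun e => R.faceOf e = R.faceOf d := by
    intro d e he
    simp only [Finset.mem_insert, Finset.mem_singleton] at he
    rcases he with rfl | rfl | rfl <;> simp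
  have hthree : ∀ d, ({d, R.next d, R.next (R.next d)} : Finset G.Dart).card = 3 := fun d =>
    Finset.card_eq_three.mpr ⟨_, _, _, (R.next_ne d).symm, (hnn d).symm, (R.next_ne _).symm, rfl⟩
  have hle : ∀ f ∈ (Finset.univ : Finset R.Face),
      3 ≤ (Finset.univ.filter fun d => R.faceOf d = f).card := by
    intro f _
    obtain ⟨d, rfl⟩ := R.faceOf_surjective f
    rw [← hthree d]
    exact Finset.card_le_card (hsub d)
  have hsum : ∑ f : R.Face, 3 =
      ∑ f : R.Face, (Finset.univ.filter fun d => R.faceOf d = f).card := by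
    rw [← card_dart_eq_sum, Finset.sum_const, Finset.card_univ, ← Nat.card_eq_fintype_card,
      smul_eq_mul]
    omega
  have heq := (Finset.sum_eq_sum_iff_of_le hle).mp hsum
  intro d
  have h1 : ({d, R.next d, R.next (R.next d)} : Finset G.Dart) =
      Finset.univ.filter fun e => R.faceOf e = R.faceOf d :=
    Finset.eq_of_subset_of_card_le (hsub d) (by rw [hthree, heq _ (Finset.mem_univ _)])
  have h2 : R.next (R.next (R.next d)) ∈ ({d, R.next d, R.next (R.next d)} : Finset G.Dart) := by
    rw [h1]; simp
  simp only [Finset.mem_insert, Finset.mem_singleton] at h2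
  rcases h2 with h2 | h2 | h2
  · exact h2
  · exact absurd (R.next.injective h2) (hnn d)
  · exact absurd h2 (R.next_ne _)

theorem IsTriangulated.rot_ne (hR : R.IsTriangulated) (d : G.Dart) : R.rot d ≠ d := by
  intro h
  have h1 := hR.next_rot_snd d
  rw [h] at h1
  exact (R.next d).fst_ne_snd (by rw [h1, next_fst])

/-- At a vertex of degree two, the side that returns to it can only be the reverse of the other dart
there. -/
theorem IsTriangulated.next_eq_of_rot_rot (hR : R.IsTriangulated) {d : G.Dart}
    (hd : R.rot (R.rot d) = d) : (R.next (R.next d)) = (R.rot d).symm := by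
  have hfst : ∀ e : G.Dart, e.fst = d.fst → e = d ∨ e = R.rot d := by
    intro e he
    have key := R.eq_of_rot_invariant (f := fun e => e = d ∨ e = R.rot d) (fun e => by
      refine propext ⟨?_, ?_⟩
      · rintro (h | h)
        · right; rw [← h] at hd ⊢; exact (R.rot.injective hd).symm
        · left; exact R.rot.injective h
      · rintro (rfl | rfl)
        · right; rfl
        · left; exact hd) he
    rw [key]; exact Or.inl rfl
  rcases hfst (R.next (R.next d)).symm (hR.next_next_snd d) with h | h
  · exfalso
    have h2 : R.next (R.next d) = d.symm := by rw [← Dart.symm_symm (R.next (R.next d)), h]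
    have h3 := hR d
    rw [h2, next_symm] at h3
    exact hR.rot_ne d h3
  · rw [← h, Dart.symm_symm]

/-- A connected triangulated graph with at least four vertices has minimum degree three. -/
theorem IsTriangulated.rot_rot_ne [Finite V] (hR : R.IsTriangulated) (hG : G.Connected)
    (hV : 3 < Nat.card V) (d : G.Dart) : R.rot (R.rot d) ≠ d := by
  have hNt : Nontrivial V := Finite.one_lt_card_iff_nontrivial.mp (by omega)
  -- Degree two spreads from a vertex to its neighbours and so to the whole graph; then all darts
  -- span the same triple of vertices, against `hV`.
  have hrotd : ∀ d, R.rot (R.rot d) = d → R.rot (R.rot (R.rot d)) = R.rot d :=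
    fun d h => by rw [h]
  have hsymmd : ∀ d, R.rot (R.rot d) = d → R.rot (R.rot d.symm) = d.symm := by
    intro d h
    have h1 := hR.next_eq_of_rot_rot h
    have h2 := hR.next_eq_of_rot_rot (hrotd d h)
    rw [h] at h2
    have h3 : R.next (R.rot d) = (R.next d).symm := by
      refine Dart.eq_of_fst_snd ?_ ?_
      · rw [next_fst, Dart.fst_symm, ← R.next_fst (R.next d), h1]; rfl
      · rw [hR.next_rot_snd, Dart.snd_symm, next_fst]
    rw [← next_apply, ← next_symm, ← h3, h2]
  intro hd
  have hP : ∀ e, R.rot (R.rot e) = e := by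
    intro e
    have := R.eq_of_invariant hG (f := fun d => R.rot (R.rot d) = d)
      (fun d => propext ⟨fun h => R.rot.injective h, hrotd d⟩)
      (fun d => propext ⟨fun h => by simpa using hsymmd _ h, hsymmd d⟩) d e
    exact this.mp hd
  have hQ : ∀ e : G.Dart, ({e.fst, e.snd, (R.rot e).snd} : Set V) =
      {d.fst, d.snd, (R.rot d).snd} := by
    intro e
    refine R.eq_of_invariant hG (f := fun d : G.Dart => ({d.fst, d.snd, (R.rot d).snd} : Set V))
      (fun d => ?_) (fun d => ?_) e d
    · simp only [hP, rot_fst]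
      rw [Set.pair_comm]
    · have h1 : (R.rot d.symm).snd = (R.rot d).snd := by
        rw [← next_apply, ← next_fst, hR.next_eq_of_rot_rot (hP d)]; rfl
      simp only [h1, Dart.fst_symm, Dart.snd_symm]
      rw [Set.insert_comm]
  have huniv : (Set.univ : Set V) ⊆ {d.fst, d.snd, (R.rot d).snd} := by
    intro v _
    obtain ⟨e, rfl⟩ := hG.exists_dart_fst v
    rw [← hQ e]; simp
  have h1 := Set.ncard_le_ncard huniv
  have h2 : ({d.fst, d.snd, (R.rot d).snd} : Set V).ncard ≤ 3 := by
    refine (Set.ncard_insert_le _ _).trans ?_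
    have := Set.ncard_insert_le d.snd {(R.rot d).snd}
    rw [Set.ncard_singleton] at this
    omega
  rw [Set.ncard_univ] at h1
  omega

/-- The darts at `v` as a finset are a cycle whose length is the degree. -/
theorem rot_pow_eq_iff [Finite V] (R : RotationSystem G) (d : G.Dart) (k : ℕ) :
    (R.rot ^ k) d = d ↔ (G.neighborSet d.fst).ncard ∣ k := by
  classical
  have := Fintype.ofFinite V
  have hs : ((Finset.univ.filter fun e : G.Dart => e.fst = d.fst : Finset G.Dart) : Set G.Dart) =
      {e | e.fst = d.fst} := by ext; simp
  have hc := R.isCycleOn d.fst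
  rw [← hs] at hc
  rw [hc.pow_apply_eq (by simp)]
  suffices h : (Finset.univ.filter fun e : G.Dart => e.fst = d.fst).card =
      (G.neighborSet d.fst).ncard by rw [h]
  rw [← Set.ncard_coe_finset, hs]
  refine Set.ncard_congr (fun e _ => e.snd) ?_ ?_ ?_
  · rintro e (he : e.fst = d.fst)
    have := e.adj
    rwa [he] at this
  · rintro e f (he : e.fst = d.fst) (hf : f.fst = d.fst) h
    exact Dart.eq_of_fst_snd (he.trans hf.symm) h
  · intro w hw
    exact ⟨⟨(d.fst, w), hw⟩, rfl, rfl⟩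

end RotationSystem
end SimpleGraph

/-! ### Deletion of a vertex from a graph and from a rotation system. -/

namespace SimpleGraph

variable {W' W : Type*} {T' : SimpleGraph W'} {T : SimpleGraph W}

/-- The action of a graph embedding on darts. -/
def Embedding.dart (j : T ↪g T') (d : T.Dart) : T'.Dart :=
  ⟨(j d.fst, j d.snd), j.map_adj_iff.mpr d.adj⟩

@[simp]
theorem Embedding.dart_fst (j : T ↪g T') (d : T.Dart) : (j.dart d).fst = j d.fst := rfl

theorem Embedding.dart_symm (j : T ↪g T') (d : T.Dart) : j.dart d.symm = (j.dart d).symm := rfl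

theorem Embedding.dart_injective (j : T ↪g T') : Function.Injective j.dart := fun _ _ h =>
  Dart.eq_of_fst_snd (j.injective (congrArg (fun z => z.fst) h))
    (j.injective (congrArg (fun z => z.snd) h))

/-- The embedding `j` identifies `T` with the graph `T'` minus the vertex `n`. -/
def Embedding.IsDeletion (j : T ↪g T') (n : W') : Prop := ∀ w, w ≠ n ↔ w ∈ Set.range j

theorem Embedding.IsDeletion.apply_ne {j : T ↪g T'} {n : W'} (hj : j.IsDeletion n) (w : W) :
    j w ≠ n := (hj _).mpr ⟨w, rfl⟩

theorem Embedding.IsDeletion.exists_dart {j : T ↪g T'} {n : W'} (hj : j.IsDeletion n)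
    {d : T'.Dart} (h₁ : d.fst ≠ n) (h₂ : d.snd ≠ n) : ∃ e, j.dart e = d := by
  obtain ⟨u, hu⟩ := (hj _).mp h₁
  obtain ⟨v, hv⟩ := (hj _).mp h₂
  have h := d.adj
  rw [← hu, ← hv] at h
  exact ⟨⟨(u, v), j.map_adj_iff.mp h⟩, Dart.eq_of_fst_snd hu hv⟩

theorem Embedding.IsDeletion.card {j : T ↪g T'} {n : W'} [Finite W'] (hj : j.IsDeletion n) :
    Nat.card W' = Nat.card W + 1 := by
  classical
  have h1 : (Set.range j) = {n}ᶜ := Set.ext fun w => (hj w).symm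
  have h2 := Set.ncard_add_ncard_compl ({n} : Set W')
  rw [← h1, Set.ncard_singleton, ← Nat.card_coe_set_eq, ← Nat.card_congr (Equiv.ofInjective j j.injective)] at h2
  omega

theorem ncard_darts_fst (G : SimpleGraph W) (n : W) :
    {d : G.Dart | d.fst = n}.ncard = (G.neighborSet n).ncard := by
  refine Set.ncard_congr (fun e _ => e.snd) ?_ ?_ ?_
  · rintro e (rfl : e.fst = n)
    exact e.adj
  · rintro e f (he : e.fst = n) (hf : f.fst = n) h
    exact Dart.eq_of_fst_snd (he.trans hf.symm) h
  · intro w hw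
    exact ⟨⟨(n, w), hw⟩, rfl, rfl⟩

theorem Embedding.IsDeletion.card_dart {j : T ↪g T'} {n : W'} [Finite W']
    (hj : j.IsDeletion n) :
    Nat.card T'.Dart = Nat.card T.Dart + 2 * (T'.neighborSet n).ncard := by
  have h1 : Set.range j.dart = ({d : T'.Dart | d.fst = n} ∪ {d : T'.Dart | d.snd = n})ᶜ := by
    ext d
    simp only [Set.mem_range, Set.mem_compl_iff, Set.mem_union, not_or]
    constructor
    · rintro ⟨d, rfl⟩
      exact ⟨hj.apply_ne _, hj.apply_ne _⟩
    · rintro ⟨h₁, h₂⟩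
      exact hj.exists_dart h₁ h₂
  have h2 := Set.ncard_add_ncard_compl ({d : T'.Dart | d.fst = n} ∪ {d : T'.Dart | d.snd = n})
  rw [← h1, ← Nat.card_coe_set_eq (Set.range _),
    ← Nat.card_congr (Equiv.ofInjective j.dart j.dart_injective), Set.ncard_union_eq] at h2
  · have h3 : {d : T'.Dart | d.snd = n}.ncard = {d : T'.Dart | d.fst = n}.ncard :=
      Set.ncard_congr (fun e _ => e.symm) (fun e he => he)
        (fun e f _ _ h => Dart.symm_involutive.injective h)
        (fun e he => ⟨e.symm, he, e.symm_symm⟩)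
    rw [h3, ncard_darts_fst] at h2
    omega
  · rw [Set.disjoint_left]
    intro d h₁ h₂
    exact d.fst_ne_snd (Eq.trans h₁ (Eq.symm h₂))

/-- Deleting a vertex whose neighbours are pairwise adjacent keeps a graph connected. -/
theorem Embedding.IsDeletion.connected {j : T ↪g T'} {n : W'} (hj : j.IsDeletion n)
    (hT : T'.Connected) {a : W} (ha : ∀ b, T'.Adj n (j b) → b = a ∨ T.Adj a b) :
    T.Connected := by
  -- Each visit of the walk to `n` is read as a visit to `a`, which equals or is adjacent to every
  -- neighbour of `n`.
  have key : ∀ {u v : W'} (_ : T'.Walk u v) (x y : W), (u = j x ∨ u = n ∧ x = a) →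
      (v = j y ∨ v = n ∧ y = a) → T.Reachable x y := by
    intro u v p
    induction p with
    | nil =>
      rintro x y (rfl | ⟨rfl, rfl⟩) (h | ⟨h, rfl⟩)
      · rw [j.injective h]
      · exact absurd h (hj.apply_ne _)
      · exact absurd h.symm (hj.apply_ne _)
      · rfl
    | cons h p ih =>
      rename_i u v w
      intro x y hx hy
      by_cases hv : v = n
      · refine Reachable.trans ?_ (ih a y (Or.inr ⟨hv, rfl⟩) hy)
        rcases hx with rfl | ⟨rfl, rfl⟩
        · rcases ha x (hv ▸ h.symm) with rfl | h'
          · rfl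
          · exact h'.symm.reachable
        · rfl
      · obtain ⟨z, rfl⟩ := (hj v).mp hv
        refine Reachable.trans ?_ (ih z y (Or.inl rfl) hy)
        rcases hx with rfl | ⟨rfl, rfl⟩
        · exact (j.map_adj_iff.mp h).reachable
        · rcases ha z h with rfl | h'
          · rfl
          · exact h'.reachable
  refine (connected_iff _).mpr ⟨fun x y => ?_, ⟨a⟩⟩
  obtain ⟨p⟩ := hT.preconnected (j x) (j y)
  exact key p x y (Or.inl rfl) (Or.inl rfl)

namespace RotationSystem

open Classical in
/-- The rotation system `R` of `T` arises from the rotation system `R'` of `T'` by skipping all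
darts into the deleted vertex `n`. -/
def IsDeletion (R : RotationSystem T) (R' : RotationSystem T') (j : T ↪g T') (n : W') : Prop :=
  ∀ d, j.dart (R.rot d) =
    if (R'.rot (j.dart d)).snd = n then R'.rot (R'.rot (j.dart d)) else R'.rot (j.dart d)

open Classical in
/-- A vertex can be deleted from a rotation system. -/
theorem exists_isDeletion [Finite W] (R' : RotationSystem T') {j : T ↪g T'} {n : W'}
    (hj : j.IsDeletion n) (hrot : ∀ d, R'.rot d ≠ d) :
    ∃ R : RotationSystem T, R.IsDeletion R' j n := by
  have hex : ∀ d : T.Dart, ∃ e : T.Dart, j.dart e =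
      if (R'.rot (j.dart d)).snd = n then R'.rot (R'.rot (j.dart d)) else R'.rot (j.dart d) := by
    intro d
    refine hj.exists_dart ?_ ?_
    · split_ifs
      · rw [rot_fst, rot_fst]; exact hj.apply_ne _
      · rw [rot_fst]; exact hj.apply_ne _
    · split_ifs with h
      · intro h'
        exact hrot (R'.rot (j.dart d)) (Dart.eq_of_fst_snd (R'.rot_fst _) (h'.trans h.symm))
      · exact h
  choose f hf using hex
  have hinj : Function.Injective f := by
    intro d e hde
    have h := congrArg j.dart hde
    rw [hf, hf] at h
    split_ifs at h with h₁ h₂ h₂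
    · exact j.dart_injective (R'.rot.injective (R'.rot.injective h))
    · have := R'.rot.injective h
      rw [this] at h₁
      exact absurd h₁ (hj.apply_ne _)
    · have := R'.rot.injective h
      rw [← this] at h₂
      exact absurd h₂ (hj.apply_ne _)
    · exact j.dart_injective (R'.rot.injective h)
  let π : Equiv.Perm T.Dart := Equiv.ofBijective f (Finite.injective_iff_bijective.mp hinj)
  have hπ : ∀ d, j.dart (π d) =
    if (R'.rot (j.dart d)).snd = n then R'.rot (R'.rot (j.dart d)) else R'.rot (j.dart d) := hf
  have hfst : ∀ d, (π d).fst = d.fst := by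
    intro d
    refine j.injective ?_
    rw [← j.dart_fst, hπ]
    split_ifs
    · rw [rot_fst, rot_fst]; rfl
    · rw [rot_fst]; rfl
  -- The induction is strong because one step of `π` uses two steps of `R'.rot` when it skips the
  -- dart into `n`.
  have hcyc : ∀ (k : ℕ) (x y : T.Dart), (R'.rot ^ k) (j.dart x) = j.dart y → π.SameCycle x y := by
    intro k
    induction k using Nat.strong_induction_on with
    | _ k ih =>
      intro x y hxy
      match k, ih, hxy with
      | 0, _, hxy =>
        rw [j.dart_injective hxy]
      | k + 1, ih, hxy =>
        rw [pow_succ, Equiv.Perm.mul_apply] at hxy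
        by_cases h : (R'.rot (j.dart x)).snd = n
        · match k, ih, hxy with
          | 0, _, hxy =>
            have h' := congrArg (fun z => z.snd) hxy
            change (R'.rot (j.dart x)).snd = j y.snd at h'
            exact absurd (h'.symm.trans h) (hj.apply_ne _)
          | k + 1, ih, hxy =>
            rw [pow_succ, Equiv.Perm.mul_apply] at hxy
            have h2 := hπ x
            rw [if_pos h] at h2
            rw [← h2] at hxy
            exact (ih k (by omega) _ _ hxy).of_apply_left
        · have h2 := hπ x
          rw [if_neg h] at h2
          rw [← h2] at hxy
          exact (ih k (by omega) _ _ hxy).of_apply_left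
  have : Finite W' := by
    have : (Set.univ : Set W') = insert n (Set.range j) := by
      ext w
      simp only [Set.mem_univ, Set.mem_insert_iff, true_iff]
      by_cases h : w = n
      · exact Or.inl h
      · exact Or.inr ((hj w).mp h)
    exact Set.finite_univ_iff.mp (this ▸ (Set.finite_range j).insert n)
  refine ⟨⟨π, fun v => ⟨⟨fun d hd => (hfst d).trans hd, π.injective.injOn, fun d hd => ?_⟩,
    fun x hx y hy => ?_⟩⟩, hπ⟩
  · refine ⟨π.symm d, ?_, by simp⟩
    have := hfst (π.symm d)
    rw [Equiv.apply_symm_apply] at this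
    exact this.symm.trans hd
  · have hfin : Set.Finite {d : T'.Dart | d.fst = j v} := Set.toFinite _
    obtain ⟨k, hk⟩ := (R'.isCycleOn (j v)).exists_pow_eq' hfin
      (show j.dart x ∈ _ from congrArg j hx) (show j.dart y ∈ _ from congrArg j hy)
    exact hcyc k x y hk

namespace IsDeletion

variable {R : RotationSystem T} {R' : RotationSystem T'} {j : T ↪g T'} {n : W'}

theorem dart_next_of_eq (h : R.IsDeletion R' j n) {d : T.Dart}
    (hd : (R'.next (j.dart d)).snd = n) : j.dart (R.next d) = R'.rot (R'.next (j.dart d)) := by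
  rw [next_apply, h, j.dart_symm, ← next_apply, if_pos hd]

theorem dart_next_of_ne (h : R.IsDeletion R' j n) {d : T.Dart}
    (hd : (R'.next (j.dart d)).snd ≠ n) : j.dart (R.next d) = R'.next (j.dart d) := by
  rw [next_apply, h, j.dart_symm, ← next_apply, if_neg hd]

/-- If `d` lies opposite to `n` in a triangle with the dart `e` out of `n` following it, then the
next dart lies opposite to `n` in the following triangle. -/
theorem dart_next_of_next_eq (h : R.IsDeletion R' j n) {d : T.Dart} {e : T'.Dart}
    (he : e.fst = n) (hd : R'.next (j.dart d) = e.symm) : j.dart (R.next d) = R'.next e := by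
  rw [h.dart_next_of_eq (by rw [hd]; exact he), hd]; rfl

/-- The triangles at `n` merge into one face, and `R.next` runs through their outer sides against
the rotation at `n`. -/
theorem next_dart_next (h : R.IsDeletion R' j n) (hR' : R'.IsTriangulated) {d : T.Dart}
    {e : T'.Dart} (he : e.fst = n) (hd : R'.next (j.dart d) = e.symm) :
    R'.next (j.dart (R.next d)) = (R'.rot.symm e).symm := by
  rw [h.dart_next_of_next_eq he hd, ← next_symm_apply, hR'.next_symm_eq]

/-- Faces away from `n` are unchanged. The outer sides of the three triangles at `n` form one
triangle, since three backward rotations at `n` return to the start. -/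
theorem isTriangulated (h : R.IsDeletion R' j n) (hj : j.IsDeletion n) (hR' : R'.IsTriangulated)
    (hn : ∀ e : T'.Dart, e.fst = n → R'.rot (R'.rot (R'.rot e)) = e) : R.IsTriangulated := by
  intro d
  refine j.dart_injective ?_
  by_cases hd : (R'.next (j.dart d)).snd = n
  · obtain ⟨e, he⟩ : ∃ e : T'.Dart, R'.next (j.dart d) = e.symm :=
      ⟨(R'.next (j.dart d)).symm, by simp⟩
    have hen : e.fst = n := by rw [he] at hd; exact hd
    have h1 := h.next_dart_next hR' hen he
    have h2 := h.next_dart_next hR' ((R'.rot_symm_fst e).trans hen) h1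
    have h3 := h.next_dart_next hR' ((R'.rot_symm_fst _).trans ((R'.rot_symm_fst e).trans hen)) h2
    refine R'.next.injective ?_
    rw [h3, he]
    congr 1
    rw [Equiv.symm_apply_eq, Equiv.symm_apply_eq, Equiv.symm_apply_eq, hn e hen]
  · have h1 := h.dart_next_of_ne hd
    have h2 : j.dart (R.next (R.next d)) = R'.next (R'.next (j.dart d)) := by
      rw [← h1]
      refine h.dart_next_of_ne ?_
      rw [h1, hR'.next_next_snd]
      exact hj.apply_ne _
    rw [h.dart_next_of_ne, h2, hR']
    rw [h2, hR']
    exact hj.apply_ne _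

end IsDeletion

end RotationSystem
end SimpleGraph

/-! ### Walks of a face colouring and strong colourings. -/

namespace SimpleGraph
namespace RotationSystem

variable {V : Type*} {G : SimpleGraph V} {R : RotationSystem G}

/-- Given a two-colouring of the faces of a triangulated graph, a dart `d` is read as a step from
the face of `d` to the face of its reverse; the walk then turns left or right according to the
colour of the face that it enters. -/
def colorWalk (R : RotationSystem G) (c : G.Dart → Bool) (d : G.Dart) : G.Dart :=
  if c d.symm then R.rot d else R.next.symm d.symm

/-- No walk with turns given by the face colouring `c` meets a face twice. -/
def IsStrongColoring (R : RotationSystem G) (c : G.Dart → Bool) : Prop :=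
  ∀ (d : G.Dart) (k : ℕ), R.faceOf ((R.colorWalk c)^[k] d) = R.faceOf d →
    (R.colorWalk c)^[k] d = d

theorem colorWalk_of_true {c : G.Dart → Bool} {d : G.Dart} (h : c d.symm = true) :
    R.colorWalk c d = R.rot d := by
  rw [colorWalk, if_pos h]

theorem colorWalk_of_false {c : G.Dart → Bool} {d : G.Dart} (h : c d.symm = false) :
    R.colorWalk c d = R.next.symm d.symm := by
  rw [colorWalk, h]; rfl

section

variable {c : G.Dart → Bool}

theorem color_rot (hc : ∀ d, c (R.next d) = c d) (d : G.Dart) : c (R.rot d) = c d.symm := by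
  rw [← next_symm, hc]

theorem color_next_symm (hc : ∀ d, c (R.next d) = c d) (d : G.Dart) :
    c (R.next.symm d) = c d := by
  rw [← hc, Equiv.apply_symm_apply]

theorem color_colorWalk (hc : ∀ d, c (R.next d) = c d) (d : G.Dart) :
    c (R.colorWalk c d) = c d.symm := by
  rw [colorWalk]
  split_ifs
  · exact color_rot hc d
  · exact color_next_symm hc _

theorem colorWalk_injective (hc : ∀ d, c (R.next d) = c d) :
    Function.Injective (R.colorWalk c) := by
  intro d e h
  have h1 : c d.symm = c e.symm := by rw [← color_colorWalk hc, h, color_colorWalk hc]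
  cases h2 : c d.symm
  · rw [colorWalk_of_false h2, colorWalk_of_false (h1 ▸ h2)] at h
    exact Dart.symm_involutive.injective (R.next.symm.injective h)
  · rw [colorWalk_of_true h2, colorWalk_of_true (h1 ▸ h2)] at h
    exact R.rot.injective h

/-- A triangle has three darts, so a bad return reaches `next d` or `next (next d)`. The walk is
periodic, and completing a period turns the second case into the first. -/
theorem isStrongColoring_of_forall_ne [Finite V] (hR : R.IsTriangulated)
    (hc : ∀ d, c (R.next d) = c d) (h : ∀ d k, (R.colorWalk c)^[k] d ≠ R.next d) :
    R.IsStrongColoring c := by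
  intro d k hk
  rcases hR.faceOf_eq_iff.mp hk with h1 | h1 | h1
  · exact h1
  · exact absurd h1 (h d k)
  · exfalso
    obtain ⟨p, hp, hper⟩ := (colorWalk_injective hc).mem_periodicPts d
    -- After the first `k` steps, `k * (p - 1)` more make `k * p` in all, a multiple of the period.
    have h2 : (R.colorWalk c)^[k * (p - 1)] (R.next (R.next d)) = d := by
      rw [← h1, ← Function.iterate_add_apply]
      have : k * (p - 1) + k = p * k := by
        obtain ⟨q, rfl⟩ : ∃ q, p = q + 1 := ⟨p - 1, by omega⟩
        simp only [Nat.add_sub_cancel]; ring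
      rw [this]
      exact hper.mul_const k
    refine h _ _ (h2.trans ?_)
    rw [hR]

/-- A strong colouring is constant on the faces around a vertex of degree three. -/
theorem IsStrongColoring.color_rot_eq (hs : R.IsStrongColoring c) (hR : R.IsTriangulated)
    (hc : ∀ d, c (R.next d) = c d) {e : G.Dart} (he : R.rot (R.rot (R.rot e)) = e) :
    c (R.rot e) = c e := by
  have hnn : ∀ e : G.Dart, R.rot (R.rot (R.rot e)) = e →
      R.next (R.next e) = (R.rot (R.rot e)).symm := by
    intro e he
    rw [← hR.next_symm_eq, next_symm_apply]
    congr 1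
    rw [Equiv.symm_apply_eq, he]
  -- If the face of `e` alone is `false`, the walk from `e` circles the vertex through the two other
  -- faces and re-enters the face of `e` at `next e`. With the colours exchanged, in `hb`, the walk
  -- circles in the other direction.
  have ha : ∀ e : G.Dart, R.rot (R.rot (R.rot e)) = e → c e = false → c (R.rot e) = true →
      c (R.rot (R.rot e)) = true → False := by
    intro e he h0 h1 h2
    refine R.next_ne e ?_
    have h3 : (R.colorWalk c)^[3] e = R.next e := by
      change R.colorWalk c (R.colorWalk c (R.colorWalk c e)) = _
      rw [colorWalk_of_true (d := e) (by rw [← color_rot hc, h1]),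
        colorWalk_of_true (d := R.rot e) (by rw [← color_rot hc, h2]),
        colorWalk_of_false (by rw [← color_rot hc, he, h0]), Equiv.symm_apply_eq, hnn e he]
    rw [← h3]
    exact hs e 3 (by rw [h3, faceOf_next])
  have hb : ∀ e : G.Dart, R.rot (R.rot (R.rot e)) = e → c e = true → c (R.rot e) = false →
      c (R.rot (R.rot e)) = false → False := by
    intro e he h0 h1 h2
    have h3 : (R.colorWalk c)^[3] (R.next (R.next e)) = R.next e := by
      change R.colorWalk c (R.colorWalk c (R.colorWalk c _)) = _
      have hback : ∀ d : G.Dart, c (R.rot d) = false → R.colorWalk c (R.rot d).symm = d.symm := by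
        intro d hd
        rw [colorWalk_of_false (by rw [Dart.symm_symm, hd]), Dart.symm_symm, next_symm_apply,
          Equiv.symm_apply_apply]
      rw [hnn e he, hback _ h2, hback _ h1, colorWalk_of_true (by rw [Dart.symm_symm, h0]),
        next_apply]
    have h4 := hs (R.next (R.next e)) 3 (by simp [h3])
    rw [h3] at h4
    exact R.next_ne _ h4.symm
  have he1 : R.rot (R.rot (R.rot (R.rot e))) = R.rot e := by rw [he]
  have he2 : R.rot (R.rot (R.rot (R.rot (R.rot e)))) = R.rot (R.rot e) := by rw [he]
  have a0 := ha e he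
  have a1 := ha _ he1
  have a2 := ha _ he2
  have b0 := hb e he
  have b1 := hb _ he1
  have b2 := hb _ he2
  rw [he] at a1 b1 a2 b2
  cases h0 : c e <;> cases h1 : c (R.rot e) <;> cases h2 : c (R.rot (R.rot e)) <;> simp_all

end

namespace IsDeletion

variable {W W' : Type*} {T : SimpleGraph W} {T' : SimpleGraph W'}
  {R : RotationSystem T} {R' : RotationSystem T'} {j : T ↪g T'} {n : W'} {c : T'.Dart → Bool}
  {κ : Bool}

theorem color_next (h : R.IsDeletion R' j n) (hc : ∀ d, c (R'.next d) = c d)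
    (hκ : ∀ e : T'.Dart, e.fst = n → c e = κ) (d : T.Dart) :
    c (j.dart (R.next d)) = c (j.dart d) := by
  by_cases hd : (R'.next (j.dart d)).snd = n
  · obtain ⟨e, he⟩ : ∃ e : T'.Dart, R'.next (j.dart d) = e.symm :=
      ⟨(R'.next (j.dart d)).symm, by simp⟩
    have hen : e.fst = n := by rw [he] at hd; exact hd
    rw [h.dart_next_of_next_eq hen he, hc, hκ e hen, ← hc (j.dart d), he, ← color_rot hc,
      hκ _ ((R'.rot_fst e).trans hen)]
  · rw [h.dart_next_of_ne hd, hc]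

/-- A step that skips a dart into `n` splits into two steps of the larger graph. Both faces at the
removed edge have colour `κ`, so both turns are of the same kind. -/
theorem exists_iterate_dart_colorWalk (h : R.IsDeletion R' j n)
    (hc : ∀ d, c (R'.next d) = c d) (hκ : ∀ e : T'.Dart, e.fst = n → c e = κ) (d : T.Dart) :
    ∃ k, (R'.colorWalk c)^[k] (j.dart d) = j.dart (R.colorWalk (fun d => c (j.dart d)) d) := by
  cases hd : c (j.dart d).symm
  · rw [colorWalk_of_false (c := fun d => c (j.dart d)) hd]
    obtain ⟨y, hy⟩ : ∃ y, R.next y = d.symm := R.next.surjective _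
    rw [← hy, Equiv.symm_apply_apply]
    by_cases hyn : (R'.next (j.dart y)).snd = n
    · obtain ⟨e, he⟩ : ∃ e : T'.Dart, R'.next (j.dart y) = e.symm :=
        ⟨(R'.next (j.dart y)).symm, by simp⟩
      have hen : e.fst = n := by rw [he] at hyn; exact hyn
      have h1 := h.dart_next_of_next_eq hen he
      rw [hy, j.dart_symm] at h1
      refine ⟨2, ?_⟩
      change R'.colorWalk c (R'.colorWalk c _) = _
      rw [colorWalk_of_false hd, h1, Equiv.symm_apply_apply, colorWalk_of_false, ← he,
        Equiv.symm_apply_apply]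
      rw [← color_rot hc, hκ _ ((R'.rot_fst e).trans hen), ← hκ e hen, ← hc, ← h1, hd]
    · refine ⟨1, ?_⟩
      have h1 := h.dart_next_of_ne hyn
      change R'.colorWalk c _ = _
      rw [colorWalk_of_false hd, Equiv.symm_apply_eq, ← h1, hy, j.dart_symm]
  · rw [colorWalk_of_true (c := fun d => c (j.dart d)) hd, h]
    split_ifs with hn
    · refine ⟨2, ?_⟩
      change R'.colorWalk c (R'.colorWalk c _) = _
      rw [colorWalk_of_true hd, colorWalk_of_true]
      have h1 : (R'.rot (j.dart d)).symm.fst = n := hn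
      rw [hκ _ h1, ← hκ _ ((R'.rot_fst _).trans h1), color_rot hc, Dart.symm_symm, color_rot hc, hd]
    · exact ⟨1, colorWalk_of_true hd⟩

theorem exists_iterate_dart (h : R.IsDeletion R' j n) (hc : ∀ d, c (R'.next d) = c d)
    (hκ : ∀ e : T'.Dart, e.fst = n → c e = κ) (d : T.Dart) (k : ℕ) :
    ∃ m, (R'.colorWalk c)^[m] (j.dart d) =
      j.dart ((R.colorWalk (fun d => c (j.dart d)))^[k] d) := by
  induction k with
  | zero => exact ⟨0, rfl⟩
  | succ k ih =>
    obtain ⟨m, hm⟩ := ih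
    obtain ⟨l, hl⟩ := h.exists_iterate_dart_colorWalk hc hκ
      ((R.colorWalk (fun d => c (j.dart d)))^[k] d)
    refine ⟨l + m, ?_⟩
    rw [Function.iterate_add_apply, hm, hl, Function.iterate_succ_apply']

/-- A strong colouring restricts to a strong colouring after the deletion of a vertex around which
it is constant. -/
theorem isStrongColoring [Finite W] (h : R.IsDeletion R' j n) (hj : j.IsDeletion n)
    (hR : R.IsTriangulated) (hs : R'.IsStrongColoring c)
    (hc : ∀ d, c (R'.next d) = c d) (hκ : ∀ e : T'.Dart, e.fst = n → c e = κ) :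
    R.IsStrongColoring (fun d => c (j.dart d)) := by
  refine isStrongColoring_of_forall_ne hR (h.color_next hc hκ) fun d k hk => ?_
  obtain ⟨m, hm⟩ := h.exists_iterate_dart hc hκ d k
  rw [hk] at hm
  by_cases hd : (R'.next (j.dart d)).snd = n
  · obtain ⟨e, he⟩ : ∃ e : T'.Dart, R'.next (j.dart d) = e.symm :=
      ⟨(R'.next (j.dart d)).symm, by simp⟩
    have hen : e.fst = n := by rw [he] at hd; exact hd
    have h1 := h.dart_next_of_next_eq hen he
    have hce : c e = κ := hκ e hen
    have hcs : c e.symm = κ := by rw [← color_rot hc, hκ _ ((R'.rot_fst e).trans hen)]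
    -- The lifted walk from `j.dart d` ends at `next e`, in another triangle at `n`. It is brought
    -- back to a single face by a step in front starting from `e` if `κ` is `false`, or by dropping
    -- the last step, which leaves from `e.symm`, if `κ` is `true`.
    cases κ
    · have h2 : R'.colorWalk c e = j.dart d := by
        rw [colorWalk_of_false hcs, ← he, Equiv.symm_apply_apply]
      have h3 : (R'.colorWalk c)^[m + 1] e = R'.next e := by
        rw [Function.iterate_succ_apply, h2, hm, h1]
      have h4 := hs e (m + 1) (by rw [h3, faceOf_next])
      rw [h3] at h4
      exact R'.next_ne e h4
    · have h2 : R'.colorWalk c e.symm = R'.next e := by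
        rw [colorWalk_of_true (by rw [Dart.symm_symm, hce])]; rfl
      match m, hm with
      | 0, hm => exact R.next_ne d (j.dart_injective hm).symm
      | m + 1, hm =>
        rw [Function.iterate_succ_apply', h1, ← h2] at hm
        have h3 := colorWalk_injective hc hm
        have h4 := hs (j.dart d) m (by rw [h3, ← he, faceOf_next])
        rw [h3] at h4
        have h5 : e.symm.snd = j d.snd := congrArg (fun z => z.snd) h4
        exact hj.apply_ne _ (h5.symm.trans hen)
  · rw [h.dart_next_of_ne hd] at hm
    have h1 := hs (j.dart d) m (by rw [hm, faceOf_next])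
    rw [hm] at h1
    exact R'.next_ne _ h1

end IsDeletion

end RotationSystem

/-! ### Strong colourings of Apollonian networks are constant. -/

section Apollonian

/-- A graph as a subgraph of the subdivision of one of its triangles. -/
def subdivideEmbedding {W : Type*} (T : SimpleGraph W) (a b c : W) :
    T ↪g T.subdivideTriangle a b c where
  toFun := some
  inj' := Option.some_injective W
  map_rel_iff' := Iff.rfl

theorem subdivideEmbedding_isDeletion {W : Type*} (T : SimpleGraph W) (a b c : W) :
    (T.subdivideEmbedding a b c).IsDeletion none := by
  intro w
  exact Option.ne_none_iff_exists

theorem ncard_neighborSet_none {W : Type*} (T : SimpleGraph W) {a b c : W} (hab : a ≠ b)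
    (hac : a ≠ c) (hbc : b ≠ c) :
    ((T.subdivideTriangle a b c).neighborSet none).ncard = 3 := by
  have : (T.subdivideTriangle a b c).neighborSet none = {some a, some b, some c} := by
    ext w
    cases w with
    | none => simp
    | some w =>
      change (w = a ∨ w = b ∨ w = c) ↔ _
      simp
  rw [this, Set.ncard_eq_three]
  exact ⟨_, _, _, by simpa using hab, by simpa using hac, by simpa using hbc, rfl⟩

theorem RotationSystem.adj_of_next_next_next {W : Type*} {T : SimpleGraph W} {R : RotationSystem T}
    {d : T.Dart} (hd : R.next (R.next (R.next d)) = d) :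
    T.Adj d.fst (R.next d).fst ∧ T.Adj (R.next d).fst (R.next (R.next d)).fst ∧
      T.Adj d.fst (R.next (R.next d)).fst := by
  refine ⟨?_, ?_, ?_⟩
  · rw [R.next_fst]; exact d.adj
  · rw [R.next_fst (R.next d)]; exact (R.next d).adj
  · have h := (R.next (R.next d)).adj
    rw [← R.next_fst (R.next (R.next d)), hd] at h
    exact h.symm

theorem IsApollonianNetwork.finite {W : Type} {T : SimpleGraph W} (h : IsApollonianNetwork T) :
    Finite W := by
  induction h with
  | completeGraph => infer_instance
  | subdivide T hT R hR d hd ih => infer_instance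

theorem IsApollonianNetwork.four_le_card {W : Type} {T : SimpleGraph W}
    (h : IsApollonianNetwork T) : 4 ≤ Nat.card W := by
  induction h with
  | completeGraph => simp
  | subdivide T hT R hR d hd ih =>
    have := hT.finite
    rw [Finite.card_option]; omega

theorem IsApollonianNetwork.card_dart {W : Type} {T : SimpleGraph W}
    (h : IsApollonianNetwork T) : Nat.card T.Dart + 12 = 6 * Nat.card W := by
  induction h with
  | completeGraph =>
    rw [Nat.card_eq_fintype_card, dart_card_eq_sum_degrees]
    simp
  | subdivide T hT R hR d hd ih =>
    have := hT.finite
    obtain ⟨h1, h2, h3⟩ := RotationSystem.adj_of_next_next_next hd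
    rw [(T.subdivideEmbedding_isDeletion _ _ _).card_dart,
      ncard_neighborSet_none T h1.ne h3.ne h2.ne, Finite.card_option]
    omega

theorem IsApollonianNetwork.exists_adj_ne {W : Type} {T : SimpleGraph W}
    (h : IsApollonianNetwork T) {u v : W} (huv : T.Adj u v) : ∃ w, w ≠ v ∧ T.Adj u w := by
  induction h with
  | completeGraph =>
    revert u v
    simp only [top_adj]
    decide
  | subdivide T hT R hR d hd ih =>
    obtain ⟨h1, h2, h3⟩ := RotationSystem.adj_of_next_next_next hd
    match u, v, huv with
    | some u, some v, huv =>
      obtain ⟨w, hw, hw'⟩ := ih (u := u) (v := v) huv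
      exact ⟨some w, by simpa using hw, hw'⟩
    | some u, none, huv =>
      rcases huv with rfl | rfl | rfl
      · exact ⟨some _, by simp, h1⟩
      · exact ⟨some _, by simp, h2⟩
      · exact ⟨some _, by simp, h3.symm⟩
    | none, some v, huv =>
      by_cases hv : v = d.fst
      · exact ⟨some _, by rw [hv]; simp, Or.inr (Or.inl rfl)⟩
      · exact ⟨some d.fst, by simpa using Ne.symm hv, Or.inl rfl⟩

/-- On an Apollonian network only the constant colourings are strong. -/
theorem IsApollonianNetwork.color_eq {W : Type} {T : SimpleGraph W}
    (h : IsApollonianNetwork T) (R : RotationSystem T) (hR : R.IsTriangulated)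
    {c : T.Dart → Bool} (hc : ∀ d, c (R.next d) = c d) (hs : R.IsStrongColoring c)
    (d e : T.Dart) : c d = c e := by
  induction h with
  | completeGraph =>
    have hrot : ∀ d, c (R.rot d) = c d := by
      intro d
      refine hs.color_rot_eq hR hc ((R.rot_pow_eq_iff d 3).mpr ?_)
      have : (⊤ : SimpleGraph (Fin 4)).neighborSet d.fst = {d.fst}ᶜ := by
        ext; simp
      rw [this, Set.ncard_compl]
      simp
    exact R.eq_of_invariant connected_top hrot
      (fun d => by rw [← RotationSystem.color_rot hc, hrot]) d e
  | subdivide T hT R₀ hR₀ d₀ hd₀ ih =>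
    have := hT.finite
    obtain ⟨h1, h2, h3⟩ := RotationSystem.adj_of_next_next_next hd₀
    have hj := T.subdivideEmbedding_isDeletion d₀.fst (R₀.next d₀).fst (R₀.next (R₀.next d₀)).fst
    set j := T.subdivideEmbedding d₀.fst (R₀.next d₀).fst (R₀.next (R₀.next d₀)).fst with hjdef
    -- `R` need not extend the `R₀` of the construction, so the induction hypothesis is applied to
    -- the rotation system that `R` itself induces.
    obtain ⟨S, hS⟩ := R.exists_isDeletion hj hR.rot_ne
    have hdeg := ncard_neighborSet_none T h1.ne h3.ne h2.ne
    have hthree : ∀ e, e.fst = none → R.rot (R.rot (R.rot e)) = e := by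
      intro e he
      refine (R.rot_pow_eq_iff e 3).mpr ?_
      rw [he, hdeg]
    have hStri := hS.isTriangulated hj hR hthree
    -- Every face keeps a side that survives the deletion, so no colour is lost.
    have hex : ∀ d, ∃ d', c d = c (j.dart d') := by
      have hn : ∀ e, e.fst = none → ∃ d', c e = c (j.dart d') := by
        intro e he
        obtain ⟨d', hd'⟩ := hj.exists_dart (d := R.next e) (by
          rw [R.next_fst]; intro h'; exact e.fst_ne_snd (he.trans h'.symm)) (by
          intro h'
          have h4 := hR.next_next_snd e
          exact (R.next (R.next e)).fst_ne_snd (by rw [h4, R.next_fst, h', he]))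
        exact ⟨d', by rw [hd', hc]⟩
      intro d
      by_cases hd1 : d.fst = none
      · exact hn d hd1
      · by_cases hd2 : d.snd = none
        · obtain ⟨d', hd'⟩ := hn (R.rot d.symm) (by rw [R.rot_fst]; exact hd2)
          refine ⟨d', ?_⟩
          rw [← hd', RotationSystem.color_rot hc, Dart.symm_symm]
        · obtain ⟨d', hd'⟩ := hj.exists_dart hd1 hd2
          exact ⟨d', by rw [hd']⟩
    have hκ : ∀ e : (T.subdivideTriangle d₀.fst (R₀.next d₀).fst
        (R₀.next (R₀.next d₀)).fst).Dart, e.fst = none →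
        c e = c ⟨(none, some d₀.fst), Or.inl rfl⟩ := by
      intro e he
      have hcyc := R.sameCycle_rot.mpr
        (show e.fst = (⟨(none, some d₀.fst), Or.inl rfl⟩ : (T.subdivideTriangle d₀.fst
          (R₀.next d₀).fst (R₀.next (R₀.next d₀)).fst).Dart).fst from he)
      obtain ⟨k, hk⟩ := hcyc.exists_nat_pow_eq
      rw [← hk]
      clear hk hcyc
      induction k with
      | zero => rfl
      | succ k ihk =>
        rw [ihk, pow_succ', Equiv.Perm.mul_apply]
        refine (hs.color_rot_eq hR hc (hthree _ ?_)).symm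
        rw [← he]
        exact ((R.sameCycle_rot.mp (Equiv.Perm.sameCycle_pow_right.mpr
          (Equiv.Perm.SameCycle.refl _ _))).symm)
    have hsS := hS.isStrongColoring hj hStri hs hc hκ
    obtain ⟨d', hd'⟩ := hex d
    obtain ⟨e', he'⟩ := hex e
    rw [hd', he']
    exact ih S hStri (hS.color_next hc hκ) hsS d' e'

end Apollonian

end SimpleGraph

/-! ### Rotation systems of a cubic dual as face colourings. -/

namespace SimpleGraph
namespace RotationSystem

variable {V : Type*} {G : SimpleGraph V} {R : RotationSystem G}

theorem rot_ne_of_exists_adj (R : RotationSystem G) (d : G.Dart)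
    (h : ∃ w, w ≠ d.snd ∧ G.Adj d.fst w) : R.rot d ≠ d := by
  obtain ⟨w, hw, hadj⟩ := h
  intro hd
  have := R.sameCycle_rot (d := d) (e := ⟨(d.fst, w), hadj⟩)
  have h2 := (this.mpr rfl).eq_of_left hd
  exact hw (congrArg (fun z => z.snd) h2).symm

/-- If every face of a triangulation has three neighbours, then the dual is simple. -/
theorem IsTriangulated.isDualSimple [Finite V] (hR : R.IsTriangulated)
    (h3 : ∀ f, (R.dualGraph.neighborSet f).ncard = 3) : R.IsDualSimple := by
  have key : ∀ d : G.Dart, R.dualGraph.neighborSet (R.faceOf d) =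
      (fun x => R.faceOf x.symm) '' ({d, R.next d, R.next (R.next d)} : Set G.Dart) ∧
      Set.InjOn (fun x : G.Dart => R.faceOf x.symm) {d, R.next d, R.next (R.next d)} := by
    intro d
    have hcard : ({d, R.next d, R.next (R.next d)} : Set G.Dart).ncard = 3 :=
      Set.ncard_eq_three.mpr
        ⟨_, _, _, (R.next_ne d).symm, (hR.next_next_ne d).symm, (R.next_ne _).symm, rfl⟩
    have hsub : R.dualGraph.neighborSet (R.faceOf d) ⊆
        (fun x => R.faceOf x.symm) '' ({d, R.next d, R.next (R.next d)} : Set G.Dart) := by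
      rintro f ⟨-, x, hx, rfl⟩
      exact ⟨x, by simpa using hR.faceOf_eq_iff.mp hx, rfl⟩
    have hle := Set.ncard_image_le (f := fun x : G.Dart => R.faceOf x.symm)
      (Set.toFinite ({d, R.next d, R.next (R.next d)} : Set G.Dart))
    have heq := Set.eq_of_subset_of_ncard_le hsub (by rw [h3, ← hcard]; exact hle)
    refine ⟨heq, Set.injOn_of_ncard_image_eq ?_⟩
    rw [← heq, h3, hcard]
  constructor
  · intro d
    have : R.faceOf d.symm ∈ R.dualGraph.neighborSet (R.faceOf d) := by
      rw [(key d).1]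
      exact ⟨d, by simp, rfl⟩
    exact this.1
  · intro d e h₁ h₂
    refine (key d).2 (by simp) ?_ h₂
    simpa using hR.faceOf_eq_iff.mp h₁.symm

open Classical in
/-- The face colouring of a triangulation that describes a rotation system of its cubic dual. -/
noncomputable def dualColor (h : R.IsDualSimple) (S : RotationSystem R.dualGraph)
    (d : G.Dart) : Bool := decide (S.rot (R.dualDart h d) = R.dualDart h (R.next d))

section

variable {h : R.IsDualSimple} {S : RotationSystem R.dualGraph}

theorem dualColor_eq_true {d : G.Dart} :
    dualColor h S d = true ↔ S.rot (R.dualDart h d) = R.dualDart h (R.next d) := by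
  simp [dualColor]

variable [Finite V]

theorem IsTriangulated.rot_dualDart (hR : R.IsTriangulated)
    (h3 : ∀ f, (R.dualGraph.neighborSet f).ncard = 3) (d : G.Dart) :
    S.rot (R.dualDart h d) = R.dualDart h (R.next d) ∨
      S.rot (R.dualDart h d) = R.dualDart h (R.next (R.next d)) := by
  obtain ⟨x, hx⟩ := (R.dualDart h).surjective (S.rot (R.dualDart h d))
  have hfst : R.faceOf x = R.faceOf d := by
    have := congrArg (fun z => z.fst) hx
    simpa using this
  rw [← hx]
  rcases hR.faceOf_eq_iff.mp hfst with rfl | rfl | rfl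
  · exfalso
    have h1 := (S.rot_pow_eq_iff (R.dualDart h x) 1).mp (by simpa using hx.symm)
    rw [h3] at h1
    omega
  · exact Or.inl rfl
  · exact Or.inr rfl

theorem IsTriangulated.rot_rot_rot_dualDart
    (h3 : ∀ f, (R.dualGraph.neighborSet f).ncard = 3) (x : R.dualGraph.Dart) :
    S.rot (S.rot (S.rot x)) = x :=
  (S.rot_pow_eq_iff x 3).mpr (by rw [h3])

/-- A cyclic permutation of the three darts of a face is `next` or its inverse, so agreement with
`next` at one dart decides it on the whole face. -/
theorem IsTriangulated.dualColor_next (hR : R.IsTriangulated)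
    (h3 : ∀ f, (R.dualGraph.neighborSet f).ncard = 3) (d : G.Dart) :
    dualColor h S (R.next d) = dualColor h S d := by
  rw [Bool.eq_iff_iff, dualColor_eq_true, dualColor_eq_true]
  constructor
  · intro h1
    rcases hR.rot_dualDart (h := h) (S := S) h3 d with h2 | h2
    · exact h2
    · rw [← h1] at h2
      exact absurd ((R.dualDart h).injective (S.rot.injective h2)).symm (R.next_ne d)
  · intro h1
    rcases hR.rot_dualDart (h := h) (S := S) h3 (R.next d) with h2 | h2
    · exact h2
    · rw [hR] at h2
      have h4 := IsTriangulated.rot_rot_rot_dualDart (S := S) h3 (R.dualDart h d)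
      rw [h1, h2, h1] at h4
      exact absurd ((R.dualDart h).injective h4) (R.next_ne d)

/-- The dictionary between facial walks of `S` and walks of the colouring. -/
theorem IsTriangulated.dualDart_colorWalk (hR : R.IsTriangulated)
    (h3 : ∀ f, (R.dualGraph.neighborSet f).ncard = 3) (d : G.Dart) :
    R.dualDart h (R.colorWalk (dualColor h S) d) = S.next (R.dualDart h d) := by
  rw [next_apply, ← dualDart_symm]
  by_cases hd : dualColor h S d.symm = true
  · rw [colorWalk_of_true hd, dualColor_eq_true.mp hd, next_symm]
  · rw [colorWalk_of_false (Bool.eq_false_iff.mpr hd), hR.next_symm_eq]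
    exact ((hR.rot_dualDart h3 d.symm).resolve_left fun h1 => hd (dualColor_eq_true.mpr h1)).symm

theorem IsStrong.isStrongColoring (hS : S.IsStrong) (hR : R.IsTriangulated)
    (h3 : ∀ f, (R.dualGraph.neighborSet f).ncard = 3) :
    R.IsStrongColoring (dualColor h S) := by
  have key : ∀ d k, R.dualDart h ((R.colorWalk (dualColor h S))^[k] d) =
      (S.next ^ k) (R.dualDart h d) := by
    intro d k
    induction k with
    | zero => rfl
    | succ k ih =>
      rw [Function.iterate_succ_apply', hR.dualDart_colorWalk h3, ih, pow_succ']; rfl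
  intro d k hk
  refine (R.dualDart h).injective (hS.1 _ _ ?_ hk)
  rw [S.faceOf_eq_iff, key]
  exact Equiv.Perm.sameCycle_pow_left.mpr (Equiv.Perm.SameCycle.refl _ _)

/-- A constant colouring makes `S` the dual embedding or its mirror image: `S.next` is conjugate to
`R.rot` or to its inverse, whose cycles are the vertices. -/
theorem IsTriangulated.card_face_of_const [Nontrivial V] (hG : G.Connected) (hR : R.IsTriangulated)
    (h3 : ∀ f, (R.dualGraph.neighborSet f).ncard = 3)
    (hconst : ∀ d e, dualColor h S d = dualColor h S e) : Nat.card S.Face = Nat.card V := by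
  rw [← R.card_quotient_rot hG]
  obtain ⟨d₀, -⟩ := hG.exists_dart_fst hG.nonempty.some
  cases hd₀ : dualColor h S d₀
  · have hnext : S.next = (G.symmPerm.trans (R.dualDart h)).permCongr R.rot⁻¹ := by
      ext1 x
      obtain ⟨d, rfl⟩ := (R.dualDart h).surjective x
      rw [← hR.dualDart_colorWalk h3, colorWalk_of_false ((hconst _ _).trans hd₀)]
      simp only [Equiv.permCongr_apply, Equiv.symm_trans_apply, Equiv.symm_apply_apply,
        Equiv.trans_apply]
      rfl
    change Nat.card (Quotient (Equiv.Perm.SameCycle.setoid S.next)) = _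
    rw [hnext, Equiv.Perm.card_quotient_permCongr]
    exact Nat.card_congr (Quotient.congrRight fun _ _ => Equiv.Perm.sameCycle_inv)
  · have hnext : S.next = (R.dualDart h).permCongr R.rot := by
      ext1 x
      obtain ⟨d, rfl⟩ := (R.dualDart h).surjective x
      rw [← hR.dualDart_colorWalk h3, colorWalk_of_true ((hconst _ _).trans hd₀)]
      simp
    change Nat.card (Quotient (Equiv.Perm.SameCycle.setoid S.next)) = _
    rw [hnext, Equiv.Perm.card_quotient_permCongr]

end

end RotationSystem

theorem IsRegularOfDegree.ncard_neighborSet {V : Type*} {G : SimpleGraph V} [G.LocallyFinite]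
    {k : ℕ} (h : G.IsRegularOfDegree k) (v : V) : (G.neighborSet v).ncard = k := by
  rw [← h v, ← card_neighborSet_eq_degree, Set.ncard_eq_toFinset_card', Set.toFinset_card]

theorem Iso.ncard_neighborSet {V W : Type*} {G : SimpleGraph V} {H : SimpleGraph W} (e : G ≃g H)
    (v : V) : (H.neighborSet (e v)).ncard = (G.neighborSet v).ncard := by
  rw [← Nat.card_coe_set_eq, ← Nat.card_coe_set_eq]
  exact (Nat.card_congr (e.mapNeighborSet v)).symm

/-- A strong embedding of a cubic Apollonian dual on an orientable surface is on the sphere. -/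
theorem IsApollonianDual.genus_eq_zero {V : Type*} {G : SimpleGraph V}
    [G.LocallyFinite] (h : G.IsApollonianDual) (hG : G.IsRegularOfDegree 3)
    {S : RotationSystem G} (hS : S.IsStrong) {g : ℕ} (hg : S.HasGenus g) : g = 0 := by
  obtain ⟨W, T, R, hT, hR, ⟨e⟩⟩ := h
  have := hT.finite
  have hcard := hT.card_dart
  have hNt : Nontrivial W := Finite.one_lt_card_iff_nontrivial.mp (by have := hT.four_le_card; omega)
  have htri : R.IsTriangulated := hR.isTriangulated
    (fun d => R.rot_ne_of_exists_adj d (hT.exists_adj_ne d.adj)) hcard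
  have h3 : ∀ f, (R.dualGraph.neighborSet f).ncard = 3 := by
    intro f
    obtain ⟨v, rfl⟩ := e.surjective f
    rw [e.ncard_neighborSet, hG.ncard_neighborSet]
  have hds := htri.isDualSimple h3
  have hconst := hT.color_eq R htri (htri.dualColor_next (h := hds) (S := S.mapIso e) h3)
    ((hS.mapIso e).isStrongColoring htri h3)
  have h1 := htri.card_face_of_const hR.1 h3 hconst
  have hg' := hg.mapIso e
  have h2 := ((S.mapIso e).hasGenus_iff hg'.1 g).mp hg'
  have h4 := (R.hasGenus_iff hR.1 0).mp hR
  rw [h1, ← Nat.card_congr (R.dualDart hds)] at h2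
  omega

end SimpleGraph

/-! ### Simplicity of the dual of a 3-connected cubic plane graph. -/

namespace SimpleGraph

variable {V : Type*} {G : SimpleGraph V}

section EdgeIndicator

open Classical in
/-- The indicator function modulo `2` of the edge of the dart `d`. -/
noncomputable def edgeIndicator (d : G.Dart) : G.Dart → ZMod 2 :=
  Pi.single d 1 + Pi.single d.symm 1

theorem edgeIndicator_self (d : G.Dart) : edgeIndicator d d = 1 := by
  simp [edgeIndicator, d.symm_ne.symm]

theorem edgeIndicator_of_ne {d e : G.Dart} (h₁ : e ≠ d) (h₂ : e ≠ d.symm) :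
    edgeIndicator d e = 0 := by
  simp [edgeIndicator, h₁, h₂]

theorem edgeIndicator_symm (d e : G.Dart) : edgeIndicator d e.symm = edgeIndicator d e := by
  classical
  have h1 : e.symm = d ↔ e = d.symm := Dart.symm_involutive.eq_iff
  have h2 : e.symm = d.symm ↔ e = d := Dart.symm_involutive.injective.eq_iff
  simp only [edgeIndicator, Pi.add_apply, Pi.single_apply, h1, h2]
  rw [add_comm]

theorem sum_mul_edgeIndicator [Fintype G.Dart] (f : G.Dart → ZMod 2) (d : G.Dart) :
    ∑ e, f e * edgeIndicator d e = f d + f d.symm := by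
  classical
  simp [edgeIndicator, mul_add, Finset.sum_add_distrib, Pi.single_apply]

end EdgeIndicator

/-- Deleting `S` destroys every edge of the cut `x`, so `k` is constant on the connected remainder.
-/
theorem IsThreeConnected.eq_of_cut (hG : G.IsThreeConnected) {x : G.Dart → ZMod 2}
    {k : V → ZMod 2} (hk : ∀ d : G.Dart, x d = k d.fst + k d.snd) {S : Set V} (hfin : S.Finite)
    (hS : S.ncard < 3) (hx : ∀ d : G.Dart, d.fst ∉ S → d.snd ∉ S → x d = 0) {u v : V}
    (hu : u ∉ S) (hv : v ∉ S) : k u = k v := by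
  obtain ⟨p⟩ := (hG.2 S hfin hS).preconnected ⟨u, hu⟩ ⟨v, hv⟩
  have key : ∀ {a b : (Sᶜ : Set V)} (_ : (G.induce Sᶜ).Walk a b), k a = k b := by
    intro a b p
    induction p with
    | nil => rfl
    | cons h p ih =>
      rename_i a b c
      rw [← ih]
      have h1 := hk ⟨(a.1, b.1), h⟩
      rw [hx ⟨(a.1, b.1), h⟩ a.2 b.2] at h1
      exact CharTwo.add_eq_zero.mp h1.symm
  exact key p

theorem ncard_pair_le {α : Type*} (a b : α) : ({a, b} : Set α).ncard ≤ 2 :=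
  (Set.ncard_insert_le _ _).trans (by simp)

theorem exists_adj_ne_ne {v : V} (h : (G.neighborSet v).ncard = 3) (w₁ w₂ : V) :
    ∃ m, G.Adj v m ∧ m ≠ w₁ ∧ m ≠ w₂ := by
  by_contra! hcon
  have hsub : G.neighborSet v ⊆ {w₁, w₂} := by
    intro m hm
    by_cases h1 : m = w₁
    · exact Or.inl h1
    · exact Or.inr (hcon m hm h1)
  have := Set.ncard_le_ncard hsub
  have := ncard_pair_le w₁ w₂
  omega

theorem IsThreeConnected.nontrivial [Finite V] (hG : G.IsThreeConnected) : Nontrivial V :=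
  Finite.one_lt_card_iff_nontrivial.mp (by have := hG.1; omega)

/-- The dual of a `3`-connected cubic graph embedded on the sphere is simple. -/
theorem IsThreeConnected.isDualSimple [Finite V] (hG : G.IsThreeConnected)
    (h3 : ∀ v, (G.neighborSet v).ncard = 3) {R : RotationSystem G} (hR : R.HasGenus 0) :
    R.IsDualSimple := by
  have := hG.nontrivial
  have := Fintype.ofFinite G.Dart
  have hloop : ∀ d : G.Dart, R.faceOf d ≠ R.faceOf d.symm := by
    intro d hd
    -- An edge with one face on both sides meets every face evenly, so it is a cut by itself.
    -- Deleting its tail leaves its head connected to another neighbour `m` of the tail, although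
    -- `k` separates them.
    obtain ⟨k, hk⟩ := hR.exists_vertexColoring (edgeIndicator_symm d) (fun f hf => by
      rw [sum_mul_edgeIndicator, R.eq_of_next_invariant hf hd]
      exact CharTwo.add_self_eq_zero _)
    obtain ⟨m, hm, hmd, -⟩ := exists_adj_ne_ne (h3 d.fst) d.snd d.snd
    have h1 := hk ⟨(d.fst, m), hm⟩
    rw [edgeIndicator_of_ne (fun h => hmd (congrArg (fun z => z.snd) h))
      (fun h => d.fst_ne_snd (congrArg (fun z => z.fst) h))] at h1
    have h2 := hk d
    rw [edgeIndicator_self] at h2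
    have h4 : k d.snd = k m := by
      refine hG.eq_of_cut hk (Set.finite_singleton d.fst) (by simp) (fun e h₁ h₂ => ?_)
        d.snd_ne_fst hm.ne'
      exact edgeIndicator_of_ne (by rintro rfl; exact h₁ rfl) (by rintro rfl; exact h₂ rfl)
    rw [h4] at h2
    exact one_ne_zero (h2.trans h1.symm)
  refine ⟨hloop, fun d e hd₁ hd₂ => ?_⟩
  by_contra hde
  have hde' : e ≠ d.symm := by
    rintro rfl
    exact hloop d hd₁
  -- Two edges between the same faces form a cut. One or two vertices covering both are deleted, and
  -- a further edge at an end of `d` leads to the remainder.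
  obtain ⟨k, hk⟩ := hR.exists_vertexColoring (x := edgeIndicator d + edgeIndicator e)
    (fun y => by simp only [Pi.add_apply, edgeIndicator_symm]) (fun f hf => by
      simp only [Pi.add_apply, mul_add, Finset.sum_add_distrib, sum_mul_edgeIndicator]
      rw [R.eq_of_next_invariant hf hd₁, R.eq_of_next_invariant hf hd₂]
      exact CharTwo.add_self_eq_zero _)
  have hzero : ∀ y, y ≠ d → y ≠ d.symm → y ≠ e → y ≠ e.symm →
      (edgeIndicator d + edgeIndicator e) y = 0 := by
    intro y h1 h2 h4 h5
    rw [Pi.add_apply, edgeIndicator_of_ne h1 h2, edgeIndicator_of_ne h4 h5, add_zero]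
  have hd : k d.fst + k d.snd = 1 := by
    rw [← hk, Pi.add_apply, edgeIndicator_self, edgeIndicator_of_ne hde, add_zero]
    rintro rfl
    exact hde' (Dart.symm_symm _).symm
  have hcut : ∀ (S : Set V), S.ncard < 3 → (d.fst ∈ S ∨ d.snd ∈ S) → (e.fst ∈ S ∨ e.snd ∈ S) →
      ∀ u v, u ∉ S → v ∉ S → k u = k v := by
    intro S hS hdS heS u v hu hv
    refine hG.eq_of_cut hk S.toFinite hS (fun y h₁ h₂ => ?_) hu hv
    refine hzero y ?_ ?_ ?_ ?_ <;> rintro rfl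
    · exact hdS.elim h₁ h₂
    · exact hdS.elim h₂ h₁
    · exact heS.elim h₁ h₂
    · exact heS.elim h₂ h₁
  have hfinish : ∀ a m : V, (hm : G.Adj a m) → (⟨(a, m), hm⟩ : G.Dart) ≠ d →
      (⟨(a, m), hm⟩ : G.Dart) ≠ d.symm → (⟨(a, m), hm⟩ : G.Dart) ≠ e →
      (⟨(a, m), hm⟩ : G.Dart) ≠ e.symm → k m = k a := by
    intro a m hm h1 h2 h4 h5
    have h6 := hk ⟨(a, m), hm⟩
    rw [hzero _ h1 h2 h4 h5] at h6
    exact (CharTwo.add_eq_zero.mp h6.symm).symm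
  have hf : ∀ {a m : V} {hm : G.Adj a m} {y : G.Dart}, (⟨(a, m), hm⟩ : G.Dart) = y →
      a = y.fst ∧ m = y.snd := by
    rintro a m hm y rfl
    exact ⟨rfl, rfl⟩
  by_cases hc1 : e.fst = d.fst
  · obtain ⟨m, hm, hmd, hme⟩ := exists_adj_ne_ne (h3 d.fst) d.snd e.snd
    have h1 := hfinish d.fst m hm (fun h => hmd (hf h).2) (fun h => d.fst_ne_snd (hf h).1)
      (fun h => hme (hf h).2) (fun h => e.fst_ne_snd (hc1.trans (hf h).1))
    have h2 := hcut {d.fst} (by simp) (Or.inl rfl) (Or.inl hc1) d.snd m d.snd_ne_fst hm.ne'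
    rw [h2, h1, CharTwo.add_self_eq_zero] at hd
    exact zero_ne_one hd
  by_cases hc2 : e.fst = d.snd
  · obtain ⟨m, hm, hmd, hme⟩ := exists_adj_ne_ne (h3 d.snd) d.fst e.snd
    have h1 := hfinish d.snd m hm (fun h => d.snd_ne_fst (hf h).1) (fun h => hmd (hf h).2)
      (fun h => hme (hf h).2) (fun h => e.fst_ne_snd (hc2.trans (hf h).1))
    have h2 := hcut {d.snd} (by simp) (Or.inr rfl) (Or.inl hc2) d.fst m d.fst_ne_snd hm.ne'
    rw [h2, h1, CharTwo.add_self_eq_zero] at hd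
    exact zero_ne_one hd
  · obtain ⟨m, hm, hmd, hme⟩ := exists_adj_ne_ne (h3 d.fst) d.snd e.fst
    have h1 := hfinish d.fst m hm (fun h => hmd (hf h).2) (fun h => d.fst_ne_snd (hf h).1)
      (fun h => hc1 (hf h).1.symm) (fun h => hme (hf h).2)
    have h2 := hcut {d.fst, e.fst} (lt_of_le_of_lt (ncard_pair_le _ _) (by norm_num))
      (Or.inl (Or.inl rfl)) (Or.inl (Or.inr rfl)) d.snd m
      (by rintro (h | h); exacts [d.snd_ne_fst h, hc2 h.symm])
      (by rintro (h | h); exacts [hm.ne' h, hme h])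
    rw [h2, h1, CharTwo.add_self_eq_zero] at hd
    exact zero_ne_one hd

end SimpleGraph

/-! ### Induced even cycles give strong embeddings of positive genus. -/

namespace SimpleGraph

/-- The set `X` of vertices induces a `2`-regular graph that is properly coloured by `b`; so it
induces a disjoint union of even cycles. -/
structure IsEvenTwoRegular {W : Type*} (T : SimpleGraph W) (X : Set W) (b : W → ZMod 2) :
    Prop where
  nonempty : X.Nonempty
  color_ne : ∀ ⦃u⦄, u ∈ X → ∀ ⦃v⦄, v ∈ X → T.Adj u v → b u ≠ b v
  exists_pair : ∀ u ∈ X, ∃ v w, v ≠ w ∧ v ∈ X ∧ w ∈ X ∧ T.Adj u v ∧ T.Adj u w ∧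
    ∀ z ∈ X, T.Adj u z → z = v ∨ z = w

namespace RotationSystem

variable {W : Type*} {T : SimpleGraph W} {R : RotationSystem T} {X : Set W} {b : W → ZMod 2}

open Classical in
/-- The indicator function modulo `2` of the edges inside a set of vertices. -/
noncomputable def insideIndicator (T : SimpleGraph W) (X : Set W) (d : T.Dart) : ZMod 2 :=
  if d.fst ∈ X ∧ d.snd ∈ X then 1 else 0

/-- A vertex of `X` lies on two inner edges and any other vertex on none, so the inner edges meet
every vertex evenly. -/
theorem _root_.SimpleGraph.IsEvenTwoRegular.exists_faceColoring [Finite W] [Nontrivial W]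
    (hX : T.IsEvenTwoRegular X b) (hR : R.HasGenus 0) :
    ∃ c : T.Dart → ZMod 2, (∀ d, c (R.next d) = c d) ∧
      ∀ d, insideIndicator T X d = c d + c d.symm := by
  classical
  have := Fintype.ofFinite T.Dart
  have := Fintype.ofFinite W
  refine hR.exists_faceColoring (fun d => ?_) fun f hf => ?_
  · simp only [insideIndicator, Dart.fst_symm, Dart.snd_symm, and_comm]
  · rw [← Finset.sum_fiberwise Finset.univ (fun d : T.Dart => d.fst)]
    refine Finset.sum_eq_zero fun u _ => ?_
    by_cases hu : u ∈ X
    · obtain ⟨v, w, hvw, hv, hw, huv, huw, hmax⟩ := hX.exists_pair u hu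
      have hne : (⟨(u, v), huv⟩ : T.Dart) ≠ ⟨(u, w), huw⟩ := fun h =>
        hvw (congrArg (fun z => z.snd) h)
      rw [← Finset.sum_subset (s₁ := {⟨(u, v), huv⟩, ⟨(u, w), huw⟩})]
      · rw [Finset.sum_pair hne]
        have h1 : insideIndicator T X ⟨(u, v), huv⟩ = 1 := if_pos ⟨hu, hv⟩
        have h2 : insideIndicator T X ⟨(u, w), huw⟩ = 1 := if_pos ⟨hu, hw⟩
        rw [h1, h2, R.eq_of_rot_invariant hf
          (show (⟨(u, v), huv⟩ : T.Dart).fst = (⟨(u, w), huw⟩ : T.Dart).fst from rfl)]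
        exact CharTwo.add_self_eq_zero _
      · intro d hd
        simp only [Finset.mem_insert, Finset.mem_singleton] at hd
        rcases hd with rfl | rfl <;> simp
      · intro d hd hd'
        simp only [Finset.mem_filter, Finset.mem_univ, true_and] at hd
        have : ¬ (d.fst ∈ X ∧ d.snd ∈ X) := by
          rintro ⟨-, h2⟩
          have h3 := d.adj
          rw [hd] at h3
          apply hd'
          simp only [Finset.mem_insert, Finset.mem_singleton]
          rcases hmax _ h2 h3 with h4 | h4
          · exact Or.inl (Dart.eq_of_fst_snd hd h4)
          · exact Or.inr (Dart.eq_of_fst_snd hd h4)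
        rw [insideIndicator, if_neg this, mul_zero]
    · refine Finset.sum_eq_zero fun d hd => ?_
      simp only [Finset.mem_filter, Finset.mem_univ, true_and] at hd
      rw [insideIndicator, if_neg (fun h => hu (hd ▸ h.1)), mul_zero]

/-- The Boolean colouring associated with a colouring modulo `2`. -/
def boolColor (c : T.Dart → ZMod 2) (d : T.Dart) : Bool := decide (c d = 1)

theorem zmodTwo_cases (a : ZMod 2) : a = 0 ∨ a = 1 := by
  revert a; decide

theorem boolColor_eq_true {c : T.Dart → ZMod 2} {d : T.Dart} :
    boolColor c d = true ↔ c d = 1 := by simp [boolColor]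

theorem boolColor_eq_false {c : T.Dart → ZMod 2} {d : T.Dart} :
    boolColor c d = false ↔ c d = 0 := by
  have := zmodTwo_cases (c d)
  rw [Bool.eq_false_iff, ne_eq, boolColor_eq_true]
  rcases this with h | h <;> simp [h]

theorem boolColor_next {c : T.Dart → ZMod 2} (hc : ∀ d, c (R.next d) = c d) (d : T.Dart) :
    boolColor c (R.next d) = boolColor c d := by simp [boolColor, hc]

/-- The vertex around which the walk turns in the face of the dart. -/
def corner (c : T.Dart → ZMod 2) (d : T.Dart) : W := if c d = 1 then d.fst else d.snd

open Classical in
/-- A label of darts that is constant along the walks of the colouring. -/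
noncomputable def walkLabel (X : Set W) (b : W → ZMod 2) (c : T.Dart → ZMod 2) (d : T.Dart) :
    W ⊕ ZMod 2 :=
  if corner c d ∈ X then Sum.inr (b (corner c d) + c d) else Sum.inl (corner c d)

theorem corner_colorWalk {c : T.Dart → ZMod 2} (hc : ∀ d, c (R.next d) = c d) (d : T.Dart) :
    c (R.colorWalk (boolColor c) d) = c d.symm ∧
    corner c (R.colorWalk (boolColor c) d) = if c d.symm = 1 then d.fst else d.snd := by
  rcases zmodTwo_cases (c d.symm) with h | h
  · have h1 : c (R.next.symm d.symm) = c d.symm := by rw [← hc, Equiv.apply_symm_apply]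
    rw [colorWalk_of_false (boolColor_eq_false.mpr h), corner, h1, h]
    simp
  · have h1 : c (R.rot d) = c d.symm := by rw [← next_symm, hc]
    rw [colorWalk_of_true (boolColor_eq_true.mpr h), corner, h1, h]
    simp

/-- Crossing an edge that is not inside `X` changes neither the colour nor the corner. Crossing an
inner edge flips the colour and moves the corner to the other end, where `b` flips as well, so the
sum is preserved. -/
theorem walkLabel_colorWalk (hX : T.IsEvenTwoRegular X b) {c : T.Dart → ZMod 2}
    (hc : ∀ d, c (R.next d) = c d) (hcX : ∀ d, insideIndicator T X d = c d + c d.symm)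
    (d : T.Dart) : walkLabel X b c (R.colorWalk (boolColor c) d) = walkLabel X b c d := by
  obtain ⟨h1, h2⟩ := corner_colorWalk hc d
  have h3 := hcX d
  rw [walkLabel, walkLabel, h1, h2, corner]
  by_cases hd : d.fst ∈ X ∧ d.snd ∈ X
  · rw [insideIndicator, if_pos hd] at h3
    have h4 := hX.color_ne hd.1 hd.2 d.adj
    generalize c d = p at *
    generalize c d.symm = q at *
    have h5 : ∀ s t : ZMod 2, s ≠ t → s + 1 = t ∧ t + 1 = s := by decide
    obtain ⟨h6, h7⟩ := h5 _ _ h4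
    rcases zmodTwo_cases p with rfl | rfl <;> rcases zmodTwo_cases q with rfl | rfl
    · exact absurd h3 (by decide)
    · simp [hd.1, hd.2, h6]
    · simp [hd.1, hd.2, h6]
    · exact absurd h3 (by decide)
  · rw [insideIndicator, if_neg hd] at h3
    rw [CharTwo.add_eq_zero.mp h3.symm]

/-- The corners of `d` and `next d` are adjacent and the colours agree. Hence the labels differ,
properness of `b` being used when both corners lie in `X`, and no walk leads from `d` to `next d`.
-/
theorem _root_.SimpleGraph.IsEvenTwoRegular.isStrongColoring [Finite W]
    (hX : T.IsEvenTwoRegular X b) (hR : R.IsTriangulated) {c : T.Dart → ZMod 2}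
    (hc : ∀ d, c (R.next d) = c d) (hcX : ∀ d, insideIndicator T X d = c d + c d.symm) :
    R.IsStrongColoring (boolColor c) := by
  refine isStrongColoring_of_forall_ne hR (boolColor_next hc) fun d k hk => ?_
  have h1 : ∀ k, walkLabel X b c ((R.colorWalk (boolColor c))^[k] d) = walkLabel X b c d := by
    intro k
    induction k with
    | zero => rfl
    | succ k ih => rw [Function.iterate_succ_apply', walkLabel_colorWalk hX hc hcX, ih]
  have h2 := h1 k
  rw [hk] at h2
  have hadj : T.Adj (corner c (R.next d)) (corner c d) := by
    rw [corner, corner, hc]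
    split_ifs
    · rw [next_fst]; exact d.adj.symm
    · have := (R.next d).adj
      rw [next_fst] at this
      exact this.symm
  rw [walkLabel, walkLabel, hc] at h2
  split_ifs at h2 with h3 h4 h4
  · exact hX.color_ne h3 h4 hadj (add_right_cancel (Sum.inr.inj h2))
  · exact hadj.ne (Sum.inl.inj h2)

/-- Along the rotation from one inner edge to the next one the colour does not change. -/
theorem exists_rot_pow_of_pair [Finite W] {c : T.Dart → ZMod 2} (hc : ∀ d, c (R.next d) = c d)
    (hcX : ∀ d, insideIndicator T X d = c d + c d.symm) {e e' : T.Dart}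
    (hfst : e.fst = e'.fst)
    (hmax : ∀ d : T.Dart, d.fst = e.fst → d.fst ∈ X ∧ d.snd ∈ X → d = e ∨ d = e') :
    ∃ i, (R.rot ^ i) e = e' ∧ ∀ l, l < i → c ((R.rot ^ (l + 1)) e) = c e.symm := by
  classical
  have hex : ∃ i : ℕ, (R.rot ^ i) e = e' :=
    (R.sameCycle_rot.mpr hfst).exists_nat_pow_eq
  refine ⟨Nat.find hex, Nat.find_spec hex, fun l => ?_⟩
  induction l with
  | zero => intro _; rw [zero_add, pow_one, ← next_symm, hc]
  | succ l ih =>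
    intro hl
    rw [pow_succ', Equiv.Perm.mul_apply, ← next_symm, hc, ← ih (by omega)]
    have hf : ((R.rot ^ (l + 1)) e).fst = e.fst :=
      R.sameCycle_rot.mp (Equiv.Perm.sameCycle_pow_left.mpr (Equiv.Perm.SameCycle.refl _ _))
    have hnot : ¬ (((R.rot ^ (l + 1)) e).fst ∈ X ∧ ((R.rot ^ (l + 1)) e).snd ∈ X) := by
      intro h
      rcases hmax _ hf h with h1 | h1
      · have h2 := Nat.find_spec hex
        have h3 : Nat.find hex = (Nat.find hex - (l + 1)) + (l + 1) := by omega
        rw [h3, pow_add, Equiv.Perm.mul_apply, h1] at h2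
        exact Nat.find_min hex (by omega) h2
      · exact Nat.find_min hex hl h1
    have h1 := hcX ((R.rot ^ (l + 1)) e)
    rw [insideIndicator, if_neg hnot] at h1
    exact (CharTwo.add_eq_zero.mp h1.symm).symm

/-- All faces in the sector from `e` to `e'` have colour `c e.symm`. Walks there turn around the
common tail, so one walk contains both `e` and `e'` if the colour is `1`, and both reverses if it is
`0`. -/
theorem eq_of_colorWalk_invariant [Finite W] {c : T.Dart → ZMod 2}
    (hc : ∀ d, c (R.next d) = c d)
    (hcX : ∀ d, insideIndicator T X d = c d + c d.symm) {e e' : T.Dart} (hne : e ≠ e')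
    (hfst : e.fst = e'.fst)
    (hmax : ∀ d : T.Dart, d.fst = e.fst → d.fst ∈ X ∧ d.snd ∈ X → d = e ∨ d = e')
    {f : T.Dart → ZMod 2} (hf : ∀ d, f (R.colorWalk (boolColor c) d) = f d) :
    c e' = c e.symm ∧ (c e.symm = 1 → f e = f e') ∧ (c e.symm = 0 → f e.symm = f e'.symm) := by
  obtain ⟨i, hi, hcol⟩ := R.exists_rot_pow_of_pair hc hcX hfst hmax
  have hi0 : i ≠ 0 := by rintro rfl; exact hne hi
  refine ⟨?_, fun h => ?_, fun h => ?_⟩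
  · rw [← hi, ← hcol (i - 1) (by omega), Nat.sub_add_cancel (by omega)]
  · have key : ∀ l, l ≤ i → f ((R.rot ^ l) e) = f e := by
      intro l
      induction l with
      | zero => intro _; rfl
      | succ l ih =>
        intro hl
        have h1 := hcol l hl
        rw [pow_succ', Equiv.Perm.mul_apply, ← next_symm, hc, h] at h1
        rw [← ih (by omega), ← hf ((R.rot ^ l) e), colorWalk_of_true (boolColor_eq_true.mpr h1),
          pow_succ', Equiv.Perm.mul_apply]
    rw [← hi, key i le_rfl]
  · have key : ∀ l, l ≤ i → f ((R.rot ^ l) e).symm = f e.symm := by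
      intro l
      induction l with
      | zero => intro _; rfl
      | succ l ih =>
        intro hl
        have h1 := hcol l hl
        rw [h] at h1
        rw [← ih (by omega), ← hf ((R.rot ^ (l + 1)) e).symm,
          colorWalk_of_false (boolColor_eq_false.mpr (by rw [Dart.symm_symm, h1])),
          Dart.symm_symm, next_symm_apply, pow_succ', Equiv.Perm.mul_apply,
          Equiv.symm_apply_apply]
    rw [← hi, key i le_rfl]

/-- Two edges at a vertex are not a cut of the dual of an embedded graph. -/
theorem not_exists_faceColoring_pair [Finite W] {e₁ e₂ : T.Dart} (hfst : e₁.fst = e₂.fst)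
    (hne : e₁ ≠ e₂) : ¬ ∃ k : T.Dart → ZMod 2, (∀ d, k (R.next d) = k d) ∧
      ∀ d, edgeIndicator e₁ d + edgeIndicator e₂ d = k d + k d.symm := by
  classical
  have := Fintype.ofFinite T.Dart
  rintro ⟨k, hk, hkx⟩
  -- The test function is supported on the darts leaving the head of `e₁`. Exactly one of the two
  -- edges meets that vertex, so the sum is odd.
  have h1 := (Equiv.Perm.mem_orthogonalFun.mp
    (Equiv.Perm.coboundary_mem_orthogonalFun (α := T.symmPerm) (σ := R.rot)
      Dart.symm_symm Dart.symm_ne (c := k) hk)).2 (fun d => if d.fst = e₁.snd then 1 else 0)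
      (fun d => by simp only [rot_fst])
  have h2 : ∀ d, Equiv.Perm.coboundary T.symmPerm k d = edgeIndicator e₁ d + edgeIndicator e₂ d :=
    fun d => (hkx d).symm
  simp only [h2, mul_add, Finset.sum_add_distrib, sum_mul_edgeIndicator] at h1
  have h3 : ¬ e₂.fst = e₁.snd := fun h => e₁.fst_ne_snd (hfst.trans h)
  have h4 : ¬ e₂.snd = e₁.snd := fun h => hne (Dart.eq_of_fst_snd hfst h.symm)
  simp [h3, h4] at h1

end RotationSystem

end SimpleGraph

theorem Equiv.Perm.IsCycleOn.congr {α : Type*} {π τ : Equiv.Perm α} {s : Set α}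
    (h : τ.IsCycleOn s) (hs : s.Finite) (heq : ∀ x ∈ s, π x = τ x) : π.IsCycleOn s := by
  refine ⟨h.1.congr fun x hx => (heq x hx).symm, fun x hx y hy => ?_⟩
  obtain ⟨n, rfl⟩ := h.exists_pow_eq' hs hx hy
  have key : ∀ n : ℕ, (π ^ n) x = (τ ^ n) x ∧ (τ ^ n) x ∈ s := by
    intro n
    induction n with
    | zero => exact ⟨rfl, hx⟩
    | succ n ih =>
      rw [pow_succ', pow_succ', Equiv.Perm.mul_apply, Equiv.Perm.mul_apply, ih.1]
      exact ⟨heq _ ih.2, h.apply_mem_iff.mpr ih.2⟩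
  rw [← (key n).1]
  exact Equiv.Perm.sameCycle_pow_right.mpr (Equiv.Perm.SameCycle.refl _ _)

namespace SimpleGraph

namespace RotationSystem

variable {V : Type*} {G : SimpleGraph V}

/-- Reversal of the rotation at the vertices of colour `false`. -/
def flip [Finite V] (R : RotationSystem G) (c : V → Bool) : RotationSystem G where
  rot :=
    { toFun := fun d => if c d.fst then R.rot d else R.rot.symm d
      invFun := fun d => if c d.fst then R.rot.symm d else R.rot d
      left_inv := fun d => by cases h : c d.fst <;> simp [h]
      right_inv := fun d => by cases h : c d.fst <;> simp [h] }
  isCycleOn v := by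
    cases hv : c v
    · refine (Equiv.Perm.isCycleOn_inv.mpr (R.isCycleOn v)).congr (Set.toFinite _) ?_
      rintro d rfl
      simp [hv]
    · refine (R.isCycleOn v).congr (Set.toFinite _) ?_
      rintro d rfl
      simp [hv]

theorem flip_rot [Finite V] (R : RotationSystem G) (c : V → Bool) (d : G.Dart) :
    (R.flip c).rot d = if c d.fst then R.rot d else R.rot.symm d := rfl

theorem edgeIndicator_dualDart {R : RotationSystem G} (h : R.IsDualSimple) (d e : G.Dart) :
    edgeIndicator (R.dualDart h d) (R.dualDart h e) = edgeIndicator d e := by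
  classical
  simp only [edgeIndicator, ← dualDart_symm, Pi.add_apply, Pi.single_apply,
    (R.dualDart h).injective.eq_iff]

/-- A union of even cycles induced in the dual yields a strong embedding of positive genus. -/
theorem _root_.SimpleGraph.IsEvenTwoRegular.exists_strong [Finite V] [Nontrivial V]
    {R : RotationSystem G} (hR : R.HasGenus 0) (hds : R.IsDualSimple)
    (htri : (R.dual hds).IsTriangulated) {X : Set R.Face} {b : R.Face → ZMod 2}
    (hX : R.dualGraph.IsEvenTwoRegular X b) :
    ∃ g, 0 < g ∧ G.HasStrongOrientableEmbedding g := by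
  have hG := hR.1
  have : Fintype G.Dart := Fintype.ofFinite _
  obtain ⟨u, hu⟩ := hX.nonempty
  obtain ⟨v, w, hvw, hv, hw, huv, huw, hmax⟩ := hX.exists_pair u hu
  have : Nontrivial R.Face := ⟨⟨v, w, hvw⟩⟩
  obtain ⟨c, hc, hcX⟩ := hX.exists_faceColoring (hR.dual hds)
  set E := R.dualDart hds with hE
  have hcE : ∀ d e : G.Dart, d.fst = e.fst → c (E d) = c (E e) := fun d e hde =>
    R.eq_of_rot_invariant (f := fun d => c (E d))
      (fun d => by rw [← R.dual_next hds]; exact hc _) hde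
  choose s hs using hG.exists_dart_fst
  -- Vertices of `G` are faces of the dual, so `c` has one value on all darts at a vertex and the
  -- choice of `s` is immaterial.
  let S := R.flip fun v => boolColor c (E (s v))
  have hcol : ∀ d : G.Dart, boolColor c (E (s d.fst)) = boolColor c (E d) := fun d => by
    rw [boolColor, boolColor, hcE _ _ (hs d.fst)]
  have hwalk : ∀ d, (R.dual hds).colorWalk (boolColor c) (E d) = E (S.next d) := by
    intro d
    rw [next_apply]
    change _ = E (if boolColor c (E (s d.symm.fst)) then _ else _)
    rw [hcol]
    cases h1 : boolColor c (E d.symm)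
    · rw [colorWalk_of_false (by rw [← dualDart_symm]; exact h1), Equiv.symm_apply_eq,
        ← dualDart_symm]
      simp only [Bool.false_eq_true, if_false]
      rw [hE, dual_next, Equiv.apply_symm_apply]
    · rw [colorWalk_of_true (by rw [← dualDart_symm]; exact h1), ← next_symm, ← dualDart_symm,
        dual_next]
      simp [hE]
  have hiter : ∀ (k : ℕ) (d : G.Dart),
      ((R.dual hds).colorWalk (boolColor c))^[k] (E d) = E ((S.next ^ k) d) := by
    intro k d
    induction k with
    | zero => rfl
    | succ k ih => rw [Function.iterate_succ_apply', ih, hwalk, pow_succ']; rfl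
  have hstrongc := hX.isStrongColoring htri hc hcX
  have hrot : ∀ d, R.rot d ≠ d := by
    intro d hd
    have h1 := R.dual_next hds d
    rw [hd] at h1
    exact (R.dual hds).next_ne _ h1
  have hstrong : S.IsStrong := by
    constructor
    · intro d d' h1 h2
      obtain ⟨k, hk⟩ := (S.faceOf_eq_iff.mp h1).exists_nat_pow_eq
      have h3 := hstrongc (E d) k (by
        rw [hiter, hk, hE, R.dual_faceOf_eq_iff]; exact h2.symm)
      rw [hiter, hk] at h3
      exact (E.injective h3).symm
    · intro d hd
      have h1 : S.next d = d.symm :=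
        Dart.eq_of_fst_snd (S.next_fst d) (by rw [← S.next_fst, hd]; rfl)
      rw [next_apply, flip_rot] at h1
      split_ifs at h1
      · exact hrot _ h1
      · rw [Equiv.symm_apply_eq] at h1
        exact hrot _ h1.symm
  obtain ⟨g, hg⟩ := S.exists_hasGenus hG
  refine ⟨g, Nat.pos_of_ne_zero ?_, S, hg, hstrong⟩
  -- In genus zero, the duals of two inner edges at `u` meet every face of `S` evenly and so form a
  -- cut of `G`. In the dual this cut is a face function whose coboundary is two edges at one
  -- vertex.
  rintro rfl
  obtain ⟨d₁, hd₁⟩ := E.surjective ⟨(u, v), huv⟩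
  obtain ⟨d₂, hd₂⟩ := E.surjective ⟨(u, w), huw⟩
  have hne : E d₁ ≠ E d₂ := by
    rw [hd₁, hd₂]
    exact fun h => hvw (congrArg (fun z => z.snd) h)
  have hfst : (E d₁).fst = (E d₂).fst := by rw [hd₁, hd₂]
  have hmax' : ∀ d : R.dualGraph.Dart, d.fst = (E d₁).fst → d.fst ∈ X ∧ d.snd ∈ X →
      d = E d₁ ∨ d = E d₂ := by
    intro d h1 h2
    rw [hd₁] at h1 ⊢
    rw [hd₂]
    have h3 := d.adj
    rw [h1] at h3
    exact (hmax _ h2.2 h3).imp (fun h => Dart.eq_of_fst_snd h1 h) fun h => Dart.eq_of_fst_snd h1 h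
  obtain ⟨k, hk⟩ := hg.exists_vertexColoring (x := edgeIndicator d₁ + edgeIndicator d₂)
    (fun y => by simp only [Pi.add_apply, edgeIndicator_symm]) (fun f hf => by
      simp only [Pi.add_apply, mul_add, Finset.sum_add_distrib, sum_mul_edgeIndicator]
      have hf' : ∀ y, f (E.symm ((R.dual hds).colorWalk (boolColor c) y)) = f (E.symm y) := by
        intro y
        obtain ⟨d, rfl⟩ := E.surjective y
        rw [hwalk, Equiv.symm_apply_apply, Equiv.symm_apply_apply, hf]
      obtain ⟨a1, a2, a3⟩ := eq_of_colorWalk_invariant (R := R.dual hds) hc hcX hne hfst hmax'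
        (f := fun y => f (E.symm y)) hf'
      obtain ⟨b1, b2, b3⟩ := eq_of_colorWalk_invariant (R := R.dual hds) hc hcX hne.symm hfst.symm
        (fun d h1 h2 => (hmax' d (h1.trans hfst.symm) h2).symm) (f := fun y => f (E.symm y)) hf'
      simp only [← dualDart_symm, hE, Equiv.symm_apply_apply] at a1 a2 a3 b1 b2 b3
      have h1 := hcX (E d₁)
      rw [insideIndicator, if_pos (by rw [hd₁]; exact ⟨hu, hv⟩), hE, ← dualDart_symm, b1] at h1
      -- The two sectors at `u` have opposite colours; one gives the equality for the darts and the
      -- other that for their reverses.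
      have h5 : f d₁ = f d₂ ∧ f d₁.symm = f d₂.symm := by
        rcases zmodTwo_cases (c (R.dualDart hds d₁.symm)) with h2 | h2
        · refine ⟨(b2 ?_).symm, a3 h2⟩
          rw [h2, add_zero] at h1
          exact h1.symm
        · refine ⟨a2 h2, (b3 ?_).symm⟩
          rw [h2] at h1
          have : ∀ z : ZMod 2, 1 = z + 1 → z = 0 := by decide
          exact this _ h1
      rw [h5.1, h5.2]
      exact CharTwo.add_self_eq_zero _)
  refine not_exists_faceColoring_pair (R := R.dual hds) hfst hne
    ⟨fun y => k (E.symm y).fst, fun y => ?_, fun y => ?_⟩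
  · obtain ⟨d, rfl⟩ := E.surjective y
    simp only [hE, dual_next, Equiv.symm_apply_apply, rot_fst]
  · obtain ⟨d, rfl⟩ := E.surjective y
    have h1 := hk d
    simp only [hE, edgeIndicator_dualDart, ← dualDart_symm, Equiv.symm_apply_apply]
    exact h1

end RotationSystem

end SimpleGraph

/-! ### Adjacent vertices with induced links. -/

namespace SimpleGraph

variable {W : Type*} {T : SimpleGraph W}

/-- Any two distinct vertices outside `B` that have neighbours in `B` are adjacent. -/
def IsCliqueBounded (T : SimpleGraph W) (B : Set W) : Prop :=
  ∀ ⦃p⦄, p ∈ B → ∀ ⦃y⦄, y ∉ B → T.Adj p y → ∀ ⦃p'⦄, p' ∈ B → ∀ ⦃y'⦄, y' ∉ B → T.Adj p' y' →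
    y ≠ y' → T.Adj y y'

namespace RotationSystem

variable {R : RotationSystem T}

/-- The neighbours of `u` induce a cycle: they are adjacent only if they are consecutive around
`u`. -/
def HasInducedLink (R : RotationSystem T) (u : W) : Prop :=
  ∀ ⦃d d' : T.Dart⦄, d.fst = u → d'.fst = u → T.Adj d.snd d'.snd → d' = R.rot d ∨ d = R.rot d'

theorem exists_minimal_isCliqueBounded [Finite W] [Nonempty W] (T : SimpleGraph W) :
    ∃ B : Set W, B.Nonempty ∧ T.IsCliqueBounded B ∧
      ∀ B' : Set W, B'.Nonempty → T.IsCliqueBounded B' → B' ⊆ B → B ⊆ B' := by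
  obtain ⟨B, hB⟩ := (Set.toFinite {B : Set W | B.Nonempty ∧ T.IsCliqueBounded B}).exists_minimal
    ⟨Set.univ, Set.univ_nonempty, fun _ _ y hy => absurd (Set.mem_univ y) hy⟩
  exact ⟨B, hB.1.1, hB.1.2, fun B' h1 h2 h3 => hB.2 ⟨h1, h2⟩ h3⟩

/-- A triangle separates the faces of a graph on the sphere. -/
theorem HasGenus.exists_faceColoring_triangle [Finite W] [Nontrivial W] (hR : R.HasGenus 0)
    {d d' : T.Dart} (hfst : d.fst = d'.fst) (hadj : T.Adj d.snd d'.snd) :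
    ∃ c : T.Dart → ZMod 2, (∀ e, c (R.next e) = c e) ∧ c d ≠ c d.symm ∧
      ∀ e : T.Dart, (e.fst ≠ d.fst ∧ e.fst ≠ d.snd ∧ e.fst ≠ d'.snd ∨
        e.snd ≠ d.fst ∧ e.snd ≠ d.snd ∧ e.snd ≠ d'.snd) → c e.symm = c e := by
  have : Fintype T.Dart := Fintype.ofFinite _
  let t : T.Dart := ⟨(d.snd, d'.snd), hadj⟩
  obtain ⟨c, hc, hx⟩ := hR.exists_faceColoring
    (x := edgeIndicator d + edgeIndicator d' + edgeIndicator t)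
    (fun y => by simp only [Pi.add_apply, edgeIndicator_symm]) (fun f hf => by
      simp only [Pi.add_apply, mul_add, Finset.sum_add_distrib, sum_mul_edgeIndicator]
      rw [R.eq_of_rot_invariant hf hfst,
        R.eq_of_rot_invariant (d := d.symm) (e := t) hf rfl,
        R.eq_of_rot_invariant (d := d'.symm) (e := t.symm) hf rfl]
      have : ∀ a b c : ZMod 2, a + b + (a + c) + (b + c) = 0 := by decide
      exact this _ _ _)
  refine ⟨c, hc, fun h => ?_, fun e he => ?_⟩
  · have h1 := hx d
    rw [h, CharTwo.add_self_eq_zero, Pi.add_apply, Pi.add_apply, edgeIndicator_self,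
      edgeIndicator_of_ne, edgeIndicator_of_ne] at h1
    · simp at h1
    · exact fun h2 => d.fst_ne_snd (congrArg (fun z => z.fst) h2)
    · exact fun h2 => d'.fst_ne_snd (hfst.symm.trans (congrArg (fun z => z.fst) h2))
    · exact fun h2 => hadj.ne (congrArg (fun z => z.snd) h2)
    · exact fun h2 => d'.fst_ne_snd (hfst.symm.trans (congrArg (fun z => z.fst) h2))
  · have h1 := hx e
    rw [Pi.add_apply, Pi.add_apply, edgeIndicator_of_ne, edgeIndicator_of_ne,
      edgeIndicator_of_ne] at h1
    · exact (CharTwo.add_eq_zero.mp (by simpa using h1.symm)).symm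
    all_goals
      rintro rfl
      simp [hfst, t] at he

/-- A chord of the link of `v` gives a triangle `K` through `v` with vertices on both sides. The
outer neighbours of `B` form a clique, so off `K` they avoid one side. The part of `B` on that side
is nonempty, bounded by vertices of `K`, and misses `v`, against minimality. -/
theorem hasInducedLink_of_minimal [Finite W] [Nontrivial W] (hR : R.HasGenus 0)
    (hrot : ∀ d, R.rot d ≠ d) {B : Set W} (hB : T.IsCliqueBounded B)
    (hmin : ∀ B' : Set W, B'.Nonempty → T.IsCliqueBounded B' → B' ⊆ B → B ⊆ B')
    {v : W} (hv : v ∈ B) : R.HasInducedLink v := by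
  intro d d' hd hd' hadj
  by_contra! hcon
  obtain ⟨h1, h2⟩ := hcon
  obtain ⟨c, hc, hcd, hcol⟩ := hR.exists_faceColoring_triangle (hd.trans hd'.symm) hadj
  set K : Set W := {d.fst, d.snd, d'.snd} with hK
  have hKmem : ∀ {p}, p ∉ K ↔ p ≠ d.fst ∧ p ≠ d.snd ∧ p ≠ d'.snd := by
    intro p
    simp [hK]
  have hsymm : ∀ e : T.Dart, (e.fst ∉ K ∨ e.snd ∉ K) → c e.symm = c e := fun e he =>
    hcol e (he.imp hKmem.mp hKmem.mp)
  have hrotc : ∀ e, c (R.rot e) = c e.symm := fun e => by rw [← next_symm, hc]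
  have hvertex : ∀ {e e' : T.Dart}, e.fst ∉ K → e'.fst = e.fst → c e = c e' := by
    intro e e' he hee
    have hpow : ∀ k : ℕ, c ((R.rot ^ k) e) = c e := by
      intro k
      induction k with
      | zero => rfl
      | succ k ih =>
        rw [pow_succ', Equiv.Perm.mul_apply, hrotc, hsymm, ih]
        left
        rwa [R.sameCycle_rot.mp (Equiv.Perm.sameCycle_pow_left.mpr
          (Equiv.Perm.SameCycle.refl R.rot e))]
    obtain ⟨k, hk⟩ := (R.sameCycle_rot.mpr hee.symm).exists_nat_pow_eq
    rw [← hk, hpow]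
  -- Off `K` the face colour is constant around each vertex, so the two values of `ε` give the two
  -- sides of the triangle.
  let P : ZMod 2 → Set W := fun ε => {p | p ∉ K ∧ ∃ e : T.Dart, e.fst = p ∧ c e = ε}
  have hPadj : ∀ {ε p q}, p ∈ P ε → q ∉ K → T.Adj p q → q ∈ P ε := by
    rintro ε p q ⟨hp, e, he, hce⟩ hq hpq
    refine ⟨hq, Dart.symm ⟨(p, q), hpq⟩, rfl, ?_⟩
    rw [hsymm _ (Or.inl hp), ← hce]
    exact hvertex (e := ⟨(p, q), hpq⟩) hp he
  have hPuniq : ∀ {ε ε' p}, p ∈ P ε → p ∈ P ε' → ε = ε' := by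
    rintro ε ε' p ⟨hp, e, he, hce⟩ ⟨-, e', he', hce'⟩
    rw [← hce, ← hce']
    exact hvertex (he ▸ hp) (he'.trans he.symm)
  have hnotK : ∀ e : T.Dart, e.fst = v → e ≠ d → e ≠ d' → e.snd ∉ K := by
    intro e he h3 h4
    refine hKmem.mpr ⟨fun h => e.fst_ne_snd (he.trans (hd.symm.trans h.symm)),
      fun h => h3 (Dart.eq_of_fst_snd (he.trans hd.symm) h),
      fun h => h4 (Dart.eq_of_fst_snd (he.trans hd'.symm) h)⟩
  have hq : ∀ ε, ∃ q, T.Adj v q ∧ q ∈ P ε := by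
    have hq1 : (R.rot d).snd ∈ P (c d.symm) := by
      have hK1 := hnotK (R.rot d) ((R.rot_fst d).trans hd) (hrot d) h1.symm
      exact ⟨hK1, (R.rot d).symm, rfl, by rw [hsymm _ (Or.inr hK1), hrotc]⟩
    have hq2 : (R.rot.symm d).snd ∈ P (c d) := by
      have hK2 := hnotK (R.rot.symm d) ((R.rot_symm_fst d).trans hd)
        (fun h => hrot d ((Equiv.symm_apply_eq _).mp h).symm)
        (fun h => h2 ((Equiv.symm_apply_eq _).mp h))
      exact ⟨hK2, (R.rot.symm d).symm, rfl, by rw [← hrotc, Equiv.apply_symm_apply]⟩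
    intro ε
    have h5 : ∀ a b ε : ZMod 2, a ≠ b → ε = a ∨ ε = b := by decide
    rcases h5 _ _ ε hcd with rfl | rfl
    · refine ⟨_, ?_, hq2⟩
      have := (R.rot.symm d).adj
      rwa [R.rot_symm_fst, hd] at this
    · refine ⟨_, ?_, hq1⟩
      have := (R.rot d).adj
      rwa [R.rot_fst, hd] at this
  have hε : ∃ ε, ∀ p ∈ B, ∀ y ∉ B, T.Adj p y → y ∉ P ε := by
    by_contra! hcon
    obtain ⟨p, hp, y, hy, hpy, hyP⟩ := hcon 0
    obtain ⟨p', hp', y', hy', hpy', hyP'⟩ := hcon 1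
    by_cases hyy : y = y'
    · rw [hyy] at hyP
      exact zero_ne_one (hPuniq hyP hyP')
    · exact zero_ne_one (hPuniq (hPadj hyP hyP'.1 (hB hp hy hpy hp' hy' hpy' hyy)) hyP')
  obtain ⟨ε, hε⟩ := hε
  have hbound : ∀ {p y}, p ∈ P ε ∩ B → y ∉ P ε ∩ B → T.Adj p y → y ∈ K := by
    intro p y hp hy hpy
    by_contra hyK
    have hyP := hPadj hp.1 hyK hpy
    exact hε p hp.2 y (fun h => hy ⟨hyP, h⟩) hpy hyP
  obtain ⟨q, hvq, hqP⟩ := hq ε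
  have hsub := hmin (P ε ∩ B) ⟨q, hqP, by
    by_contra hqB
    exact hε v hv q hqB hvq hqP⟩ (by
    intro p hp y hy hpy p' hp' y' hy' hpy' hne
    have hyK := hbound hp hy hpy
    have hyK' := hbound hp' hy' hpy'
    have e1 := d.adj
    have e2 := d'.adj
    rw [hd', ← hd] at e2
    rcases hyK with rfl | rfl | rfl <;> rcases hyK' with rfl | rfl | rfl
    · exact absurd rfl hne
    · exact e1
    · exact e2
    · exact e1.symm
    · exact absurd rfl hne
    · exact hadj
    · exact e2.symm
    · exact hadj.symm
    · exact absurd rfl hne) Set.inter_subset_right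
  exact (hsub hv).1.1 (Or.inl hd.symm)

/-- On the sphere, if all degrees are at least four, then there are two adjacent vertices whose
neighbours induce cycles. -/
theorem HasGenus.exists_hasInducedLink [Finite W] [Nontrivial W] (hR : R.HasGenus 0)
    (hrot : ∀ d, R.rot d ≠ d) (hrot₂ : ∀ d, R.rot (R.rot d) ≠ d)
    (hrot₃ : ∀ d, R.rot (R.rot (R.rot d)) ≠ d) :
    ∃ d : T.Dart, R.HasInducedLink d.fst ∧ R.HasInducedLink d.snd := by
  obtain ⟨B, ⟨v, hv⟩, hB, hmin⟩ := exists_minimal_isCliqueBounded T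
  have hlink : ∀ v ∈ B, R.HasInducedLink v := fun v hv =>
    hasInducedLink_of_minimal hR hrot hB hmin hv
  -- Otherwise all neighbours of `v` lie outside `B` and are pairwise adjacent. With degree at least
  -- four, those of `d` and `rot (rot d)` are not consecutive, which contradicts the induced link.
  by_contra! hcon
  obtain ⟨d, rfl⟩ := hR.1.exists_dart_fst v
  have hout : ∀ e : T.Dart, e.fst = d.fst → e.snd ∉ B := by
    intro e he heB
    exact hcon e (he ▸ hlink _ hv) (hlink _ heB)
  have hfst2 : (R.rot (R.rot d)).fst = d.fst := by simp
  have hadj2 := (R.rot (R.rot d)).adj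
  rw [hfst2] at hadj2
  have hne : d.snd ≠ (R.rot (R.rot d)).snd := fun h =>
    hrot₂ d (Dart.eq_of_fst_snd hfst2 h.symm)
  rcases hlink _ hv rfl hfst2 (hB hv (hout d rfl) d.adj hv (hout _ hfst2) hadj2 hne) with h | h
  · exact hrot _ (R.rot.injective h)
  · exact hrot₃ d h.symm

/-- A numbering of the darts around the tail of `e`, starting with `e`. -/
theorem exists_angle [Finite W] (R : RotationSystem T) (e : T.Dart) :
    ∃ θ : T.Dart → ℕ, θ e = 0 ∧ ∀ d : T.Dart, d.fst = e.fst →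
      (R.rot d ≠ e → θ (R.rot d) = θ d + 1) ∧
      (R.rot d = e → θ d + 1 = (T.neighborSet e.fst).ncard) := by
  classical
  have hex : ∀ d : T.Dart, d.fst = e.fst → ∃ i : ℕ, (R.rot ^ i) e = d := fun d hd =>
    (R.sameCycle_rot.mpr hd.symm).exists_nat_pow_eq
  let θ : T.Dart → ℕ := fun d => if h : d.fst = e.fst then Nat.find (hex d h) else 0
  have hθ : ∀ d, d.fst = e.fst → (R.rot ^ θ d) e = d := by
    intro d hd
    simp only [θ, dif_pos hd]
    exact Nat.find_spec (hex d hd)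
  have hle : ∀ d i, d.fst = e.fst → (R.rot ^ i) e = d → θ d ≤ i := by
    intro d i hd h
    simp only [θ, dif_pos hd]
    exact Nat.find_min' _ h
  refine ⟨θ, Nat.le_zero.mp (hle e 0 rfl rfl), fun d hd => ⟨fun hne => ?_, fun heq => ?_⟩⟩
  · have hrd : (R.rot d).fst = e.fst := (R.rot_fst d).trans hd
    refine le_antisymm (hle _ _ hrd ?_) ?_
    · rw [pow_succ', Equiv.Perm.mul_apply, hθ d hd]
    · have h1 := hθ _ hrd
      cases h2 : θ (R.rot d) with
      | zero => rw [h2] at h1; exact absurd h1.symm hne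
      | succ j =>
        rw [h2, pow_succ', Equiv.Perm.mul_apply] at h1
        exact Nat.succ_le_succ (hle d j hd (R.rot.injective h1))
  · have h1 : (R.rot ^ (θ d + 1)) e = e := by
      rw [pow_succ', Equiv.Perm.mul_apply, hθ d hd, heq]
    rw [R.rot_pow_eq_iff] at h1
    have hpos : 0 < (T.neighborSet e.fst).ncard :=
      Nat.pos_of_dvd_of_pos h1 (Nat.succ_pos _)
    obtain ⟨q, hq⟩ : ∃ q, (T.neighborSet e.fst).ncard = q + 1 := ⟨_, (Nat.succ_pred hpos.ne').symm⟩
    have h2 := (R.rot_pow_eq_iff e (q + 1)).mpr (by rw [hq])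
    rw [pow_succ', Equiv.Perm.mul_apply] at h2
    have h3 := hle d q hd (R.rot.injective (h2.trans heq.symm))
    have h4 := Nat.le_of_dvd (Nat.succ_pos _) h1
    omega

end RotationSystem

end SimpleGraph

/-! ### Induced even cycles in triangulations of minimum degree at least four. -/

namespace SimpleGraph

variable {W : Type*} {T : SimpleGraph W}

/-- An induced `4`-cycle. -/
theorem isEvenTwoRegular_fourCycle {a b c d : W} (hab : T.Adj a b) (hbc : T.Adj b c)
    (hcd : T.Adj c d) (hda : T.Adj d a) (hac : a ≠ c) (hac' : ¬ T.Adj a c) (hbd : b ≠ d)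
    (hbd' : ¬ T.Adj b d) : ∃ X k, T.IsEvenTwoRegular X k := by
  classical
  refine ⟨{a, b, c, d}, fun w => if w = a ∨ w = c then 0 else 1, ⟨a, by simp⟩, ?_, ?_⟩
  · have hb : ¬ (b = a ∨ b = c) := by rintro (h | h); exacts [hab.ne' h, hbc.ne h]
    have hd : ¬ (d = a ∨ d = c) := by rintro (h | h); exacts [hda.ne h, hcd.ne' h]
    rintro u (rfl | rfl | rfl | rfl) v (rfl | rfl | rfl | rfl) huv <;>
      first
      | exact absurd huv (T.irrefl)
      | exact absurd huv hac'
      | exact absurd huv hbd'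
      | exact absurd huv.symm hac'
      | exact absurd huv.symm hbd'
      | simp [hb, hd]
  · rintro u (rfl | rfl | rfl | rfl)
    · refine ⟨b, d, hbd, by simp, by simp, hab, hda.symm, ?_⟩
      rintro z (rfl | rfl | rfl | rfl) hz
      exacts [absurd hz T.irrefl, Or.inl rfl, absurd hz hac', Or.inr rfl]
    · refine ⟨a, c, hac, by simp, by simp, hab.symm, hbc, ?_⟩
      rintro z (rfl | rfl | rfl | rfl) hz
      exacts [Or.inl rfl, absurd hz T.irrefl, Or.inr rfl, absurd hz hbd']
    · refine ⟨b, d, hbd, by simp, by simp, hbc.symm, hcd, ?_⟩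
      rintro z (rfl | rfl | rfl | rfl) hz
      exacts [absurd hz.symm hac', Or.inl rfl, absurd hz T.irrefl, Or.inr rfl]
    · refine ⟨a, c, hac, by simp, by simp, hda, hcd.symm, ?_⟩
      rintro z (rfl | rfl | rfl | rfl) hz
      exacts [Or.inl rfl, absurd hz.symm hbd', Or.inr rfl, absurd hz T.irrefl]

theorem IsEvenTwoRegular.map {W' : Type*} {T' : SimpleGraph W'} (j : T ↪g T') {X : Set W}
    {b : W → ZMod 2} (hX : T.IsEvenTwoRegular X b) :
    T'.IsEvenTwoRegular (j '' X) (Function.extend j b 0) := by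
  refine ⟨hX.nonempty.image j, ?_, ?_⟩
  · rintro _ ⟨u, hu, rfl⟩ _ ⟨v, hv, rfl⟩ huv
    rw [j.injective.extend_apply, j.injective.extend_apply]
    exact hX.color_ne hu hv (j.map_adj_iff.mp huv)
  · rintro _ ⟨u, hu, rfl⟩
    obtain ⟨v, w, hvw, hv, hw, huv, huw, hmax⟩ := hX.exists_pair u hu
    refine ⟨j v, j w, j.injective.ne hvw, ⟨v, hv, rfl⟩, ⟨w, hw, rfl⟩, j.map_adj_iff.mpr huv,
      j.map_adj_iff.mpr huw, ?_⟩
    rintro _ ⟨z, hz, rfl⟩ huz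
    exact (hmax z hz (j.map_adj_iff.mp huz)).imp (congrArg j) (congrArg j)

namespace RotationSystem

variable {R : RotationSystem T}

theorem IsTriangulated.adj_rot_symm_snd (hR : R.IsTriangulated) (d : T.Dart) :
    T.Adj d.snd (R.rot.symm d).snd := by
  have := hR.adj_rot_snd (R.rot.symm d)
  rw [Equiv.apply_symm_apply] at this
  exact this.symm

theorem rot_snd_ne_rot_symm_snd (hrot₂ : ∀ d, R.rot (R.rot d) ≠ d) (d : T.Dart) :
    (R.rot d).snd ≠ (R.rot.symm d).snd := by
  intro h
  have h1 : R.rot d = R.rot.symm d := Dart.eq_of_fst_snd (by simp) h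
  exact hrot₂ d ((Equiv.eq_symm_apply _).mp h1)

theorem adj_rot_snd_left (d : T.Dart) : T.Adj d.fst (R.rot d).snd := by
  have := (R.rot d).adj
  rwa [rot_fst] at this

theorem adj_rot_symm_snd_left (d : T.Dart) : T.Adj d.fst (R.rot.symm d).snd := by
  have := (R.rot.symm d).adj
  rwa [rot_symm_fst] at this

theorem natCast_add_one_ne (n : ℕ) : ((n + 1 : ℕ) : ZMod 2) ≠ n := by
  intro h
  rw [Nat.cast_add, Nat.cast_one] at h
  simp at h

/-- The neighbours of a vertex of even degree whose link is induced. -/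
theorem HasInducedLink.exists_isEvenTwoRegular [Finite W] (hR : R.IsTriangulated)
    (hrot₂ : ∀ d, R.rot (R.rot d) ≠ d) {e : T.Dart} (hlink : R.HasInducedLink e.fst)
    (heven : Even (T.neighborSet e.fst).ncard) : ∃ X b, T.IsEvenTwoRegular X b := by
  classical
  obtain ⟨θ, hθ0, hθ⟩ := R.exists_angle e
  have hstep : ∀ d : T.Dart, d.fst = e.fst → ((θ (R.rot d) : ℕ) : ZMod 2) ≠ θ d := by
    intro d hd
    by_cases h : R.rot d = e
    · have h1 := (hθ d hd).2 h
      have h2 : ((θ d + 1 : ℕ) : ZMod 2) = 0 := by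
        rw [h1, ZMod.natCast_eq_zero_iff_even]; exact heven
      rw [h, hθ0, Nat.cast_zero, ← h2]
      exact natCast_add_one_ne _
    · rw [(hθ d hd).1 h]
      exact natCast_add_one_ne _
  refine ⟨T.neighborSet e.fst, fun w => if h : T.Adj e.fst w then θ ⟨(e.fst, w), h⟩ else 0,
    ⟨e.snd, e.adj⟩, ?_, ?_⟩
  · intro u hu v hv huv
    have hu' : T.Adj e.fst u := hu
    have hv' : T.Adj e.fst v := hv
    simp only [dif_pos hu', dif_pos hv']
    rcases hlink (d := ⟨(e.fst, u), hu'⟩) (d' := ⟨(e.fst, v), hv'⟩) rfl rfl huv with h | h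
    · rw [h]; exact (hstep ⟨(e.fst, u), hu'⟩ rfl).symm
    · rw [h]; exact hstep ⟨(e.fst, v), hv'⟩ rfl
  · intro u hu
    refine ⟨(R.rot ⟨(e.fst, u), hu⟩).snd, (R.rot.symm ⟨(e.fst, u), hu⟩).snd,
      rot_snd_ne_rot_symm_snd hrot₂ _, adj_rot_snd_left ⟨(e.fst, u), hu⟩,
      adj_rot_symm_snd_left ⟨(e.fst, u), hu⟩, hR.adj_rot_snd ⟨(e.fst, u), hu⟩,
      hR.adj_rot_symm_snd ⟨(e.fst, u), hu⟩, fun z hz huz => ?_⟩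
    rcases hlink (d := ⟨(e.fst, u), hu⟩) (d' := ⟨(e.fst, z), hz⟩) rfl rfl huz with h | h
    · left; rw [← h]
    · right; rw [h, Equiv.symm_apply_apply]

/-- The vertices on the boundary of the union of the stars of the ends of a dart. -/
def starBoundary (d : T.Dart) : Set W :=
  {w | w ≠ d.fst ∧ w ≠ d.snd ∧ (T.Adj d.fst w ∨ T.Adj d.snd w)}

theorem starBoundary_symm (d : T.Dart) : starBoundary d.symm = starBoundary d := by
  ext w
  simp only [starBoundary, Set.mem_ofPred_eq, Dart.fst_symm, Dart.snd_symm]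
  tauto

theorem IsTriangulated.rot_symm_symm (hR : R.IsTriangulated) (d : T.Dart) :
    R.rot.symm d.symm = (R.next (R.rot d)).symm := by
  rw [Equiv.symm_apply_eq, ← next_apply, ← R.next_symm d, hR]

theorem IsTriangulated.rot_symm_symm_snd (hR : R.IsTriangulated) (d : T.Dart) :
    (R.rot.symm d.symm).snd = (R.rot d).snd := by
  rw [hR.rot_symm_symm, Dart.snd_symm, next_fst]

theorem IsTriangulated.rot_symm_snd (hR : R.IsTriangulated) (d : T.Dart) :
    (R.rot d.symm).snd = (R.rot.symm d).snd := by
  have := hR.rot_symm_symm_snd d.symm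
  rw [Dart.symm_symm] at this
  exact this.symm

theorem HasInducedLink.eq_of_adj_adj {d : T.Dart} (hlink : R.HasInducedLink d.fst) {w : W}
    (h₁ : T.Adj d.fst w) (h₂ : T.Adj d.snd w) : w = (R.rot d).snd ∨ w = (R.rot.symm d).snd := by
  rcases hlink (d := d) (d' := ⟨(d.fst, w), h₁⟩) rfl rfl h₂ with h | h
  · left; rw [← h]
  · right; rw [h, Equiv.symm_apply_apply]

/-- The neighbours on the boundary of a common neighbour of the ends of `d`. -/
theorem exists_pair_common (hR : R.IsTriangulated) (hrot₂ : ∀ d, R.rot (R.rot d) ≠ d)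
    (hrot₃ : ∀ d, R.rot (R.rot (R.rot d)) ≠ d) {d : T.Dart} (h₁ : R.HasInducedLink d.fst)
    (h₂ : R.HasInducedLink d.snd) :
    ∃ v w, v ≠ w ∧ v ∈ starBoundary d ∧ w ∈ starBoundary d ∧ T.Adj (R.rot d).snd v ∧
      T.Adj (R.rot d).snd w ∧ ∀ z ∈ starBoundary d, T.Adj (R.rot d).snd z → z = v ∨ z = w := by
  have hsnd := hR.rot_symm_symm_snd d
  set e := R.rot.symm d.symm with he
  have hefst : e.fst = d.snd := by rw [he, rot_symm_fst]; rfl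
  have hre : R.rot e = d.symm := by rw [he, Equiv.apply_symm_apply]
  have hrX : (R.rot (R.rot d)).snd ∈ starBoundary d := by
    refine ⟨?_, fun h => hrot₂ d (Dart.eq_of_fst_snd (by simp) h), Or.inl ?_⟩
    · have := (R.rot (R.rot d)).snd_ne_fst
      simpa using this
    · have := (R.rot (R.rot d)).adj
      simpa using this
  have hsX : (R.rot.symm e).snd ∈ starBoundary d := by
    refine ⟨fun h => ?_, ?_, Or.inr ?_⟩
    · have h1 : R.rot.symm e = d.symm := Dart.eq_of_fst_snd (by rw [rot_symm_fst, hefst]; rfl) h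
      rw [Equiv.symm_apply_eq] at h1
      exact hrot₂ e (by rw [hre, ← h1])
    · have := (R.rot.symm e).snd_ne_fst
      rwa [rot_symm_fst, hefst] at this
    · have := (R.rot.symm e).adj
      rwa [rot_symm_fst, hefst] at this
  refine ⟨_, _, fun h => ?_, hrX, hsX, hR.adj_rot_snd (R.rot d), ?_, fun z hz hxz => ?_⟩
  · have hu : T.Adj d.fst (R.rot (R.rot d)).snd := by
      have := (R.rot (R.rot d)).adj
      simpa using this
    have hv : T.Adj d.snd (R.rot (R.rot d)).snd := by
      rw [h]
      have := (R.rot.symm e).adj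
      rwa [rot_symm_fst, hefst] at this
    rcases h₁.eq_of_adj_adj hu hv with h3 | h3
    · exact (hR.adj_rot_snd (R.rot d)).ne h3.symm
    · refine hrot₃ d ?_
      have h4 : R.rot (R.rot d) = R.rot.symm d := Dart.eq_of_fst_snd (by simp) h3
      rw [h4, Equiv.apply_symm_apply]
  · rw [← hsnd]
    exact hR.adj_rot_symm_snd e
  · rcases hz.2.2 with hz' | hz'
    · left
      rcases h₁ (d := R.rot d) (d' := ⟨(d.fst, z), hz'⟩) (R.rot_fst d) rfl hxz with h | h
      · rw [← h]
      · have h5 := R.rot.injective h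
        exact absurd (congrArg (fun z => z.snd) h5).symm hz.2.1
    · right
      rcases h₂ (d := e) (d' := ⟨(d.snd, z), hz'⟩) hefst rfl (by rw [hsnd]; exact hxz) with h | h
      · rw [hre] at h
        exact absurd (congrArg (fun z => z.snd) h) hz.1
      · rw [h, Equiv.symm_apply_apply]

/-- The neighbours on the boundary of a vertex that is adjacent to the tail of `d` only. -/
theorem exists_pair_of_adj_fst (hR : R.IsTriangulated) (hrot₂ : ∀ d, R.rot (R.rot d) ≠ d)
    {d : T.Dart} (h₁ : R.HasInducedLink d.fst)
    (hno : ∀ a b, T.Adj d.fst a → a ≠ d.snd → ¬ T.Adj d.snd a → T.Adj d.snd b → b ≠ d.fst →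
      ¬ T.Adj d.fst b → ¬ T.Adj a b) {u : W} (hu : u ∈ starBoundary d)
    (hu₁ : T.Adj d.fst u) (hu₂ : ¬ T.Adj d.snd u) :
    ∃ v w, v ≠ w ∧ v ∈ starBoundary d ∧ w ∈ starBoundary d ∧ T.Adj u v ∧
      T.Adj u w ∧ ∀ z ∈ starBoundary d, T.Adj u z → z = v ∨ z = w := by
  let e : T.Dart := ⟨(d.fst, u), hu₁⟩
  have hmem : ∀ w, T.Adj d.fst w → T.Adj u w → w ∈ starBoundary d := fun w hw huw =>
    ⟨hw.ne', fun h => hu₂ (h ▸ huw.symm), Or.inl hw⟩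
  refine ⟨(R.rot e).snd, (R.rot.symm e).snd, rot_snd_ne_rot_symm_snd hrot₂ _,
    hmem _ (adj_rot_snd_left e) (hR.adj_rot_snd e),
    hmem _ (adj_rot_symm_snd_left e) (hR.adj_rot_symm_snd e), hR.adj_rot_snd e,
    hR.adj_rot_symm_snd e, fun z hz huz => ?_⟩
  by_cases hz' : T.Adj d.fst z
  · rcases h₁ (d := e) (d' := ⟨(d.fst, z), hz'⟩) rfl rfl huz with h | h
    · left; rw [← h]
    · right; rw [h, Equiv.symm_apply_apply]
  · exact absurd huz (hno u z hu₁ hu.2.1 hu₂ (hz.2.2.resolve_left hz') hz.1 hz')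

/-- The boundary of the union of the stars of two adjacent vertices of odd degree. -/
theorem exists_isEvenTwoRegular_of_odd [Finite W] (hR : R.IsTriangulated)
    (hrot₂ : ∀ d, R.rot (R.rot d) ≠ d) (hrot₃ : ∀ d, R.rot (R.rot (R.rot d)) ≠ d) {d : T.Dart}
    (h₁ : R.HasInducedLink d.fst) (h₂ : R.HasInducedLink d.snd)
    (hodd₁ : Odd (T.neighborSet d.fst).ncard) (hodd₂ : Odd (T.neighborSet d.snd).ncard)
    (hno : ∀ a b, T.Adj d.fst a → a ≠ d.snd → ¬ T.Adj d.snd a → T.Adj d.snd b → b ≠ d.fst →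
      ¬ T.Adj d.fst b → ¬ T.Adj a b) : ∃ X b, T.IsEvenTwoRegular X b := by
  classical
  obtain ⟨θ, hθ0, hθ⟩ := R.exists_angle d
  obtain ⟨η, hη0, hη⟩ := R.exists_angle d.symm
  have hno' : ∀ a b, T.Adj d.symm.fst a → a ≠ d.symm.snd → ¬ T.Adj d.symm.snd a →
      T.Adj d.symm.snd b → b ≠ d.symm.fst → ¬ T.Adj d.symm.fst b → ¬ T.Adj a b :=
    fun a b ha ha' ha'' hb hb' hb'' hab => hno b a hb hb' hb'' ha ha' ha'' hab.symm
  -- Boundary vertices are numbered around each end of `d`, with a shift by one at the head. The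
  -- numberings agree mod 2 at the two common neighbours because both degrees are odd: `1` against
  -- the degree of the head at one, the degree of the tail minus one against `2` at the other.
  let b : W → ZMod 2 := fun w =>
    if h : T.Adj d.fst w then (θ ⟨(d.fst, w), h⟩ : ℕ)
    else if h : T.Adj d.snd w then (η ⟨(d.snd, w), h⟩ + 1 : ℕ) else 0
  have hb₁ : ∀ (w : W) (h : T.Adj d.fst w), b w = (θ ⟨(d.fst, w), h⟩ : ℕ) := fun w h => dif_pos h
  have hb₂ : ∀ (w : W) (h : T.Adj d.snd w), w ≠ d.fst → b w = (η ⟨(d.snd, w), h⟩ + 1 : ℕ) := by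
    intro w h hw
    by_cases h' : T.Adj d.fst w
    · rw [hb₁ w h']
      rcases h₁ (d := d) (d' := ⟨(d.fst, w), h'⟩) rfl rfl h with h3 | h3
      · have h4 : R.rot ⟨(d.snd, w), h⟩ = d.symm := by
          rw [← Equiv.eq_symm_apply]
          refine Dart.eq_of_fst_snd (by rw [rot_symm_fst]; rfl) ?_
          rw [hR.rot_symm_symm_snd, ← h3]
        have h5 := (hη ⟨(d.snd, w), h⟩ rfl).2 h4
        rw [h3, (hθ d rfl).1 (hR.rot_ne d), hθ0, h5]
        have h6 : (((T.neighborSet d.snd).ncard : ℕ) : ZMod 2) = 1 :=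
          ZMod.natCast_eq_one_iff_odd.mpr hodd₂
        rw [Dart.fst_symm, h6]; simp
      · have h4 : R.rot d.symm = ⟨(d.snd, w), h⟩ := by
          refine Dart.eq_of_fst_snd (by rw [rot_fst]; rfl) ?_
          have h7 : R.rot.symm d = ⟨(d.fst, w), h'⟩ := (Equiv.symm_apply_eq _).mpr h3
          rw [hR.rot_symm_snd, h7]
        have h5 := (hη d.symm rfl).1 (hR.rot_ne _)
        rw [h4, hη0] at h5
        have h6 := (hθ ⟨(d.fst, w), h'⟩ rfl).2 h3.symm
        rw [h5]
        have h7 : ((θ ⟨(d.fst, w), h'⟩ + 1 : ℕ) : ZMod 2) = 1 := by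
          rw [h6]; exact ZMod.natCast_eq_one_iff_odd.mpr hodd₁
        rw [Nat.cast_add, Nat.cast_one] at h7
        have h8 : ∀ z : ZMod 2, z + 1 = 1 → z = 0 := by decide
        rw [h8 _ h7]
        rfl
    · simp only [b, dif_neg h', dif_pos h]
  refine ⟨starBoundary d, b, ?_, ?_, ?_⟩
  · obtain ⟨v, -, -, hv, -⟩ := exists_pair_common hR hrot₂ hrot₃ h₁ h₂
    exact ⟨v, hv⟩
  · intro u hu v hv huv
    have hfst : ∀ {u v}, u ∈ starBoundary d → v ∈ starBoundary d → T.Adj d.fst u → T.Adj d.fst v →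
        T.Adj u v → b u ≠ b v := by
      intro u v hu hv hu' hv' huv
      rw [hb₁ u hu', hb₁ v hv']
      rcases h₁ (d := ⟨(d.fst, u), hu'⟩) (d' := ⟨(d.fst, v), hv'⟩) rfl rfl huv with h | h
      · have h3 := (hθ ⟨(d.fst, u), hu'⟩ rfl).1
          (by rw [← h]; exact fun h4 => hv.2.1 (congrArg (fun z => z.snd) h4))
        rw [h, h3]
        exact (natCast_add_one_ne _).symm
      · have h3 := (hθ ⟨(d.fst, v), hv'⟩ rfl).1
          (by rw [← h]; exact fun h4 => hu.2.1 (congrArg (fun z => z.snd) h4))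
        rw [h, h3]
        exact natCast_add_one_ne _
    have hsnd : ∀ {u v}, u ∈ starBoundary d → v ∈ starBoundary d → T.Adj d.snd u → T.Adj d.snd v →
        T.Adj u v → b u ≠ b v := by
      intro u v hu hv hu' hv' huv
      rw [hb₂ u hu' hu.1, hb₂ v hv' hv.1]
      rcases h₂ (d := ⟨(d.snd, u), hu'⟩) (d' := ⟨(d.snd, v), hv'⟩) rfl rfl huv with h | h
      · have h3 := (hη ⟨(d.snd, u), hu'⟩ rfl).1
          (by rw [← h]; exact fun h4 => hv.1 (congrArg (fun z => z.snd) h4))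
        rw [h, h3]
        exact (natCast_add_one_ne _).symm
      · have h3 := (hη ⟨(d.snd, v), hv'⟩ rfl).1
          (by rw [← h]; exact fun h4 => hu.1 (congrArg (fun z => z.snd) h4))
        rw [h, h3]
        exact natCast_add_one_ne _
    by_cases hu₁ : T.Adj d.fst u <;> by_cases hv₁ : T.Adj d.fst v
    · exact hfst hu hv hu₁ hv₁ huv
    · have hv₂ := hv.2.2.resolve_left hv₁
      by_cases hu₂ : T.Adj d.snd u
      · exact hsnd hu hv hu₂ hv₂ huv
      · exact absurd huv (hno u v hu₁ hu.2.1 hu₂ hv₂ hv.1 hv₁)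
    · have hu₂ := hu.2.2.resolve_left hu₁
      by_cases hv₂ : T.Adj d.snd v
      · exact hsnd hu hv hu₂ hv₂ huv
      · exact absurd huv.symm (hno v u hv₁ hv.2.1 hv₂ hu₂ hu.1 hu₁)
    · exact hsnd hu hv (hu.2.2.resolve_left hu₁) (hv.2.2.resolve_left hv₁) huv
  · intro u hu
    by_cases hu₁ : T.Adj d.fst u
    · by_cases hu₂ : T.Adj d.snd u
      · rcases h₁.eq_of_adj_adj hu₁ hu₂ with rfl | rfl
        · exact exists_pair_common hR hrot₂ hrot₃ h₁ h₂
        · have := exists_pair_common (d := d.symm) hR hrot₂ hrot₃ h₂ h₁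
          rw [starBoundary_symm, hR.rot_symm_snd] at this
          exact this
      · exact exists_pair_of_adj_fst hR hrot₂ h₁ hno hu hu₁ hu₂
    · have := exists_pair_of_adj_fst (d := d.symm) hR hrot₂ h₂ hno' (u := u)
        (by rw [starBoundary_symm]; exact hu) (hu.2.2.resolve_left hu₁) hu₁
      rw [starBoundary_symm] at this
      exact this

/-- A triangulation of the sphere with minimum degree at least four has an induced even cycle. -/
theorem IsTriangulated.exists_isEvenTwoRegular [Finite W] [Nontrivial W] (hR : R.IsTriangulated)
    (hgenus : R.HasGenus 0) (hrot₂ : ∀ d, R.rot (R.rot d) ≠ d)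
    (hrot₃ : ∀ d, R.rot (R.rot (R.rot d)) ≠ d) : ∃ X b, T.IsEvenTwoRegular X b := by
  obtain ⟨d, h₁, h₂⟩ := hgenus.exists_hasInducedLink hR.rot_ne hrot₂ hrot₃
  rcases Nat.even_or_odd (T.neighborSet d.fst).ncard with heven | hodd₁
  · exact h₁.exists_isEvenTwoRegular hR hrot₂ heven
  rcases Nat.even_or_odd (T.neighborSet d.snd).ncard with heven | hodd₂
  · exact HasInducedLink.exists_isEvenTwoRegular (e := d.symm) hR hrot₂ h₂ heven
  by_cases hno : ∀ a b, T.Adj d.fst a → a ≠ d.snd → ¬ T.Adj d.snd a → T.Adj d.snd b → b ≠ d.fst →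
      ¬ T.Adj d.fst b → ¬ T.Adj a b
  · exact exists_isEvenTwoRegular_of_odd hR hrot₂ hrot₃ h₁ h₂ hodd₁ hodd₂ hno
  · push Not at hno
    obtain ⟨a, b, ha, ha', ha'', hb, hb', hb'', hab⟩ := hno
    exact isEvenTwoRegular_fourCycle ha hab hb.symm d.adj.symm hb'.symm hb'' ha'
      (fun h => ha'' h.symm)

end RotationSystem

end SimpleGraph

/-! ### Reduction of a triangulation to an Apollonian network. -/

namespace SimpleGraph

namespace RotationSystem

variable {W : Type*} {T : SimpleGraph W} {R : RotationSystem T}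

theorem eq_of_rot_rot_rot {d e : T.Dart} (hd : R.rot (R.rot (R.rot d)) = d)
    (he : e.fst = d.fst) : e = d ∨ e = R.rot d ∨ e = R.rot (R.rot d) := by
  have key := R.eq_of_rot_invariant
    (f := fun e => e = d ∨ e = R.rot d ∨ e = R.rot (R.rot d)) (fun e => by
      refine propext ⟨?_, ?_⟩
      · rintro (h | h | h)
        · right; right
          refine R.rot.injective ?_
          rw [h, hd]
        · left; exact R.rot.injective h
        · right; left; exact R.rot.injective h
      · rintro (rfl | rfl | rfl)
        · right; left; rfl
        · right; right; rfl
        · left; exact hd) he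
  rw [key]
  exact Or.inl rfl

theorem IsTriangulated.mapIso {W' : Type*} {T' : SimpleGraph W'} (hR : R.IsTriangulated)
    (e : T ≃g T') : (R.mapIso e).IsTriangulated := by
  intro d
  obtain ⟨d, rfl⟩ := e.dartEquiv.surjective d
  rw [mapIso_next_apply, mapIso_next_apply, mapIso_next_apply, hR]

end RotationSystem

/-- The graph isomorphism that restores a deleted vertex of degree three. -/
def subdivideIso {W W₀ : Type*} [DecidableEq W] {T : SimpleGraph W} {T₀ : SimpleGraph W₀} {n : W}
    (e : T.induce {w | w ≠ n} ≃g T₀) {x y z : {w | w ≠ n}}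
    (hn : ∀ w, T.Adj n w ↔ w = x ∨ w = y ∨ w = z) :
    T₀.subdivideTriangle (e x) (e y) (e z) ≃g T where
  toEquiv := (Equiv.optionCongr e.toEquiv.symm).trans (Equiv.optionSubtypeNe n)
  map_rel_iff' := by
    have hmem : ∀ w : W₀, T.Adj n (e.symm w).1 ↔ w = e x ∨ w = e y ∨ w = e z := by
      intro w
      rw [hn, ← Subtype.ext_iff, ← Subtype.ext_iff, ← Subtype.ext_iff]
      exact or_congr (e.toEquiv.symm_apply_eq) (or_congr e.toEquiv.symm_apply_eq
        e.toEquiv.symm_apply_eq)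
    rintro (_ | u) (_ | v)
    · exact iff_of_false (T.irrefl) id
    · exact hmem v
    · exact (T.adj_comm _ _).trans (hmem u)
    · exact e.symm.map_adj_iff

theorem nonempty_iso_top_of_card {W : Type*} [Finite W] {T : SimpleGraph W} (hW : Nat.card W = 4)
    (h : ∀ v, 3 ≤ (T.neighborSet v).ncard) : Nonempty (T ≃g (⊤ : SimpleGraph (Fin 4))) := by
  have htop : ∀ u v, T.Adj u v ↔ u ≠ v := by
    intro u v
    refine ⟨fun h => h.ne, fun huv => ?_⟩
    have hsub : T.neighborSet u ⊆ {u}ᶜ := fun w hw => (T.ne_of_adj hw).symm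
    have hcard : ({u}ᶜ : Set W).ncard = 3 := by
      have := Set.ncard_add_ncard_compl ({u} : Set W)
      rw [Set.ncard_singleton, hW] at this
      omega
    have heq := Set.eq_of_subset_of_ncard_le hsub (by rw [hcard]; exact h u)
    have : v ∈ T.neighborSet u := by
      rw [heq]
      exact huv.symm
    exact this
  refine ⟨⟨Finite.equivFinOfCardEq hW, ?_⟩⟩
  intro u v
  rw [htop, top_adj, ne_eq, ne_eq, Equiv.apply_eq_iff_eq]

open RotationSystem in
/-- A triangulation of the sphere without induced even cycles is an Apollonian network. -/
theorem exists_isApollonianNetwork_iso (n : ℕ) : ∀ {W : Type*} [Finite W] {T : SimpleGraph W}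
    {R : RotationSystem T}, R.IsTriangulated → R.HasGenus 0 → Nat.card W = n + 4 →
    (∀ X b, ¬ T.IsEvenTwoRegular X b) →
    ∃ (W₀ : Type) (T₀ : SimpleGraph W₀), IsApollonianNetwork T₀ ∧ Nonempty (T ≃g T₀) := by
  classical
  induction n with
  | zero =>
    intro W _ T R hR hgenus hW hno
    have : Nontrivial W := Finite.one_lt_card_iff_nontrivial.mp (by omega)
    have hrot₂ := hR.rot_rot_ne hgenus.1 (by omega)
    refine ⟨Fin 4, ⊤, .completeGraph, nonempty_iso_top_of_card hW fun v => ?_⟩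
    obtain ⟨d, rfl⟩ := hgenus.1.exists_dart_fst v
    by_contra! hlt
    have h1 := (R.rot_pow_eq_iff d 1).not.mp (hR.rot_ne d)
    have h2 := (R.rot_pow_eq_iff d 2).not.mp (hrot₂ d)
    have h0 : (T.neighborSet d.fst).ncard ≠ 0 := ((Set.ncard_pos).mpr ⟨d.snd, d.adj⟩).ne'
    interval_cases (T.neighborSet d.fst).ncard <;> simp_all
  | succ n ih =>
    intro W _ T R hR hgenus hW hno
    have : Nontrivial W := Finite.one_lt_card_iff_nontrivial.mp (by omega)
    have hrot₂ := hR.rot_rot_ne hgenus.1 (by omega)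
    -- Without induced even cycles the minimum degree is at most three.
    obtain ⟨d, hd⟩ : ∃ d, R.rot (R.rot (R.rot d)) = d := by
      by_contra! hcon
      obtain ⟨X, b, hX⟩ := hR.exists_isEvenTwoRegular hgenus hrot₂ hcon
      exact hno X b hX
    let j : T.induce {w | w ≠ d.fst} ↪g T := Embedding.induce _
    have hj : j.IsDeletion d.fst := by
      intro w
      constructor
      · intro h; exact ⟨⟨w, h⟩, rfl⟩
      · rintro ⟨w, rfl⟩; exact w.2
    have hdeg : (T.neighborSet d.fst).ncard = 3 := by
      have h3 := (R.rot_pow_eq_iff d 3).mp hd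
      have h1 := (R.rot_pow_eq_iff d 1).not.mp (hR.rot_ne d)
      rcases (Nat.dvd_prime Nat.prime_three).mp h3 with h | h
      · rw [h] at h1; exact absurd dvd_rfl h1
      · exact h
    obtain ⟨S, hS⟩ := R.exists_isDeletion hj hR.rot_ne
    have hStri : S.IsTriangulated := hS.isTriangulated hj hR fun e he =>
      (R.rot_pow_eq_iff e 3).mpr (by rw [he, hdeg])
    have hsymm : R.rot.symm d = R.rot (R.rot d) := by rw [Equiv.symm_apply_eq, hd]
    have hcases : ∀ w, T.Adj d.fst w ↔
        w = (R.rot d).snd ∨ w = d.snd ∨ w = (R.rot.symm d).snd := by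
      intro w
      constructor
      · intro hw
        rcases eq_of_rot_rot_rot (e := ⟨(d.fst, w), hw⟩) hd rfl with h | h | h
        · right; left; rw [← h]
        · left; rw [← h]
        · right; right; rw [hsymm, ← h]
      · rintro (rfl | rfl | rfl)
        · exact adj_rot_snd_left d
        · exact d.adj
        · exact adj_rot_symm_snd_left d
    have hconn : (T.induce {w | w ≠ d.fst}).Connected := by
      refine hj.connected hgenus.1 (a := ⟨d.snd, d.snd_ne_fst⟩) fun b hb => ?_
      rcases (hcases b.1).mp hb with h | h | h
      · right
        change T.Adj d.snd b.1
        rw [h]; exact hR.adj_rot_snd d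
      · left; exact Subtype.ext h
      · right
        change T.Adj d.snd b.1
        rw [h]; exact hR.adj_rot_symm_snd d
    have hcardW := hj.card
    have hSgenus : S.HasGenus 0 := by
      rw [hStri.hasGenus_zero_iff hconn]
      have h1 := (hR.hasGenus_zero_iff hgenus.1).mp hgenus
      have h2 := hj.card_dart
      rw [hdeg] at h2
      omega
    obtain ⟨W₀, T₀, hT₀, ⟨e⟩⟩ := ih hStri hSgenus (by omega)
      fun X b hX => hno _ _ (hX.map j)
    have hnext : R.next (R.next.symm d.symm) = d.symm := Equiv.apply_symm_apply _ _
    have hfst : (R.next.symm d.symm).fst = (R.rot d).snd := by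
      rw [next_symm_apply, hR.rot_symm_symm, Dart.symm_symm, next_fst]
    -- `f` is the outer side of a triangle at the deleted vertex. Its face in `S` is the merged
    -- triangle, whose corners are the three neighbours to which the vertex is to be rejoined.
    obtain ⟨f, hf⟩ := hj.exists_dart (d := R.next.symm d.symm)
      (by rw [hfst]; exact (adj_rot_snd_left d).ne')
      (by rw [next_symm_snd]; exact d.snd_ne_fst)
    rw [← hf] at hnext
    have h1 := hS.dart_next_of_next_eq rfl hnext
    have h2 := hS.dart_next_of_next_eq (R.rot_symm_fst d) (hS.next_dart_next hR rfl hnext)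
    have hx : f.fst.1 = (R.rot d).snd := by
      rw [← hfst, ← hf]; rfl
    have hy : (S.next f).fst.1 = d.snd := by
      have := congrArg (fun z => z.fst) h1
      rwa [next_fst] at this
    have hz : (S.next (S.next f)).fst.1 = (R.rot.symm d).snd := by
      have := congrArg (fun z => z.fst) h2
      rwa [next_fst] at this
    have hiso := subdivideIso e (x := f.fst) (y := (S.next f).fst) (z := (S.next (S.next f)).fst)
      (by intro w; rw [hx, hy, hz]; exact hcases w)
    have hnet := IsApollonianNetwork.subdivide T₀ hT₀ (S.mapIso e) (hSgenus.mapIso e)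
      (e.dartEquiv f) (hStri.mapIso e _)
    rw [mapIso_next_apply, mapIso_next_apply] at hnet
    exact ⟨_, _, hnet, ⟨hiso.symm⟩⟩

end SimpleGraph

/-! ### The characterization. -/

theorem mainTheorem1 {V : Type*} [Finite V] (G : SimpleGraph V) [G.LocallyFinite]
    (hconn : G.IsThreeConnected) (hcubic : G.IsRegularOfDegree 3) (hplanar : G.IsPlanar) :
    G.IsApollonianDual ↔ ∀ g : ℕ, 0 < g → ¬ G.HasStrongOrientableEmbedding g := by
  constructor
  · rintro h g hg ⟨S, hS, hstrong⟩
    exact hg.ne' (h.genus_eq_zero hcubic hstrong hS)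
  · intro h
    obtain ⟨R, hR⟩ := hplanar
    have := hconn.nontrivial
    have h3 := hcubic.ncard_neighborSet
    have hds := hconn.isDualSimple h3 hR
    have htri : (R.dual hds).IsTriangulated := by
      intro d
      obtain ⟨d, rfl⟩ := (R.dualDart hds).surjective d
      simp only [SimpleGraph.RotationSystem.dual_next]
      congr 1
      exact (R.rot_pow_eq_iff d 3).mpr (by rw [h3])
    have hgenus := hR.dual hds
    -- The subtraction is not truncated: cubicity and Euler's formula give `2 * F = V + 4` with `V >
    -- 3`.
    have hcard : Nat.card R.Face = (Nat.card R.Face - 4) + 4 := by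
      have h1 := (R.hasGenus_iff hR.1 0).mp hR
      have h2 := htri.card_face
      rw [Nat.card_congr (R.dualFaceEquiv hds hR.1), ← Nat.card_congr (R.dualDart hds)] at h2
      have := hconn.1
      omega
    obtain ⟨W₀, T₀, hT₀, ⟨e⟩⟩ := SimpleGraph.exists_isApollonianNetwork_iso _ htri
      hgenus hcard fun X b hX => by
        obtain ⟨g, hg, hS⟩ := hX.exists_strong hR hds htri
        exact h g hg hS
    exact ⟨W₀, T₀, (R.dual hds).mapIso e, hT₀, hgenus.mapIso e,
      ⟨(R.dualDualIso hds hR.1).symm.trans ((R.dual hds).dualGraphMapIso e)⟩⟩
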